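/- **Setting.** For a sequence $v:\mathbb Z\to\mathbb C$, $\delta>0$ and $p\in[1,\infty]$ let $\|v\|_{\ell^{p,\delta}}$ be the $\ell^p(\mathbb Z)$ norm of $n\mapsto e^{\delta|n|}v(n)$, and for $\varepsilon\in(0,1)$, $C>0$ let $$B^\delta_{\varepsilon,C}=\{v:\ \|v\|_{\ell^{p,\delta}}\le C\varepsilon^{\frac12-\frac1p}\ \text{ for all } p\in[1,\infty]\}.$$ Write $P=\sum_n|v(n)|^2$. Fix a sign $\sigma\in\{1,-1\}$ and consider the Hamiltonian $$H(v)=\Lambda_2+H_4,\qquad \Lambda_2=i\sum_n n^2|v(n)|^2,\qquad H_4=\sigma i\sum_{m_1+m_2=m_3+m_4}v(m_1)v(m_2)\bar v(m_3)\bar v(m_4),$$ whose flow $\dot v(n)=\partial H/\partial\bar v(n)$ is the periodic cubic nonlinear Schrödinger equation in Fourier variables. Put $$F_1=\sigma\sum_{l(m)=0,\;q(m)\ne0}\frac{v(m_1)v(m_2)\bar v(m_3)\bar v(m_4)}{q(m)},$$ with $l(m)=m_1+m_2-m_3-m_4$, $q(m)=m_1^2+m_2^2-m_3^2-m_4^2$,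 and $$F_2=\sum_{\substack{m_4,m_5\ne m_1,\ m_2,m_3\ne m_6\\ l(m)=0,\ q(m)\neq0}}\frac{v(m_1)v(m_2)v(m_3)\bar v(m_4)\bar v(m_5)\bar v(m_6)}{q(m)(m_2-m_6)(m_6-m_3)}\;-\;\text{c.c.},$$ with $l(m)=m_1+m_2+m_3-m_4-m_5-m_6$ and $q(m)=m_1^2+m_2^2+m_3^2-m_4^2-m_5^2-m_6^2$. Let $X_F^s$ be the time $s$ map of $\frac{dw(n)}{ds}=\frac{\partial F}{\partial\bar w(n)}$ (solutions being continuous curves in $\ell^1$). Define $R$ by $$H\circ X^1_{F_1}\circ X^1_{F_2}=\Lambda_2+2\sigma i\Big(\sum_m|v(m)|^2\Big)^2+R,\qquad\text{and}\qquad E(v)(n)=\frac{\partial R}{\partial\bar v(n)}(v).$$ **Proposition.** For every $C>0$ there is $\varepsilon_0\in(0,1)$, depending only on $C$ (and $\sigma$), such that for all $\delta>0$, $\varepsilon\in(0,\varepsilon_0)$ and $v\in B^\delta_{\varepsilon,C}$ the following holds. 1. The flow line of $F_2$ that starts at $v$, and the flow line of $F_1$ that starts at $X^1_{F_2}(v)$,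 exist on $0\le s\le1$ and are unique. The transformed Hamiltonian $H\circ X^1_{F_1}\circ X^1_{F_2}$ is (real) differentiable at $v$ in each coordinate $v(n)$, and the right-hand side of the transformed equation $\dot v(n)=\partial(H\circ X^1_{F_1}\circ X^1_{F_2})/\partial\bar v(n)$ has the form $$\frac{\partial(H\circ X^1_{F_1}\circ X^1_{F_2})}{\partial\bar v(n)}=i(n^2+4\sigma P)v(n)+E(v)(n),\qquad n\in\mathbb Z.$$ 2. For every $p\in[1,\infty]$ and every $\gamma>0$, $$\|E(v)\|_{\ell^{p,\delta}}\le K\,\varepsilon^{\frac32-\frac1p-\gamma},$$ where $K$ depends only on $C$, $p$ and $\gamma$ (and $\sigma$), and not on $\delta$, $\varepsilon$ or $v$. For $\sigma=1$ the transformed equation is $\dot v(n)=i(n^2+4P)v(n)+E(v)(n)$. -/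

import Mathlib

open scoped ENNReal ComplexConjugate

noncomputable section

namespace QuasiLinear

/-! ### Weighted norms and the class of data -/

/-- The weighted norm `‖f‖_{ℓ^{p,δ}}`: the `ℓ^p(ℤ)` norm of `e^{δ|n|} f(n)`, with values in
`[0, ∞]` (for `p = ∞` this is the supremum). -/
def wnorm (p : ℝ≥0∞) (δ : ℝ) (f : ℤ → ℂ) : ℝ≥0∞ :=
  MeasureTheory.eLpNorm (fun n : ℤ => Real.exp (δ * |(n : ℝ)|) • f n) p
    MeasureTheory.Measure.count

/-- The set `B^δ_{ε,C}`, on the side of Fourier coefficients: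
`‖f‖_{ℓ^{p,δ}} ≤ C ε^{1/2 - 1/p}` for all `p ∈ [1, ∞]` (here `1/∞ = 0`). -/
def dataSet (δ ε C : ℝ) : Set (ℤ → ℂ) :=
  {f | ∀ p : ℝ≥0∞, 1 ≤ p →
    wnorm p δ f ≤ ENNReal.ofReal (C * ε ^ ((1 : ℝ) / 2 - (p⁻¹).toReal))}

/-! ### Derivatives with respect to the conjugate variables, Hamiltonian flows -/

/-- The Wirtinger derivative `∂A/∂v̄(n) = (1/2) (∂A/∂(Re v(n)) + i ∂A/∂(Im v(n)))` at `v`. -/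
def dbar (A : (ℤ → ℂ) → ℂ) (v : ℤ → ℂ) (n : ℤ) : ℂ :=
  (1 / 2 : ℂ) *
    (fderiv ℝ (fun z : ℂ => A (Function.update v n z)) (v n) 1
      + Complex.I * fderiv ℝ (fun z : ℂ => A (Function.update v n z)) (v n) Complex.I)

/-- `w` is a solution on `0 ≤ s ≤ 1` of `dw(n)/ds = ∂F/∂w̄(n)`, `w(0) = v`, which is a continuous
curve in `ℓ¹(ℤ)`. -/
structure IsFlowLine (F : (ℤ → ℂ) → ℂ) (v : ℤ → ℂ) (w : ℝ → lp (fun _ : ℤ => ℂ) 1) : Prop where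
  initial : (w 0 : ℤ → ℂ) = v
  continuousOn : ContinuousOn w (Set.Icc 0 1)
  hasDeriv : ∀ s ∈ Set.Icc (0 : ℝ) 1, ∀ n : ℤ,
    HasDerivWithinAt (fun t => (w t : ℤ → ℂ) n) (dbar F (w s : ℤ → ℂ) n) (Set.Icc 0 1) s

/-- The flow line of `F` which starts at `v` exists on `[0, 1]` and is unique. -/
def HasUniqueFlowLine (F : (ℤ → ℂ) → ℂ) (v : ℤ → ℂ) : Prop :=
  ∃ w, IsFlowLine F v w ∧ ∀ w', IsFlowLine F v w' → Set.EqOn w' w (Set.Icc 0 1)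

open Classical in
/-- The time `s` map `X_F^s`, `0 ≤ s ≤ 1` (with value `v` where there is no flow line). -/
def flowMap (F : (ℤ → ℂ) → ℂ) (s : ℝ) (v : ℤ → ℂ) : ℤ → ℂ :=
  if h : ∃ w, IsFlowLine F v w then (h.choose s : ℤ → ℂ) else v

/-! ### The Hamiltonian -/

/-- `P = ∑ |v(n)|²`. -/
def mass (v : ℤ → ℂ) : ℝ := ∑' n : ℤ, ‖v n‖ ^ 2

/-- `Λ₂(v) = i ∑ n² |v(n)|²`. -/
def quadPart (v : ℤ → ℂ) : ℂ := Complex.I * ((∑' n : ℤ, (n : ℝ) ^ 2 * ‖v n‖ ^ 2 : ℝ) : ℂ)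

/-- Indices with `l(m) = m₁ + m₂ - m₃ - m₄ = 0` (numbered from `0` here). -/
def zeroSum4 : Set (Fin 4 → ℤ) := {m | m 0 + m 1 - m 2 - m 3 = 0}

/-- `q(m) = m₁² + m₂² - m₃² - m₄²`. -/
def q4 (m : Fin 4 → ℤ) : ℤ := m 0 ^ 2 + m 1 ^ 2 - m 2 ^ 2 - m 3 ^ 2

/-- `v(m₁) v(m₂) v̄(m₃) v̄(m₄)`. -/
def monomial4 (v : ℤ → ℂ) (m : Fin 4 → ℤ) : ℂ := v (m 0) * v (m 1) * conj (v (m 2)) * conj (v (m 3))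

/-- The quartic part `σ i ∑_{l(m) = 0} v(m₁) v(m₂) v̄(m₃) v̄(m₄)`. -/
def quarticPart (σ : ℝ) (v : ℤ → ℂ) : ℂ := σ * Complex.I * ∑' m : zeroSum4, monomial4 v m

/-- The Hamiltonian `H = Λ₂ + H₄`. -/
def hamiltonian (σ : ℝ) (v : ℤ → ℂ) : ℂ := quadPart v + quarticPart σ v

/-- The part `H₄^{r2} = 2 σ i ∑_{m₁, m₂} |v(m₁)|² |v(m₂)|²` of the resonant quartic terms. -/
def resonantPart (σ : ℝ) (v : ℤ → ℂ) : ℂ := 2 * σ * Complex.I * (mass v : ℂ) ^ 2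

/-! ### The two normal form transformations -/

/-- Non-resonant quadruples: `l(m) = 0`, `q(m) ≠ 0`. -/
def nonres4 : Set (Fin 4 → ℤ) := {m | m ∈ zeroSum4 ∧ q4 m ≠ 0}

/-- `F₁ = σ ∑ v(m₁) v(m₂) v̄(m₃) v̄(m₄) / q(m)`, over `l(m) = 0`, `q(m) ≠ 0`. -/
def genF1 (σ : ℝ) (v : ℤ → ℂ) : ℂ := σ * ∑' m : nonres4, monomial4 v m / (q4 m : ℂ)

/-- `q(m) = m₁² + m₂² + m₃² - m₄² - m₅² - m₆²`. -/
def q6 (m : Fin 6 → ℤ) : ℤ := m 0 ^ 2 + m 1 ^ 2 + m 2 ^ 2 - m 3 ^ 2 - m 4 ^ 2 - m 5 ^ 2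

/-- Sextuples with `l(m) = m₁ + m₂ + m₃ - m₄ - m₅ - m₆ = 0`, `q(m) ≠ 0`, `m₄, m₅ ≠ m₁`,
`m₂, m₃ ≠ m₆`. -/
def nonres6 : Set (Fin 6 → ℤ) :=
  {m | m 0 + m 1 + m 2 - m 3 - m 4 - m 5 = 0 ∧ q6 m ≠ 0 ∧
    m 3 ≠ m 0 ∧ m 4 ≠ m 0 ∧ m 1 ≠ m 5 ∧ m 2 ≠ m 5}

/-- `v(m₁) v(m₂) v(m₃) v̄(m₄) v̄(m₅) v̄(m₆)`. -/
def monomial6 (v : ℤ → ℂ) (m : Fin 6 → ℤ) : ℂ :=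
  v (m 0) * v (m 1) * v (m 2) * conj (v (m 3)) * conj (v (m 4)) * conj (v (m 5))

/-- The sum `∑ v(m₁) v(m₂) v(m₃) v̄(m₄) v̄(m₅) v̄(m₆) / (q(m) (m₂ - m₆) (m₆ - m₃))`. -/
def halfF2 (v : ℤ → ℂ) : ℂ :=
  ∑' m : nonres6, monomial6 v m /
    ((q6 m : ℂ) * ((m.1 1 - m.1 5 : ℤ) : ℂ) * ((m.1 5 - m.1 2 : ℤ) : ℂ))

/-- `F₂`: the preceding sum minus its complex conjugate. -/
def genF2 (v : ℤ → ℂ) : ℂ := halfF2 v - conj (halfF2 v)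

/-- The change of variables `u = X_{F₁}^1 (X_{F₂}^1 (v))`. -/
def normalForm (σ : ℝ) (v : ℤ → ℂ) : ℤ → ℂ := flowMap (genF1 σ) 1 (flowMap genF2 1 v)

/-- The transformed Hamiltonian `H ∘ X_{F₁}^1 ∘ X_{F₂}^1`. -/
def transformedHamiltonian (σ : ℝ) (v : ℤ → ℂ) : ℂ := hamiltonian σ (normalForm σ v)

/-- The remainder `R` in `H ∘ X_{F₁}^1 ∘ X_{F₂}^1 = Λ₂ + H₄^{r2} + R`. -/
def remainder (σ : ℝ) (v : ℤ → ℂ) : ℂ :=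
  transformedHamiltonian σ v - quadPart v - resonantPart σ v

/-- The error term `E(v)(n) = ∂R/∂v̄(n)`. -/
def errorTerm (σ : ℝ) (v : ℤ → ℂ) (n : ℤ) : ℂ := dbar (remainder σ) v n

end QuasiLinear

end

open QuasiLinear

/-! Put N = 1/ε. The cases p = ∞ and p = 1 of the hypothesis say that max(sup, N⁻¹ ∑) of
e^{δ|n|}|v(n)| is at most C√ε; this is the norm `nB`. Conversely a bound A for `nB` gives A N^{1/p}
in ℓ^{p,δ} by interpolation (`wnorm_le`). So it suffices to bound the gradient of the remainder by
ε^{3/2-γ} in `nB`.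

Multilinear estimates. On l = 0 the function q factorises for quadruples and is a difference of two
products for sextuples, so all Hamiltonians are forms whose kernels are dominated by products of
weights 1/|a|. A sum of f(a)/|a| costs only log N: use the sup of f for |a| ≤ N and its ℓ¹ norm
beyond. A sum without a weight costs N. Hence the gradients (`SlotBound`) have constants log²N for
F₁, N² log²N for the sextic terms and N log³N for F₂, where 1/q saves a factor N. The sextic terms
with q = 0 obey the same bound as F₂, and ∑|v(n)|⁴ has constant 1. The exponential weight is free,
because l = 0 bounds each |m_j| by the sum of the others (`SlotBound.weight`); so no constant
depends on δ.

Algebra, after division by i. Along the flow of F₁ the derivative of ∑ n²|v|² is minus σ times the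
nonresonant quartic form, and the derivative of that form is 4σ Z with Z sextic, obtained by joining
two quadruples. A Taylor formula of second order turns ∑ n²|v|² plus the nonresonant quartic part
into ∑ n²|v|² + 2Z plus an integral of the derivative of Z. Along the flow of F₂ the derivative of ∑
n²|v|² is -2 times the part of Z with q ≠ 0, which removes that part at first order. Both flows
conserve the mass. What remains is `remX`: two Taylor remainders, the resonant part of 2Z, and
-σ∑|v(n)|⁴.

Gradients by duality. A function whose increments are at most α times the norm `nD` dual to `nB` has
derivative bounded by α in that pairing, hence a gradient of size O(α) in `nB` (`enorm_fderiv_le`,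
`wt_mul_enorm_le`, `sum_wt_enorm_le`). It is thus enough to compare values at two points, and the
derivative of the flow never has to be estimated. `SlotBound` dualises: forms and vector fields are
Lipschitz for `nD` (`SlotBound.form_diag_sub_le`, `SlotBound.nD_fieldRaw_sub_le`), and each flow at
most doubles `nD` distances (`nD_ev_le_two_mul`). This gives `IsSmall.remX_sub_le`. With r of order
√ε its terms are of order N² r² r⁵, N² N r⁴ r⁵, N r⁵ and r³, each equal to ε^{3/2} up to logarithms.

For δ > 0, n² is at most a multiple of e^{δ|n|}, so ∑ n²|v|² is a continuous quadratic form. That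
justifies differentiation; its norm, which depends on δ, never enters an estimate, because this form
appears only inside exact identities. -/

noncomputable section

open scoped NNReal

namespace QuasiLinear

/-! ### The norm `max (sup, N⁻¹ ∑)` with exponential weight, and its dual -/

section WeightedNorm

/-- The weight `e^{δ|n|}`. -/
def wt (δ : ℝ) (n : ℤ) : ℝ≥0∞ := ENNReal.ofReal (Real.exp (δ * |(n : ℝ)|))

/-- The norm `max (sup e^{δ|n|} g(n), N⁻¹ ∑ e^{δ|n|} g(n))`. -/
def nB (δ N : ℝ) (g : ℤ → ℝ≥0∞) : ℝ≥0∞ :=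
  max (⨆ n, wt δ n * g n) ((ENNReal.ofReal N)⁻¹ * ∑' n, wt δ n * g n)

/-- The lattice norm dual to `nB`. -/
def nD (δ N : ℝ) (h : ℤ → ℝ≥0∞) : ℝ≥0∞ :=
  ⨆ g : ℤ → ℝ≥0∞, ⨆ _ : nB δ N g ≤ 1, ∑' n, g n * h n

variable {δ N : ℝ}

lemma wt_ne_zero (δ : ℝ) (n : ℤ) : wt δ n ≠ 0 := by
  simp [wt, Real.exp_pos]

lemma wt_ne_top (δ : ℝ) (n : ℤ) : wt δ n ≠ ∞ := ENNReal.ofReal_ne_top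

lemma one_le_wt (hδ : 0 ≤ δ) (n : ℤ) : 1 ≤ wt δ n := by
  rw [wt, ← ENNReal.ofReal_one]
  exact ENNReal.ofReal_le_ofReal (Real.one_le_exp (by positivity))

lemma wt_zero (n : ℤ) : wt 0 n = 1 := by simp [wt]

lemma ofReal_ne_zero_of_one_le (hN : 1 ≤ N) : ENNReal.ofReal N ≠ 0 := by
  simp; linarith

lemma one_le_ofReal (hN : 1 ≤ N) : 1 ≤ ENNReal.ofReal N := by
  rw [← ENNReal.ofReal_one]; exact ENNReal.ofReal_le_ofReal hN

lemma wt_mul_le_nB (δ N : ℝ) (g : ℤ → ℝ≥0∞) (n : ℤ) : wt δ n * g n ≤ nB δ N g :=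
  (le_iSup (fun n => wt δ n * g n) n).trans (le_max_left _ _)

lemma le_nB (hδ : 0 ≤ δ) (g : ℤ → ℝ≥0∞) (n : ℤ) : g n ≤ nB δ N g :=
  le_trans (le_mul_of_one_le_left zero_le (one_le_wt hδ n)) (wt_mul_le_nB δ N g n)

lemma tsum_wt_mul_le_nB (hN : 1 ≤ N) (g : ℤ → ℝ≥0∞) :
    ∑' n, wt δ n * g n ≤ ENNReal.ofReal N * nB δ N g := by
  have h : (ENNReal.ofReal N)⁻¹ * ∑' n, wt δ n * g n ≤ nB δ N g := le_max_right _ _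
  calc ∑' n, wt δ n * g n
      = ENNReal.ofReal N * ((ENNReal.ofReal N)⁻¹ * ∑' n, wt δ n * g n) := by
        rw [← mul_assoc, ENNReal.mul_inv_cancel (ofReal_ne_zero_of_one_le hN)
          ENNReal.ofReal_ne_top, one_mul]
    _ ≤ _ := by gcongr

lemma tsum_le_nB (hδ : 0 ≤ δ) (hN : 1 ≤ N) (g : ℤ → ℝ≥0∞) :
    ∑' n, g n ≤ ENNReal.ofReal N * nB δ N g :=
  (ENNReal.tsum_le_tsum fun n => le_mul_of_one_le_left zero_le (one_le_wt hδ n)).trans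
    (tsum_wt_mul_le_nB hN g)

lemma nB_le {g : ℤ → ℝ≥0∞} {M : ℝ≥0∞} (hN : 1 ≤ N) (h₁ : ∀ n, wt δ n * g n ≤ M)
    (h₂ : ∑' n, wt δ n * g n ≤ ENNReal.ofReal N * M) : nB δ N g ≤ M := by
  refine max_le (iSup_le h₁) ?_
  calc (ENNReal.ofReal N)⁻¹ * ∑' n, wt δ n * g n
      ≤ (ENNReal.ofReal N)⁻¹ * (ENNReal.ofReal N * M) := by gcongr
    _ = M := by
      rw [← mul_assoc, ENNReal.inv_mul_cancel (ofReal_ne_zero_of_one_le hN)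
          ENNReal.ofReal_ne_top, one_mul]

lemma nB_mono {g g' : ℤ → ℝ≥0∞} (h : ∀ n, g n ≤ g' n) : nB δ N g ≤ nB δ N g' := by
  refine max_le_max (iSup_mono fun n => by gcongr; exact h n) ?_
  gcongr; exact h _

lemma nB_add_le (g g' : ℤ → ℝ≥0∞) :
    nB δ N (fun n => g n + g' n) ≤ nB δ N g + nB δ N g' := by
  refine max_le (iSup_le fun n => ?_) ?_
  · rw [mul_add]; exact add_le_add (wt_mul_le_nB _ _ _ _) (wt_mul_le_nB _ _ _ _)
  · simp_rw [mul_add]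
    rw [ENNReal.tsum_add, mul_add]
    exact add_le_add (le_max_right _ _) (le_max_right _ _)

lemma nB_const_mul (c : ℝ≥0∞) (g : ℤ → ℝ≥0∞) :
    nB δ N (fun n => c * g n) = c * nB δ N g := by
  simp only [nB, mul_left_comm _ c, ENNReal.tsum_mul_left, ← ENNReal.mul_iSup]
  rw [mul_max]

lemma nB_sum_le {α : Type*} (s : Finset α) (g : α → ℤ → ℝ≥0∞) :
    nB δ N (fun n => ∑ i ∈ s, g i n) ≤ ∑ i ∈ s, nB δ N (g i) := by
  classical
  induction s using Finset.induction_on with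
  | empty => simp [nB]
  | insert a s ha ih =>
    simp only [Finset.sum_insert ha]
    exact (nB_add_le _ _).trans (by gcongr)

lemma tsum_mul_le_nD {g h : ℤ → ℝ≥0∞} (hg : nB δ N g ≤ 1) : ∑' n, g n * h n ≤ nD δ N h :=
  le_iSup₂ (f := fun (g : ℤ → ℝ≥0∞) (_ : nB δ N g ≤ 1) => ∑' n, g n * h n) g hg

lemma nB_single_le (hN : 1 ≤ N) (n : ℤ) (t : ℝ≥0∞) :
    nB δ N (Pi.single n t) ≤ wt δ n * t := by
  refine nB_le hN (fun m => ?_) ?_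
  · by_cases h : m = n
    · subst h; simp
    · simp [h]
  · rw [tsum_eq_single n (fun m hm => by simp [hm])]
    simpa using le_mul_of_one_le_left zero_le (one_le_ofReal hN)

lemma le_wt_mul_nD (hN : 1 ≤ N) (h : ℤ → ℝ≥0∞) (n : ℤ) : h n ≤ wt δ n * nD δ N h := by
  have h1 : nB δ N (Pi.single n (wt δ n)⁻¹) ≤ 1 :=
    (nB_single_le hN n _).trans
      (ENNReal.mul_inv_cancel (wt_ne_zero δ n) (wt_ne_top δ n)).le
  have h2 := tsum_mul_le_nD (h := h) h1
  rw [tsum_eq_single n (fun m hm => by simp [hm])] at h2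
  simp only [Pi.single_eq_same] at h2
  calc h n = wt δ n * ((wt δ n)⁻¹ * h n) := by
        rw [← mul_assoc, ENNReal.mul_inv_cancel (wt_ne_zero δ n) (wt_ne_top δ n), one_mul]
    _ ≤ _ := by gcongr

/-- Normalise `g` and use the definition of `nD`. The degenerate cases are separate since 0 * ∞ = 0:
a vanishing norm on either side forces the sequence to vanish, and then an infinite `nB δ N g` makes
the right side infinite. -/
lemma tsum_mul_le (hN : 1 ≤ N) (g h : ℤ → ℝ≥0∞) :
    ∑' n, g n * h n ≤ nB δ N g * nD δ N h := by
  by_cases h0 : nB δ N g = 0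
  · have : ∀ n, g n = 0 := fun n => by
      have := wt_mul_le_nB δ N g n
      rw [h0, nonpos_iff_eq_zero, mul_eq_zero] at this
      exact this.resolve_left (wt_ne_zero δ n)
    simp [this]
  by_cases hD : nD δ N h = 0
  · have : ∀ n, h n = 0 := fun n => by
      have := le_wt_mul_nD (δ := δ) hN h n
      rwa [hD, mul_zero, nonpos_iff_eq_zero] at this
    simp [this]
  by_cases hT : nB δ N g = ∞
  · rw [hT, ENNReal.top_mul hD]; exact le_top
  have h1 : nB δ N (fun n => (nB δ N g)⁻¹ * g n) ≤ 1 := by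
    rw [nB_const_mul, ENNReal.inv_mul_cancel h0 hT]
  have h2 := tsum_mul_le_nD (h := h) h1
  simp_rw [mul_assoc] at h2
  rw [ENNReal.tsum_mul_left] at h2
  calc ∑' n, g n * h n = nB δ N g * ((nB δ N g)⁻¹ * ∑' n, g n * h n) := by
        rw [← mul_assoc, ENNReal.mul_inv_cancel h0 hT, one_mul]
    _ ≤ _ := by gcongr

lemma nD_le {h : ℤ → ℝ≥0∞} {M : ℝ≥0∞}
    (H : ∀ g, nB δ N g ≤ 1 → ∑' n, g n * h n ≤ M) : nD δ N h ≤ M :=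
  iSup₂_le H

/-- Uses only the ℓ¹ half of `nB`. It makes vectors with entries of modulus up to e^{δ|n|}
admissible as test vectors in `sum_wt_enorm_le`. -/
lemma nD_le_of_le_wt (hN : 1 ≤ N) {h : ℤ → ℝ≥0∞} {M : ℝ≥0∞} (H : ∀ n, h n ≤ wt δ n * M) :
    nD δ N h ≤ ENNReal.ofReal N * M := by
  refine nD_le fun g hg => ?_
  calc ∑' n, g n * h n ≤ ∑' n, (wt δ n * g n) * M := by
        refine ENNReal.tsum_le_tsum fun n => ?_
        calc g n * h n ≤ g n * (wt δ n * M) := by gcongr; exact H n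
          _ = _ := by ring
    _ = (∑' n, wt δ n * g n) * M := ENNReal.tsum_mul_right
    _ ≤ (ENNReal.ofReal N * nB δ N g) * M := by gcongr; exact tsum_wt_mul_le_nB hN g
    _ ≤ (ENNReal.ofReal N * 1) * M := by gcongr
    _ = _ := by rw [mul_one]

lemma nD_le_nB (hδ : 0 ≤ δ) (hN : 1 ≤ N) (h : ℤ → ℝ≥0∞) :
    nD δ N h ≤ ENNReal.ofReal N * nB δ N h :=
  nD_le_of_le_wt hN fun n =>
    (le_nB hδ h n).trans (le_mul_of_one_le_left zero_le (one_le_wt hδ n))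

lemma nD_single_le (n : ℤ) (t : ℝ≥0∞) : wt δ n * nD δ N (Pi.single n t) ≤ t := by
  have : nD δ N (Pi.single n t) ≤ (wt δ n)⁻¹ * t := by
    refine nD_le fun g hg => ?_
    rw [tsum_eq_single n (fun m hm => by simp [hm])]
    simp only [Pi.single_eq_same]
    gcongr
    have := (wt_mul_le_nB δ N g n).trans hg
    rw [mul_comm] at this
    exact ENNReal.le_inv_iff_mul_le.mpr this
  calc wt δ n * nD δ N (Pi.single n t) ≤ wt δ n * ((wt δ n)⁻¹ * t) := by gcongr
    _ = t := by
      rw [← mul_assoc, ENNReal.mul_inv_cancel (wt_ne_zero δ n) (wt_ne_top δ n), one_mul]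

/-! ### Majorants of multilinear forms -/

/-- The multilinear form with nonnegative kernel `K`. -/
def maj {k : ℕ} (K : (Fin k → ℤ) → ℝ≥0∞) (f : Fin k → ℤ → ℝ≥0∞) : ℝ≥0∞ :=
  ∑' m, K m * ∏ i, f i (m i)

/-- Boundedness, with constant `β`, of all the gradients of the form with kernel `K`. -/
def SlotBound (δ N : ℝ) {k : ℕ} (β : ℝ≥0∞) (K : (Fin k → ℤ) → ℝ≥0∞) : Prop :=
  ∀ (j : Fin k) (f : Fin k → ℤ → ℝ≥0∞),
    nB δ N (fun n => maj K (Function.update f j (Pi.single n 1)))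
      ≤ β * ∏ i ∈ Finset.univ.erase j, nB δ N (f i)

variable {k : ℕ} {K : (Fin k → ℤ) → ℝ≥0∞} {β : ℝ≥0∞}

lemma maj_mono {K' : (Fin k → ℤ) → ℝ≥0∞} {f f' : Fin k → ℤ → ℝ≥0∞} (hK : ∀ m, K m ≤ K' m)
    (hf : ∀ i n, f i n ≤ f' i n) : maj K f ≤ maj K' f' := by
  refine ENNReal.tsum_le_tsum fun m => ?_
  gcongr
  · exact hK m
  · exact hf _ _

lemma prod_update_apply {M : Type*} [CommMonoid M] (f : Fin k → ℤ → M) (j : Fin k) (h : ℤ → M)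
    (m : Fin k → ℤ) :
    ∏ i, Function.update f j h i (m i) = h (m j) * ∏ i ∈ Finset.univ.erase j, f i (m i) := by
  rw [← Finset.mul_prod_erase _ _ (Finset.mem_univ j)]
  congr 1
  · simp
  · refine Finset.prod_congr rfl fun i hi => ?_
    rw [Function.update_of_ne (Finset.ne_of_mem_erase hi)]

/-- Pairing the partial gradient with `h` puts `h` back into slot `j`. -/
lemma tsum_mul_maj_update (K : (Fin k → ℤ) → ℝ≥0∞) (f : Fin k → ℤ → ℝ≥0∞) (j : Fin k)
    (h : ℤ → ℝ≥0∞) :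
    ∑' n, h n * maj K (Function.update f j (Pi.single n 1)) = maj K (Function.update f j h) := by
  unfold maj
  simp_rw [← ENNReal.tsum_mul_left]
  rw [ENNReal.tsum_comm]
  congr 1; ext m
  simp_rw [prod_update_apply]
  rw [tsum_eq_single (m j)]
  · simp only [Pi.single_eq_same, one_mul]; ring
  · intro n hn
    simp [Ne.symm hn]

/-- The form is the pairing of its gradient in slot `j` with `f j`; duality lets any one chosen slot
be measured in `nD`. -/
lemma SlotBound.maj_le (hN : 1 ≤ N) (hK : SlotBound δ N β K) (j : Fin k)
    (f : Fin k → ℤ → ℝ≥0∞) :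
    maj K f ≤ β * (∏ i ∈ Finset.univ.erase j, nB δ N (f i)) * nD δ N (f j) := by
  have h := tsum_mul_maj_update K f j (f j)
  rw [Function.update_eq_self] at h
  rw [← h]
  simp_rw [mul_comm (f j _)]
  exact (tsum_mul_le hN _ _).trans (by gcongr; exact hK j f)

lemma SlotBound.mono {K' : (Fin k → ℤ) → ℝ≥0∞} {β' : ℝ≥0∞} (hK : SlotBound δ N β K)
    (h : ∀ m, K' m ≤ K m) (hβ : β ≤ β') : SlotBound δ N β' K' := fun j f =>
  (nB_mono fun _ => maj_mono h fun _ _ => le_rfl).trans ((hK j f).trans (by gcongr))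

lemma wt_mul_prod_le (hδ : 0 ≤ δ) {m : Fin k → ℤ} {j : Fin k}
    (h : |m j| ≤ ∑ i ∈ Finset.univ.erase j, |m i|) (f : Fin k → ℤ → ℝ≥0∞) :
    wt δ (m j) * ∏ i ∈ Finset.univ.erase j, f i (m i)
      ≤ ∏ i ∈ Finset.univ.erase j, (wt δ (m i) * f i (m i)) := by
  rw [Finset.prod_mul_distrib]
  gcongr
  simp only [wt]
  rw [← ENNReal.ofReal_prod_of_nonneg (fun _ _ => (Real.exp_pos _).le), ← Real.exp_sum,
    ← Finset.mul_sum]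
  refine ENNReal.ofReal_le_ofReal (Real.exp_le_exp.mpr ?_)
  gcongr
  exact_mod_cast h

/-- On the support of the kernel e^{δ|m_j|} is at most the product of the e^{δ|m_i|} over the other
slots, so the weight moves from the output to the inputs without loss. -/
lemma SlotBound.weight (hδ : 0 ≤ δ) (hK : SlotBound 0 N β K)
    (hbal : ∀ m, K m ≠ 0 → ∀ j, |m j| ≤ ∑ i ∈ Finset.univ.erase j, |m i|) :
    SlotBound δ N β K := by
  intro j f
  have key : ∀ n, wt δ n * maj K (Function.update f j (Pi.single n 1)) ≤
      maj K (Function.update (fun i n => wt δ n * f i n) j (Pi.single n 1)) := by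
    intro n
    unfold maj
    rw [← ENNReal.tsum_mul_left]
    refine ENNReal.tsum_le_tsum fun m => ?_
    simp_rw [prod_update_apply]
    by_cases h0 : K m = 0
    · simp [h0]
    by_cases hn : m j = n
    · subst hn
      simp only [Pi.single_eq_same, one_mul]
      rw [mul_left_comm]
      gcongr
      exact wt_mul_prod_le hδ (hbal m h0 j) f
    · simp [hn]
  have h := hK j (fun i n => wt δ n * f i n)
  simp only [nB, wt_zero, one_mul] at h ⊢
  refine le_trans (max_le_max (iSup_mono key) ?_) h
  gcongr
  exact key _

/-- A bound for the form with one slot fixed and one slot set to `1` (norms without weights). -/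
def PairBound (N : ℝ) (β : ℝ≥0∞) (K : (Fin k → ℤ) → ℝ≥0∞) (i j : Fin k) : Prop :=
  i ≠ j ∧ ∀ (f : Fin k → ℤ → ℝ≥0∞) (n : ℤ), f i = Pi.single n 1 → f j = (fun _ => 1) →
    maj K f ≤ β * ∏ l ∈ (Finset.univ.erase i).erase j, nB 0 N (f l)

lemma PairBound.fixed {i j : Fin k} (h : PairBound N β K i j) (f : Fin k → ℤ → ℝ≥0∞) (n : ℤ) :
    maj K (Function.update (Function.update f j fun _ => 1) i (Pi.single n 1))
      ≤ β * ∏ l ∈ (Finset.univ.erase i).erase j, nB 0 N (f l) := by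
  refine (h.2 _ n (by simp) (by simp [h.1.symm])).trans (le_of_eq ?_)
  congr 1
  refine Finset.prod_congr rfl fun l hl => ?_
  simp only [Finset.mem_erase] at hl
  rw [Function.update_of_ne hl.2.1, Function.update_of_ne hl.1]

lemma maj_update_const_mul (f : Fin k → ℤ → ℝ≥0∞) (j : Fin k) (c : ℝ≥0∞) (h : ℤ → ℝ≥0∞) :
    maj K (Function.update f j fun n => c * h n) = c * maj K (Function.update f j h) := by
  unfold maj
  rw [← ENNReal.tsum_mul_left]
  congr 1; ext m
  simp_rw [prod_update_apply]
  ring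

/-- A pair (i, j) serves twice. Bounding `f j` by its sup gives the sup half of `nB` for the
gradient in slot `i`. Summing over slot `i` gives the ℓ¹ half for the gradient in slot `j`, the
factor N from ∑ `f i` being the one allowed in `nB`. Hence each slot must occur once in either role.
-/
lemma slotBound_of_pairBound (hN : 1 ≤ N) (hi : ∀ i, ∃ j, PairBound N β K i j)
    (hj : ∀ j, ∃ i, PairBound N β K i j) : SlotBound 0 N β K := by
  intro s f
  refine nB_le hN (fun n => ?_) ?_
  · obtain ⟨j, h⟩ := hi s
    rw [wt_zero, one_mul]
    have h1 := h.fixed f n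
    have h2 : maj K (Function.update f s (Pi.single n 1)) ≤
        nB 0 N (f j) *
          maj K (Function.update (Function.update f j fun _ => 1) s (Pi.single n 1)) := by
      rw [Function.update_comm h.1.symm, ← maj_update_const_mul]
      refine maj_mono (fun _ => le_rfl) fun i x => ?_
      by_cases hij : i = j
      · subst hij; simp only [Function.update_self, ne_eq, h.1.symm, not_false_eq_true,
          Function.update_of_ne, mul_one]; exact le_nB le_rfl _ _
      · rw [Function.update_of_ne hij]
    refine h2.trans ?_
    rw [← Finset.mul_prod_erase (Finset.univ.erase s) _
      (Finset.mem_erase.mpr ⟨h.1.symm, Finset.mem_univ j⟩), mul_left_comm]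
    gcongr
  · obtain ⟨i, h⟩ := hj s
    simp_rw [wt_zero]
    rw [tsum_mul_maj_update K f s (fun _ => 1)]
    rw [← Function.update_eq_self i (Function.update f s fun _ => 1), Function.update_of_ne h.1,
      ← tsum_mul_maj_update]
    calc _ ≤ ∑' n, f i n * (β * ∏ l ∈ (Finset.univ.erase i).erase s, nB 0 N (f l)) := by
          refine ENNReal.tsum_le_tsum fun n => ?_
          gcongr
          exact h.fixed f n
      _ = (∑' n, f i n) * (β * ∏ l ∈ (Finset.univ.erase i).erase s, nB 0 N (f l)) :=
          ENNReal.tsum_mul_right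
      _ ≤ (ENNReal.ofReal N * nB 0 N (f i)) *
            (β * ∏ l ∈ (Finset.univ.erase i).erase s, nB 0 N (f l)) := by
          gcongr; exact tsum_le_nB le_rfl hN _
      _ = _ := by
          rw [← Finset.mul_prod_erase (Finset.univ.erase s) _
            (Finset.mem_erase.mpr ⟨h.1, Finset.mem_univ i⟩), Finset.erase_right_comm]
          ring

lemma PairBound.perm {i j : Fin k} (h : PairBound N β K i j) (π : Equiv.Perm (Fin k))
    (hK : ∀ m, K (m ∘ π) = K m) : PairBound N β K (π i) (π j) := by
  refine ⟨fun e => h.1 (π.injective e), fun f n hi hj => ?_⟩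
  have h1 := h.2 (f ∘ π) n hi hj
  have h2 : maj K (f ∘ π) = maj K f := by
    unfold maj
    rw [← (Equiv.arrowCongr π.symm (Equiv.refl ℤ)).tsum_eq]
    congr 1; ext m
    have e : (Equiv.arrowCongr π.symm (Equiv.refl ℤ)) m = m ∘ π := rfl
    rw [e, hK]
    congr 1
    exact Equiv.prod_comp π (fun i => f i (m i))
  rw [← h2]
  refine h1.trans (le_of_eq ?_)
  congr 1
  refine Finset.prod_bij (fun l _ => π l) ?_ (fun _ _ _ _ e => π.injective e) ?_ ?_
  · intro l hl; simpa using hl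
  · intro l hl; exact ⟨π.symm l, by simp only [Finset.mem_erase, Finset.mem_univ, and_true, ne_eq] at hl ⊢; exact ⟨fun e => hl.1 (by simp [← e]), fun e => hl.2 (by simp [← e])⟩, by simp⟩
  · intro l _; rfl

end WeightedNorm

/-! ### Logarithmic sums -/

section LogarithmicSums

/-- The weight `1 / max(1, |a|)`. -/
def J (a : ℤ) : ℝ≥0∞ := ((max 1 a.natAbs : ℕ) : ℝ≥0∞)⁻¹

/-- The logarithmic factor `5 + 2 log N`. -/
def kap (N : ℝ) : ℝ≥0∞ := ENNReal.ofReal (5 + 2 * Real.log N)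

variable {N : ℝ}

lemma J_le_one (a : ℤ) : J a ≤ 1 := by
  rw [J, ENNReal.inv_le_one]; exact_mod_cast le_max_left _ _

lemma J_neg (a : ℤ) : J (-a) = J a := by simp [J]

lemma J_sub_comm (a b : ℤ) : J (a - b) = J (b - a) := by rw [← J_neg, neg_sub]

lemma one_le_kap (hN : 1 ≤ N) : 1 ≤ kap N := by
  rw [kap, ← ENNReal.ofReal_one]
  exact ENNReal.ofReal_le_ofReal (by linarith [Real.log_nonneg hN])

lemma tsum_natAbs_le (F : ℕ → ℝ≥0∞) : ∑' a : ℤ, F a.natAbs ≤ 2 * ∑' n, F n := by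
  have hinj : Function.Injective (fun a : ℤ => ((decide (0 ≤ a) : Bool), a.natAbs)) := by
    intro a b h
    simp only [Prod.mk.injEq, decide_eq_decide] at h
    omega
  refine (ENNReal.tsum_comp_le_tsum_of_injective hinj (fun p : Bool × ℕ => F p.2)).trans ?_
  rw [ENNReal.tsum_prod (f := fun (_ : Bool) n => F n)]
  simp [two_mul]

/-- The sum over naturals is at most 1 + (1 + log N); passing to integers doubles it. The extra 1 is
kept for the tail |a| > N in `tsum_mul_J_le_of_fiber`, whence 5 + 2 log N. -/
lemma tsum_J_low_le (hN : 1 ≤ N) :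
    (∑' a : ℤ, if (a.natAbs : ℝ) ≤ N then J a else 0) + 1 ≤ kap N := by
  have h1 := tsum_natAbs_le (fun n => if (n : ℝ) ≤ N then ((max 1 n : ℕ) : ℝ≥0∞)⁻¹ else 0)
  have h2 : ∑' n : ℕ, (if (n : ℝ) ≤ N then ((max 1 n : ℕ) : ℝ≥0∞)⁻¹ else 0)
      ≤ ENNReal.ofReal (2 + Real.log N) := by
    rw [tsum_eq_sum (s := Finset.range (⌊N⌋₊ + 1))]
    · rw [Finset.sum_range_succ']
      have : (harmonic ⌊N⌋₊ : ℝ) ≤ 1 + Real.log N := harmonic_floor_le_one_add_log N hN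
      have e : ∑ k ∈ Finset.range ⌊N⌋₊,
          (if ((k + 1 : ℕ) : ℝ) ≤ N then ((max 1 (k + 1) : ℕ) : ℝ≥0∞)⁻¹ else 0)
          ≤ ENNReal.ofReal (harmonic ⌊N⌋₊ : ℝ) := by
        rw [harmonic]
        push_cast
        rw [ENNReal.ofReal_sum_of_nonneg (fun i _ => by positivity)]
        refine Finset.sum_le_sum fun i _ => ?_
        have : ENNReal.ofReal ((i : ℝ) + 1)⁻¹ = ((i : ℝ≥0∞) + 1)⁻¹ := by
          rw [ENNReal.ofReal_inv_of_pos (by positivity),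
            ENNReal.ofReal_add (by positivity) (by positivity)]
          simp
        rw [this]
        split_ifs
        · simp
        · exact zero_le
      have hz : (if ((0 : ℕ) : ℝ) ≤ N then ((max 1 0 : ℕ) : ℝ≥0∞)⁻¹ else 0)
          ≤ ENNReal.ofReal 1 := by split_ifs; all_goals simp
      calc _ ≤ ENNReal.ofReal (harmonic ⌊N⌋₊ : ℝ) + ENNReal.ofReal 1 := add_le_add e hz
        _ = ENNReal.ofReal ((harmonic ⌊N⌋₊ : ℝ) + 1) := by
            rw [ENNReal.ofReal_add _ (by norm_num)]
            rw [harmonic]; push_cast; positivity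
        _ ≤ _ := ENNReal.ofReal_le_ofReal (by linarith)
    · intro b hb
      rw [if_neg]
      intro h
      exact hb (Finset.mem_range.mpr (Nat.lt_succ_of_le (Nat.le_floor h)))
  calc _ ≤ 2 * ENNReal.ofReal (2 + Real.log N) + 1 := by
        gcongr
        exact h1.trans (by gcongr)
    _ = ENNReal.ofReal (2 * (2 + Real.log N) + 1) := by
        have := Real.log_nonneg hN
        rw [ENNReal.ofReal_add (p := 2 * (2 + Real.log N)) (by linarith) zero_le_one,
          ENNReal.ofReal_mul zero_le_two]
        simp
    _ = kap N := by rw [kap]; congr 1; ring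

lemma tsum_J_low_le' (hN : 1 ≤ N) :
    (∑' a : ℤ, if (a.natAbs : ℝ) ≤ N then J a else 0) ≤ kap N :=
  le_self_add.trans (tsum_J_low_le hN)

lemma J_le_inv_of_lt {a : ℤ} (h : N < a.natAbs) : J a ≤ (ENNReal.ofReal N)⁻¹ := by
  rw [J]
  refine ENNReal.inv_le_inv.mpr ?_
  calc ENNReal.ofReal N ≤ ENNReal.ofReal (a.natAbs : ℝ) := ENNReal.ofReal_le_ofReal h.le
    _ = (a.natAbs : ℝ≥0∞) := ENNReal.ofReal_natCast _
    _ ≤ _ := by exact_mod_cast le_max_right _ _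

lemma tsum_J_sq_high_le (hN : 1 ≤ N) :
    (∑' a : ℤ, if (a.natAbs : ℝ) ≤ N then 0 else J a * J a) ≤ 4 * (ENNReal.ofReal N)⁻¹ := by
  have h1 := tsum_natAbs_le (fun n => if (n : ℝ) ≤ N then 0 else
    ((max 1 n : ℕ) : ℝ≥0∞)⁻¹ * ((max 1 n : ℕ) : ℝ≥0∞)⁻¹)
  have h2 : ∑' n : ℕ, (if (n : ℝ) ≤ N then 0 else
    ((max 1 n : ℕ) : ℝ≥0∞)⁻¹ * ((max 1 n : ℕ) : ℝ≥0∞)⁻¹) ≤ ENNReal.ofReal (2 / N) := by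
    refine ENNReal.tsum_le_of_sum_range_le fun n => ?_
    have hs := sum_Ioo_inv_sq_le (α := ℝ) ⌊N⌋₊ n
    have hN' : (2 : ℝ) / (⌊N⌋₊ + 1) ≤ 2 / N := by
      gcongr; exact (Nat.lt_floor_add_one N).le
    refine le_trans ?_ (ENNReal.ofReal_le_ofReal (hs.trans hN'))
    rw [ENNReal.ofReal_sum_of_nonneg (fun i _ => by positivity)]
    rw [← Finset.sum_subset (s₁ := Finset.Ioo ⌊N⌋₊ n) (s₂ := Finset.range n)]
    · refine Finset.sum_le_sum fun i hi => ?_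
      rw [Finset.mem_Ioo] at hi
      have hi1 : 1 ≤ i := by omega
      split_ifs
      · exact zero_le
      · rw [max_eq_right hi1, ENNReal.ofReal_inv_of_pos (by positivity), sq,
          ENNReal.ofReal_mul (by positivity), ENNReal.ofReal_natCast,
          ENNReal.mul_inv (by simp) (by simp)]
    · intro i hi; simp at hi ⊢; omega
    · intro i hi hi2
      rw [if_pos]
      simp only [Finset.mem_range, Finset.mem_Ioo, not_and] at hi hi2
      have : i ≤ ⌊N⌋₊ := by by_contra hc; exact hi2 (by omega) hi
      exact (Nat.le_floor_iff (by linarith)).mp this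
  calc _ ≤ 2 * ENNReal.ofReal (2 / N) := h1.trans (by gcongr)
    _ = _ := by
      rw [ENNReal.ofReal_div_of_pos (by linarith), div_eq_mul_inv, ← mul_assoc]
      congr 1; norm_num

/-- Sums against `J ∘ φ`, where the fibres of `φ` have at most `c` elements. -/
lemma tsum_mul_J_le_of_fiber {c M : ℝ≥0∞} (hc : 1 ≤ c) (hN : 1 ≤ N) {g : ℤ → ℝ≥0∞} {φ : ℤ → ℤ}
    (hφ : ∀ j, (∑' y, if φ y = j ∧ g y ≠ 0 then (1 : ℝ≥0∞) else 0) ≤ c)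
    (h1 : ∀ y, g y ≤ M) (h2 : ∑' y, g y ≤ ENNReal.ofReal N * M) :
    ∑' y, g y * J (φ y) ≤ c * kap N * M := by
  -- Where |φ y| ≤ N, bound `g y` by M and sort by the value of φ, each fibre costing c; elsewhere J
  -- ≤ 1/N and the ℓ¹ bound of `g` pays.
  have hle : ∀ y, g y * J (φ y) ≤
      (∑' j, M * (if (j.natAbs : ℝ) ≤ N then J j else 0) *
        (if φ y = j ∧ g y ≠ 0 then (1 : ℝ≥0∞) else 0))
      + (ENNReal.ofReal N)⁻¹ * g y := by
    intro y
    by_cases hg : g y = 0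
    · simp [hg]
    by_cases hy : ((φ y).natAbs : ℝ) ≤ N
    · refine le_trans ?_ le_self_add
      rw [tsum_eq_single (φ y) (fun j hj => by simp [Ne.symm hj])]
      simp only [hy, if_true, true_and, ne_eq, hg, not_false_eq_true, mul_one]
      gcongr
      exact h1 y
    · refine le_trans ?_ le_add_self
      rw [mul_comm]
      gcongr
      exact J_le_inv_of_lt (not_le.mp hy)
  calc _ ≤ _ := ENNReal.tsum_le_tsum hle
    _ = (∑' j : ℤ, M * (if (j.natAbs : ℝ) ≤ N then J j else 0) *
        ∑' y, (if φ y = j ∧ g y ≠ 0 then (1 : ℝ≥0∞) else 0))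
        + (ENNReal.ofReal N)⁻¹ * ∑' y, g y := by
        rw [ENNReal.tsum_add, ENNReal.tsum_comm, ENNReal.tsum_mul_left]
        simp_rw [ENNReal.tsum_mul_left]
    _ ≤ (∑' j : ℤ, M * (if (j.natAbs : ℝ) ≤ N then J j else 0) * c) + c * M := by
        have h3 : (ENNReal.ofReal N)⁻¹ * ∑' y, g y ≤ c * M := by
          calc _ ≤ (ENNReal.ofReal N)⁻¹ * (ENNReal.ofReal N * M) := by gcongr
            _ = M := by
              rw [← mul_assoc, ENNReal.inv_mul_cancel (ofReal_ne_zero_of_one_le hN)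
                ENNReal.ofReal_ne_top, one_mul]
            _ ≤ _ := le_mul_of_one_le_left zero_le hc
        refine add_le_add (ENNReal.tsum_le_tsum fun j => ?_) h3
        gcongr
        exact hφ j
    _ = c * ((∑' j : ℤ, if (j.natAbs : ℝ) ≤ N then J j else 0) + 1) * M := by
        rw [ENNReal.tsum_mul_right, ENNReal.tsum_mul_left]; ring
    _ ≤ _ := by gcongr; exact tsum_J_low_le hN

lemma tsum_ite_le_one (p : ℤ → Prop) [DecidablePred p] (h : ∀ y y', p y → p y' → y = y') :
    (∑' y, if p y then (1 : ℝ≥0∞) else 0) ≤ 1 := by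
  by_cases hp : ∃ y, p y
  · obtain ⟨y, hy⟩ := hp
    rw [tsum_eq_single y (fun y' hy' => if_neg fun h' => hy' (h _ _ h' hy))]
    split_ifs; all_goals simp
  · simp only [not_exists] at hp
    simp [hp]

lemma tsum_mul_J_le_of_inj {M : ℝ≥0∞} (hN : 1 ≤ N) {g : ℤ → ℝ≥0∞} {φ : ℤ → ℤ}
    (hφ : ∀ y y', g y ≠ 0 → g y' ≠ 0 → φ y = φ y' → y = y')
    (h1 : ∀ y, g y ≤ M) (h2 : ∑' y, g y ≤ ENNReal.ofReal N * M) :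
    ∑' y, g y * J (φ y) ≤ kap N * M := by
  have := tsum_mul_J_le_of_fiber (c := 1) le_rfl hN (φ := φ)
    (fun j => tsum_ite_le_one _ fun y y' hy hy' => hφ y y' hy.2 hy'.2 (hy.1.trans hy'.1.symm)) h1 h2
  simpa using this

lemma le_nB_zero (f : ℤ → ℝ≥0∞) (n : ℤ) : f n ≤ nB 0 N f := le_nB le_rfl f n

lemma tsum_comp_le_nB (hN : 1 ≤ N) (f : ℤ → ℝ≥0∞) {ψ : ℤ → ℤ} (hψ : Function.Injective ψ) :
    ∑' y, f (ψ y) ≤ ENNReal.ofReal N * nB 0 N f :=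
  (ENNReal.tsum_comp_le_tsum_of_injective hψ f).trans (tsum_le_nB le_rfl hN f)

/-- The basic logarithmic estimate. -/
lemma tsum_J_mul_le (hN : 1 ≤ N) (f : ℤ → ℝ≥0∞) {φ ψ : ℤ → ℤ} (hφ : Function.Injective φ)
    (hψ : Function.Injective ψ) : ∑' y, J (φ y) * f (ψ y) ≤ kap N * nB 0 N f := by
  simp_rw [mul_comm (J _)]
  exact tsum_mul_J_le_of_inj hN (fun _ _ _ _ h => hφ h) (fun y => le_nB_zero f _)
    (tsum_comp_le_nB hN f hψ)

/-- The logarithmic estimate for an injection on a subset. -/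
lemma tsum_ite_J_mul_le (hN : 1 ≤ N) (f : ℤ → ℝ≥0∞) {p : ℤ → Prop} [DecidablePred p]
    {φ ψ : ℤ → ℤ} (hφ : ∀ y y', p y → p y' → φ y = φ y' → y = y') (hψ : Function.Injective ψ) :
    ∑' y, (if p y then f (ψ y) * J (φ y) else 0) ≤ kap N * nB 0 N f := by
  have := tsum_mul_J_le_of_inj (M := nB 0 N f) hN (g := fun y => if p y then f (ψ y) else 0)
    (φ := φ) (fun y y' hy hy' h => hφ y y' (by by_contra hc; simp [hc] at hy)
      (by by_contra hc; simp [hc] at hy') h)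
    (fun y => by split_ifs; exacts [le_nB_zero f _, zero_le])
    ((ENNReal.tsum_le_tsum fun y => by split_ifs; exacts [le_rfl, zero_le]).trans
      (tsum_comp_le_nB hN f hψ))
  simpa [ite_mul] using this

/-- A quadratic polynomial takes a value at most twice: if y is one solution, the other is n + c -
y. -/
lemma tsum_quadratic_le (hN : 1 ≤ N) (f : ℤ → ℝ≥0∞) (n c d : ℤ) :
    ∑' s, f s * J ((n - s) * (s - c) - d) ≤ 2 * kap N * nB 0 N f := by
  refine tsum_mul_J_le_of_fiber (by norm_num) hN (fun j => ?_) (fun y => le_nB_zero f _)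
    (tsum_le_nB le_rfl hN f)
  by_cases h : ∃ y, (n - y) * (y - c) - d = j
  · obtain ⟨y, hy⟩ := h
    calc _ ≤ ∑' z : ℤ, ((if z = y then (1 : ℝ≥0∞) else 0) + if z = n + c - y then 1 else 0) := by
          refine ENNReal.tsum_le_tsum fun z => ?_
          by_cases h1 : (n - z) * (z - c) - d = j ∧ f z ≠ 0
          swap
          · rw [if_neg h1]; exact zero_le
          rw [if_pos h1]
          by_cases h2 : z = y
          · rw [if_pos h2]; exact le_self_add
          by_cases h3 : z = n + c - y
          · rw [if_pos h3]; exact le_add_self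
          exfalso
          have : (z - y) * (z - (n + c - y)) = 0 := by linear_combination hy - h1.1
          rcases mul_eq_zero.mp this with h | h
          · exact h2 (sub_eq_zero.mp h)
          · exact h3 (sub_eq_zero.mp h)
      _ = 2 := by
          rw [ENNReal.tsum_add, tsum_ite_eq, tsum_ite_eq]; norm_num
  · simp only [not_exists] at h
    simp [h]

/-- A double sum in which one of the two weights is not matched by a function. -/
lemma tsum_unmatched_le (hN : 1 ≤ N) (u w : ℤ → ℝ≥0∞) (d a e r : ℤ) :
    ∑' b, ∑' y, (if d + b ≠ 0 then
      J b * (J (d * y + b * (y - a)) * (u (e + y) * w (y - b + r))) else 0)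
      ≤ 3 * kap N ^ 2 * (nB 0 N u * nB 0 N w) := by
  set U := nB 0 N u
  set W := nB 0 N w
  -- Three regions. For y = a the argument of the second weight does not depend on b, and only J b
  -- is used. For |b| ≤ N the sum over y runs first, with slope d + b ≠ 0. For |b| > N one has J b ≤
  -- 1/N and the sum over b runs first, with slope y - a ≠ 0; the factor 1/N then cancels the ℓ¹
  -- cost of u.
  have hle : ∀ b y, (if d + b ≠ 0 then
      J b * (J (d * y + b * (y - a)) * (u (e + y) * w (y - b + r))) else 0) ≤
      (if y = a then U * (J b * w (a - b + r)) else 0)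
      + (if (b.natAbs : ℝ) ≤ N then J b else 0) *
        (U * (if d + b ≠ 0 then w (y - b + r) * J (d * y + b * (y - a)) else 0))
      + (ENNReal.ofReal N)⁻¹ *
        (u (e + y) * if y ≠ a then w (y - b + r) * J (d * y + b * (y - a)) else 0) := by
    intro b y
    have hu : u (e + y) ≤ U := le_nB_zero u _
    by_cases hd : d + b ≠ 0
    swap
    · rw [if_neg hd]; exact zero_le
    simp only [if_pos hd]
    by_cases hy : y = a
    · subst hy
      refine le_trans ?_ (le_self_add.trans le_self_add)
      simp only [if_true]
      calc _ ≤ J b * (1 * (U * w (y - b + r))) := by gcongr; exact J_le_one _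
        _ = _ := by ring
    by_cases hb : (b.natAbs : ℝ) ≤ N
    · refine le_trans ?_ (le_add_self.trans le_self_add)
      simp only [hb, if_true]
      calc _ ≤ J b * (J (d * y + b * (y - a)) * (U * w (y - b + r))) := by gcongr
        _ = _ := by ring
    · refine le_trans ?_ le_add_self
      simp only [ne_eq, hy, not_false_eq_true, if_true]
      calc _ ≤ (ENNReal.ofReal N)⁻¹ *
            (J (d * y + b * (y - a)) * (u (e + y) * w (y - b + r))) := by
            gcongr; exact J_le_inv_of_lt (not_le.mp hb)
        _ = _ := by ring
  have hk := one_le_kap hN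
  calc _ ≤ _ := ENNReal.tsum_le_tsum fun b => ENNReal.tsum_le_tsum fun y => hle b y
    _ = (U * ∑' b, J b * w (a - b + r))
        + (∑' b : ℤ, (if (b.natAbs : ℝ) ≤ N then J b else 0) *
          (U * ∑' y, if d + b ≠ 0 then w (y - b + r) * J (d * y + b * (y - a)) else 0))
        + (ENNReal.ofReal N)⁻¹ * ∑' y, u (e + y) *
          ∑' b, if y ≠ a then w (y - b + r) * J (d * y + b * (y - a)) else 0 := by
        simp_rw [ENNReal.tsum_add, ENNReal.tsum_mul_left, tsum_ite_eq]
        congr 2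
        · rw [ENNReal.tsum_mul_left]
        · rw [ENNReal.tsum_comm]
          simp_rw [ENNReal.tsum_mul_left]
    _ ≤ (U * (kap N * W)) + (∑' b : ℤ, (if (b.natAbs : ℝ) ≤ N then J b else 0) *
          (U * (kap N * W))) + (ENNReal.ofReal N)⁻¹ * ∑' y, u (e + y) * (kap N * W) := by
        gcongr with b y
        · exact tsum_J_mul_le hN w (φ := fun b => b) (ψ := fun b => a - b + r)
            (fun _ _ h => h) (fun _ _ h => by simpa using h)
        · refine tsum_ite_J_mul_le hN w (ψ := fun y => y - b + r)
            (φ := fun y => d * y + b * (y - a)) (p := fun _ => d + b ≠ 0) ?_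
            (fun _ _ h => by simpa using h)
          intro y y' h _ he
          exact mul_left_cancel₀ h (by linear_combination he)
        · refine tsum_ite_J_mul_le hN w (ψ := fun b => y - b + r)
            (φ := fun b => d * y + b * (y - a)) (p := fun _ => y ≠ a) ?_
            (fun _ _ h => by simpa using h)
          intro b b' h _ he
          exact mul_right_cancel₀ (sub_ne_zero.mpr h) (by linear_combination he)
    _ ≤ (U * (kap N * W)) + kap N * (U * (kap N * W))
        + (ENNReal.ofReal N)⁻¹ * ((ENNReal.ofReal N * U) * (kap N * W)) := by
        rw [ENNReal.tsum_mul_right, ENNReal.tsum_mul_right]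
        gcongr
        · exact tsum_J_low_le' hN
        · exact tsum_comp_le_nB hN u (fun _ _ h => by simpa using h)
    _ = 1 * kap N * (U * W) + kap N * kap N * (U * W) + 1 * kap N * (U * W) := by
        rw [mul_assoc (ENNReal.ofReal N) U, ← mul_assoc (ENNReal.ofReal N)⁻¹,
          ENNReal.inv_mul_cancel (ofReal_ne_zero_of_one_le hN) ENNReal.ofReal_ne_top]
        ring
    _ ≤ kap N * kap N * (U * W) + kap N * kap N * (U * W) + kap N * kap N * (U * W) := by
        gcongr
    _ = _ := by ring

/-- A double sum with two weights and a function of the difference. -/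
lemma tsum_J_J_diff_le (hN : 1 ≤ N) (g : ℤ → ℝ≥0∞) (n : ℤ) :
    ∑' b, ∑' a, J b * (J a * g (n + b - a)) ≤ 10 * kap N ^ 2 * nB 0 N g := by
  set G := nB 0 N g
  -- If one of the two variables is at most N, its weight is summed by itself and the other weight
  -- is matched with g. If both exceed N, the product is at most the larger square, whose sum is
  -- O(1/N) and cancels the ℓ¹ cost of g.
  have hle : ∀ b a, J b * (J a * g (n + b - a)) ≤
      (if (b.natAbs : ℝ) ≤ N then J b else 0) * (J a * g (n + b - a))
      + (if (a.natAbs : ℝ) ≤ N then J a else 0) * (J b * g (n + b - a))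
      + ((if (b.natAbs : ℝ) ≤ N then 0 else J b * J b) * g (n + b - a)
      + (if (a.natAbs : ℝ) ≤ N then 0 else J a * J a) * g (n + b - a)) := by
    intro b a
    by_cases hb : (b.natAbs : ℝ) ≤ N
    · refine le_trans ?_ (le_self_add.trans le_self_add)
      rw [if_pos hb]
    by_cases ha : (a.natAbs : ℝ) ≤ N
    · refine le_trans ?_ (le_add_self.trans le_self_add)
      simp only [ha, if_true]
      exact le_of_eq (by ring)
    · refine le_trans ?_ le_add_self
      simp only [ha, hb, if_false]
      rcases le_total (J a) (J b) with h | h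
      · refine le_trans ?_ le_self_add
        rw [mul_assoc]; gcongr
      · refine le_trans ?_ le_add_self
        rw [mul_assoc]; gcongr
  calc _ ≤ _ := ENNReal.tsum_le_tsum fun b => ENNReal.tsum_le_tsum fun a => hle b a
    _ = (∑' b : ℤ, (if (b.natAbs : ℝ) ≤ N then J b else 0) * ∑' a, J a * g (n + b - a))
      + (∑' a : ℤ, (if (a.natAbs : ℝ) ≤ N then J a else 0) * ∑' b, J b * g (n + b - a))
      + ((∑' b : ℤ, (if (b.natAbs : ℝ) ≤ N then 0 else J b * J b) * ∑' a, g (n + b - a))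
      + (∑' a : ℤ, (if (a.natAbs : ℝ) ≤ N then 0 else J a * J a) * ∑' b, g (n + b - a))) := by
        simp_rw [ENNReal.tsum_add, ENNReal.tsum_mul_left]
        congr 2
        · rw [ENNReal.tsum_comm]; simp_rw [ENNReal.tsum_mul_left]
        · rw [ENNReal.tsum_comm]; simp_rw [ENNReal.tsum_mul_left]
    _ ≤ (∑' b : ℤ, (if (b.natAbs : ℝ) ≤ N then J b else 0) * (kap N * G))
      + (∑' a : ℤ, (if (a.natAbs : ℝ) ≤ N then J a else 0) * (kap N * G))
      + ((∑' b : ℤ, (if (b.natAbs : ℝ) ≤ N then 0 else J b * J b) * (ENNReal.ofReal N * G))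
      + (∑' a : ℤ, (if (a.natAbs : ℝ) ≤ N then 0 else J a * J a) * (ENNReal.ofReal N * G))) := by
        gcongr with x x x x
        · exact tsum_J_mul_le hN g (φ := fun a => a) (fun _ _ h => h)
            (fun _ _ h => by simpa using h)
        · exact tsum_J_mul_le hN g (φ := fun a => a) (ψ := fun b => n + b - x) (fun _ _ h => h)
            (fun _ _ h => by simpa using h)
        · exact tsum_comp_le_nB hN g (fun _ _ h => by simpa using h)
        · exact tsum_comp_le_nB hN g (ψ := fun b => n + b - x) (fun _ _ h => by simpa using h)
    _ ≤ kap N * (kap N * G) + kap N * (kap N * G)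
      + (4 * (ENNReal.ofReal N)⁻¹ * (ENNReal.ofReal N * G)
        + 4 * (ENNReal.ofReal N)⁻¹ * (ENNReal.ofReal N * G)) := by
        simp_rw [ENNReal.tsum_mul_right]
        gcongr
        · exact tsum_J_low_le' hN
        · exact tsum_J_low_le' hN
        · exact tsum_J_sq_high_le hN
        · exact tsum_J_sq_high_le hN
    _ = 2 * (kap N * kap N) * G + 8 * (1 * 1) * G := by
        rw [mul_assoc 4, ← mul_assoc (ENNReal.ofReal N)⁻¹,
          ENNReal.inv_mul_cancel (ofReal_ne_zero_of_one_le hN) ENNReal.ofReal_ne_top]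
        ring
    _ ≤ 2 * (kap N * kap N) * G + 8 * (kap N * kap N) * G := by
        gcongr <;> exact one_le_kap hN
    _ = _ := by ring

end LogarithmicSums

/-! ### Slot bounds for the kernels -/

section SlotBounds

variable {N : ℝ} {k : ℕ}

open Classical in
/-- The weight `1/(|a||b|)` of the nonresonant quartic terms. -/
def kerQuartic (m : Fin 4 → ℤ) : ℝ≥0∞ :=
  if m 0 + m 1 - m 2 - m 3 = 0 then J (m 2 - m 0) * J (m 2 - m 1) else 0

open Classical in
/-- The weight `1/(|a||b|)` of the sextic terms. -/
def kerSextic (m : Fin 6 → ℤ) : ℝ≥0∞ :=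
  if m 0 + m 1 + m 2 - m 3 - m 4 - m 5 = 0 then J (m 5 - m 2) * J (m 5 - m 1) else 0

open Classical in
/-- The weight `1/(|a||b||q|)` of the nonresonant sextic terms (`q` replaced by `1` if it is `0`). -/
def kerNonres (m : Fin 6 → ℤ) : ℝ≥0∞ :=
  if m 0 + m 1 + m 2 - m 3 - m 4 - m 5 = 0 ∧ m 4 ≠ m 0 ∧ m 3 ≠ m 0 then
    J (m 5 - m 2) * J (m 5 - m 1) *
      J ((m 0 - m 4) * (m 0 - m 3) - (m 5 - m 2) * (m 5 - m 1)) else 0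

open Classical in
/-- The kernel of `∑ |v(n)|⁴`. -/
def kerDiag (m : Fin 4 → ℤ) : ℝ≥0∞ := if ∀ i, m i = m 0 then 1 else 0

/-- With slot `i` pinned to `n`, the linear relation on the support leaves only the free parameters
φ(m) to be summed over. -/
lemma maj_le_param {κ : Type*} {K : (Fin k → ℤ) → ℝ≥0∞} {f : Fin k → ℤ → ℝ≥0∞} {i : Fin k} {n : ℤ}
    (hi : f i = Pi.single n 1) (φ : (Fin k → ℤ) → κ) (G : κ → ℝ≥0∞)
    (hle : ∀ m, K m ≠ 0 → m i = n → K m * ∏ l, f l (m l) ≤ G (φ m))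
    (hinj : ∀ m m', K m ≠ 0 → K m' ≠ 0 → m i = n → m' i = n → φ m = φ m' → m = m') :
    maj K f ≤ ∑' p, G p := by
  unfold maj
  have h0 : ∀ m, m ∉ {m | K m ≠ 0 ∧ m i = n} → K m * ∏ l, f l (m l) = 0 := by
    intro m hm
    by_cases h : K m = 0
    · simp [h]
    · have : m i ≠ n := fun e => hm ⟨h, e⟩
      rw [Finset.prod_eq_zero (Finset.mem_univ i) (by rw [hi]; simp [this]), mul_zero]
  rw [← tsum_subtype_eq_of_support_subset (s := {m | K m ≠ 0 ∧ m i = n})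
    (fun m hm => by by_contra h; exact hm (h0 m h))]
  calc _ ≤ ∑' m : {m | K m ≠ 0 ∧ m i = n}, G (φ m) :=
        ENNReal.tsum_le_tsum fun m => hle m m.2.1 m.2.2
    _ ≤ _ := ENNReal.tsum_comp_le_tsum_of_injective
        (f := fun m : {m | K m ≠ 0 ∧ m i = n} => φ m)
        (fun m m' h => Subtype.ext (hinj m m' m.2.1 m'.2.1 m.2.2 m'.2.2 h)) G

lemma kerQuartic_ne {m : Fin 4 → ℤ} (h : kerQuartic m ≠ 0) :
    m 0 + m 1 - m 2 - m 3 = 0 ∧ kerQuartic m = J (m 2 - m 0) * J (m 2 - m 1) := by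
  by_cases hl : m 0 + m 1 - m 2 - m 3 = 0
  · exact ⟨hl, if_pos hl⟩
  · exact absurd (if_neg hl) h

lemma kerSextic_ne {m : Fin 6 → ℤ} (h : kerSextic m ≠ 0) :
    m 0 + m 1 + m 2 - m 3 - m 4 - m 5 = 0 ∧
      kerSextic m = J (m 5 - m 2) * J (m 5 - m 1) := by
  by_cases hl : m 0 + m 1 + m 2 - m 3 - m 4 - m 5 = 0
  · exact ⟨hl, if_pos hl⟩
  · exact absurd (if_neg hl) h

lemma kerNonres_ne {m : Fin 6 → ℤ} (h : kerNonres m ≠ 0) :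
    m 0 + m 1 + m 2 - m 3 - m 4 - m 5 = 0 ∧ m 4 ≠ m 0 ∧ m 3 ≠ m 0 ∧
      kerNonres m = J (m 5 - m 2) * J (m 5 - m 1) *
      J ((m 0 - m 4) * (m 0 - m 3) - (m 5 - m 2) * (m 5 - m 1)) := by
  by_cases hl : m 0 + m 1 + m 2 - m 3 - m 4 - m 5 = 0 ∧ m 4 ≠ m 0 ∧ m 3 ≠ m 0
  · exact ⟨hl.1, hl.2.1, hl.2.2, if_pos hl⟩
  · exact absurd (if_neg hl) h

lemma tsum_prod_le {α γ : Type*} {F : α × γ → ℝ≥0∞} {f : α → ℝ≥0∞} {A B : ℝ≥0∞}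
    (hf : ∑' a, f a ≤ A) (hG : ∀ a, ∑' c, F (a, c) ≤ f a * B) : ∑' p, F p ≤ A * B := by
  rw [ENNReal.tsum_prod']
  exact (ENNReal.tsum_le_tsum hG).trans (by rw [ENNReal.tsum_mul_right]; gcongr)

lemma tsum_mul_le_mul {γ : Type*} {F : γ → ℝ≥0∞} {c B : ℝ≥0∞} (h : ∑' x, F x ≤ B) :
    ∑' x, c * F x ≤ c * B := by
  rw [ENNReal.tsum_mul_left]; gcongr

lemma fin4_ext {m m' : Fin 4 → ℤ} (h0 : m 0 = m' 0) (h1 : m 1 = m' 1) (h2 : m 2 = m' 2)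
    (h3 : m 3 = m' 3) : m = m' := by
  ext i; fin_cases i <;> assumption

lemma fin6_ext {m m' : Fin 6 → ℤ} (h0 : m 0 = m' 0) (h1 : m 1 = m' 1) (h2 : m 2 = m' 2)
    (h3 : m 3 = m' 3) (h4 : m 4 = m' 4) (h5 : m 5 = m' 5) : m = m' := by
  ext i; fin_cases i <;> assumption

lemma J_shift_le (hN : 1 ≤ N) (f : ℤ → ℝ≥0∞) (c : ℤ) :
    ∑' y, J (c - y) * f y ≤ kap N * nB 0 N f :=
  tsum_J_mul_le hN f (φ := fun y => c - y) (ψ := fun y => y) (fun _ _ h => by simpa using h)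
    (fun _ _ h => h)

lemma quartic_pair_sum (hN : 1 ≤ N) (f g : ℤ → ℝ≥0∞) (n : ℤ) :
    ∑' p : ℤ × ℤ, J (n - p.1) * f p.1 * (J (n - p.2) * g p.2)
      ≤ (kap N * nB 0 N f) * (kap N * nB 0 N g) :=
  tsum_prod_le (f := fun a => J (n - a) * f a) (J_shift_le hN f n)
    fun _ => tsum_mul_le_mul (J_shift_le hN g n)

/-- Pin one slot and free the other slot of the same conjugation type. The linear relation then
turns the two weights into the reciprocal distances from n to the two remaining indices, and the sum
factors into two logarithmic ones. -/
lemma slotBound_kerQuartic (hN : 1 ≤ N) : SlotBound 0 N (kap N ^ 2) kerQuartic := by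
  have e23 : (((Finset.univ : Finset (Fin 4)).erase 2).erase 3) = {0, 1} := by decide
  have e32 : (((Finset.univ : Finset (Fin 4)).erase 3).erase 2) = {0, 1} := by decide
  have e01 : (((Finset.univ : Finset (Fin 4)).erase 0).erase 1) = {2, 3} := by decide
  have e10 : (((Finset.univ : Finset (Fin 4)).erase 1).erase 0) = {2, 3} := by decide
  have h23 : PairBound N (kap N ^ 2) kerQuartic 2 3 := by
    refine ⟨by decide, fun f n hi hj => ?_⟩
    rw [e23, Finset.prod_pair (by decide)]
    refine (maj_le_param hi (fun m => (m 0, m 1)) _ ?_ ?_).trans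
      ((quartic_pair_sum hN (f 0) (f 1) n).trans (le_of_eq (by ring)))
    · intro m hm hn
      rw [(kerQuartic_ne hm).2, Fin.prod_univ_four, hi, hj, hn]
      simp only [Pi.single_eq_same]
      exact le_of_eq (by ring)
    · intro m m' hm hm' hn hn' h
      have := (kerQuartic_ne hm).1
      have := (kerQuartic_ne hm').1
      simp only [Prod.mk.injEq] at h
      refine fin4_ext ?_ ?_ ?_ ?_ <;> omega
  have h32 : PairBound N (kap N ^ 2) kerQuartic 3 2 := by
    refine ⟨by decide, fun f n hi hj => ?_⟩
    rw [e32, Finset.prod_pair (by decide)]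
    refine (maj_le_param hi (fun m => (m 0, m 1)) _ ?_ ?_).trans
      ((quartic_pair_sum hN (f 0) (f 1) n).trans (le_of_eq (by ring)))
    · intro m hm hn
      have hl := (kerQuartic_ne hm).1
      rw [(kerQuartic_ne hm).2, Fin.prod_univ_four, hi, hj, hn,
        show m 2 - m 0 = m 1 - n by omega, show m 2 - m 1 = m 0 - n by omega, J_sub_comm,
        J_sub_comm (m 0)]
      simp only [Pi.single_eq_same]
      exact le_of_eq (by ring)
    · intro m m' hm hm' hn hn' h
      have := (kerQuartic_ne hm).1
      have := (kerQuartic_ne hm').1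
      simp only [Prod.mk.injEq] at h
      refine fin4_ext ?_ ?_ ?_ ?_ <;> omega
  have h01 : PairBound N (kap N ^ 2) kerQuartic 0 1 := by
    refine ⟨by decide, fun f n hi hj => ?_⟩
    rw [e01, Finset.prod_pair (by decide)]
    refine (maj_le_param hi (fun m => (m 2, m 3)) _ ?_ ?_).trans
      ((quartic_pair_sum hN (f 2) (f 3) n).trans (le_of_eq (by ring)))
    · intro m hm hn
      have hl := (kerQuartic_ne hm).1
      rw [(kerQuartic_ne hm).2, Fin.prod_univ_four, hi, hj, hn,
        show m 2 - m 1 = n - m 3 by omega, J_sub_comm]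
      simp only [Pi.single_eq_same]
      exact le_of_eq (by ring)
    · intro m m' hm hm' hn hn' h
      have := (kerQuartic_ne hm).1
      have := (kerQuartic_ne hm').1
      simp only [Prod.mk.injEq] at h
      refine fin4_ext ?_ ?_ ?_ ?_ <;> omega
  have h10 : PairBound N (kap N ^ 2) kerQuartic 1 0 := by
    refine ⟨by decide, fun f n hi hj => ?_⟩
    rw [e10, Finset.prod_pair (by decide)]
    refine (maj_le_param hi (fun m => (m 2, m 3)) _ ?_ ?_).trans
      ((quartic_pair_sum hN (f 2) (f 3) n).trans (le_of_eq (by ring)))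
    · intro m hm hn
      have hl := (kerQuartic_ne hm).1
      rw [(kerQuartic_ne hm).2, Fin.prod_univ_four, hi, hj, hn,
        show m 2 - m 0 = n - m 3 by omega, J_sub_comm (m 2)]
      simp only [Pi.single_eq_same]
      exact le_of_eq (by ring)
    · intro m m' hm hm' hn hn' h
      have := (kerQuartic_ne hm).1
      have := (kerQuartic_ne hm').1
      simp only [Prod.mk.injEq] at h
      refine fin4_ext ?_ ?_ ?_ ?_ <;> omega
  refine slotBound_of_pairBound hN (fun i => ?_) (fun j => ?_)
  · fin_cases i
    exacts [⟨1, h01⟩, ⟨0, h10⟩, ⟨3, h23⟩, ⟨2, h32⟩]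
  · fin_cases j
    exacts [⟨1, h10⟩, ⟨0, h01⟩, ⟨3, h32⟩, ⟨2, h23⟩]

/-- One pinned index determines all the others, so no sum is left. -/
lemma slotBound_kerDiag (hN : 1 ≤ N) : SlotBound 0 N 1 kerDiag := by
  have h : ∀ i j : Fin 4, i ≠ j → PairBound N 1 kerDiag i j := by
    intro i j hij
    refine ⟨hij, fun f n hi hj => ?_⟩
    have hK : ∀ m, kerDiag m ≠ 0 → ∀ l, m l = m 0 := fun m hm => by
      by_contra h; exact hm (if_neg h)
    refine (maj_le_param hi (fun _ => ()) (fun _ =>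
      ∏ l ∈ (Finset.univ.erase i).erase j, nB 0 N (f l)) ?_ ?_).trans (by simp)
    · intro m hm hn
      have hm' := hK m hm
      have : kerDiag m = 1 := if_pos hm'
      rw [this, one_mul, ← Finset.mul_prod_erase _ _ (Finset.mem_univ i),
        ← Finset.mul_prod_erase (Finset.univ.erase i) _
        (Finset.mem_erase.mpr ⟨hij.symm, Finset.mem_univ j⟩), hi, hj, hn]
      simp only [Pi.single_eq_same, one_mul]
      gcongr
      exact le_nB_zero _ _
    · intro m m' hm hm' hn hn' _
      ext l
      have := hK m hm l; have := hK m hm i; have := hK m' hm' l; have := hK m' hm' i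
      omega
  refine slotBound_of_pairBound hN (fun i => ?_) (fun j => ?_)
  · obtain ⟨j, hj⟩ := exists_ne i; exact ⟨j, h i j hj.symm⟩
  · obtain ⟨i, hi⟩ := exists_ne j; exact ⟨i, h i j hi⟩

/-- From four pair bounds and the symmetries `1 ↔ 2`, `3 ↔ 4`. -/
lemma slotBound_of_symm {K : (Fin 6 → ℤ) → ℝ≥0∞} {β : ℝ≥0∞} (hN : 1 ≤ N)
    (s12 : ∀ m, K (m ∘ Equiv.swap 1 2) = K m) (s34 : ∀ m, K (m ∘ Equiv.swap 3 4) = K m)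
    (hi0 : ∃ j, PairBound N β K 0 j) (hi1 : ∃ j, PairBound N β K 1 j)
    (hi3 : ∃ j, PairBound N β K 3 j) (hi5 : ∃ j, PairBound N β K 5 j)
    (hj0 : ∃ i, PairBound N β K i 0) (hj1 : ∃ i, PairBound N β K i 1)
    (hj3 : ∃ i, PairBound N β K i 3) (hj5 : ∃ i, PairBound N β K i 5) : SlotBound 0 N β K := by
  have e2 : Equiv.swap (1 : Fin 6) 2 1 = 2 := by decide
  have e4 : Equiv.swap (3 : Fin 6) 4 3 = 4 := by decide
  have hi2 : ∃ j, PairBound N β K 2 j := hi1.imp' (Equiv.swap 1 2) fun j h => e2 ▸ h.perm _ s12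
  have hi4 : ∃ j, PairBound N β K 4 j := hi3.imp' (Equiv.swap 3 4) fun j h => e4 ▸ h.perm _ s34
  have hj2 : ∃ i, PairBound N β K i 2 := hj1.imp' (Equiv.swap 1 2) fun i h => e2 ▸ h.perm _ s12
  have hj4 : ∃ i, PairBound N β K i 4 := hj3.imp' (Equiv.swap 3 4) fun i h => e4 ▸ h.perm _ s34
  refine slotBound_of_pairBound hN (fun i => ?_) (fun j => ?_)
  · fin_cases i <;> assumption
  · fin_cases j <;> assumption

/-- Two free sums cost N each and two weighted sums a logarithm each; the centre of a weight may
depend on the variables fixed before it. -/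
lemma sextic_quad_sum (hN : 1 ≤ N) (f g u w : ℤ → ℝ≥0∞) (c : ℤ → ℤ → ℤ) (d : ℤ → ℤ → ℤ → ℤ) :
    ∑' p : ℤ × ℤ × ℤ × ℤ, f p.1 * (g p.2.1 * (J (c p.1 p.2.1 - p.2.2.1) * u p.2.2.1 *
        (J (d p.1 p.2.1 p.2.2.1 - p.2.2.2) * w p.2.2.2)))
      ≤ (ENNReal.ofReal N * nB 0 N f) * ((ENNReal.ofReal N * nB 0 N g) *
        ((kap N * nB 0 N u) * (kap N * nB 0 N w))) :=
  tsum_prod_le (tsum_le_nB le_rfl hN f) fun a => tsum_mul_le_mul <|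
    tsum_prod_le (tsum_le_nB le_rfl hN g) fun b => tsum_mul_le_mul <|
    tsum_prod_le (f := fun x => J (c a b - x) * u x) (J_shift_le hN u (c a b))
    fun x => tsum_mul_le_mul <| J_shift_le hN w (d a b x)

/-- The pairs {0, 5} and {1, 3} are chosen so that, after elimination of the freed index, each of
the two weights is matched with a function of its own summation variable. -/
lemma slotBound_kerSextic (hN : 1 ≤ N) :
    SlotBound 0 N (ENNReal.ofReal N ^ 2 * kap N ^ 2) kerSextic := by
  have e50 : (((Finset.univ : Finset (Fin 6)).erase 5).erase 0) = {3, 4, 1, 2} := by decide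
  have e05 : (((Finset.univ : Finset (Fin 6)).erase 0).erase 5) = {3, 4, 1, 2} := by decide
  have e13 : (((Finset.univ : Finset (Fin 6)).erase 1).erase 3) = {0, 4, 5, 2} := by decide
  have e31 : (((Finset.univ : Finset (Fin 6)).erase 3).erase 1) = {0, 4, 2, 5} := by decide
  have hprod : ∀ (a b c d : Fin 6) (F : Fin 6 → ℝ≥0∞), a ∉ ({b, c, d} : Finset (Fin 6)) →
      b ∉ ({c, d} : Finset (Fin 6)) → c ≠ d → ∏ l ∈ ({a, b, c, d} : Finset (Fin 6)), F l
        = F a * (F b * (F c * F d)) := by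
    intro a b c d F h1 h2 h3
    rw [Finset.prod_insert h1, Finset.prod_insert h2, Finset.prod_pair h3]
  have h50 : PairBound N (ENNReal.ofReal N ^ 2 * kap N ^ 2) kerSextic 5 0 := by
    refine ⟨by decide, fun f n hi hj => ?_⟩
    rw [e50, hprod _ _ _ _ _ (by decide) (by decide) (by decide)]
    refine (maj_le_param hi (fun m => (m 3, m 4, m 1, m 2)) _ ?_ ?_).trans
      ((sextic_quad_sum hN (f 3) (f 4) (f 1) (f 2) (fun _ _ => n) (fun _ _ _ => n)).trans
        (le_of_eq (by ring)))
    · intro m hm hn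
      rw [(kerSextic_ne hm).2, Fin.prod_univ_six, hi, hj, hn]
      simp only [Pi.single_eq_same]
      exact le_of_eq (by ring)
    · intro m m' hm hm' hn hn' h
      have := (kerSextic_ne hm).1
      have := (kerSextic_ne hm').1
      simp only [Prod.mk.injEq] at h
      refine fin6_ext ?_ ?_ ?_ ?_ ?_ ?_ <;> omega
  have h05 : PairBound N (ENNReal.ofReal N ^ 2 * kap N ^ 2) kerSextic 0 5 := by
    refine ⟨by decide, fun f n hi hj => ?_⟩
    rw [e05, hprod _ _ _ _ _ (by decide) (by decide) (by decide)]
    refine (maj_le_param hi (fun m => (m 3, m 4, m 1, m 2)) _ ?_ ?_).trans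
      ((sextic_quad_sum hN (f 3) (f 4) (f 1) (f 2) (fun p q => p + q - n)
        (fun p q _ => p + q - n)).trans (le_of_eq (by ring)))
    · intro m hm hn
      have hl := (kerSextic_ne hm).1
      rw [(kerSextic_ne hm).2, Fin.prod_univ_six, hi, hj, hn,
        show m 5 - m 2 = m 1 - (m 3 + m 4 - n) by omega,
        show m 5 - m 1 = m 2 - (m 3 + m 4 - n) by omega, J_sub_comm, J_sub_comm (m 2)]
      simp only [Pi.single_eq_same]
      exact le_of_eq (by ring)
    · intro m m' hm hm' hn hn' h
      have := (kerSextic_ne hm).1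
      have := (kerSextic_ne hm').1
      simp only [Prod.mk.injEq] at h
      refine fin6_ext ?_ ?_ ?_ ?_ ?_ ?_ <;> omega
  have h13 : PairBound N (ENNReal.ofReal N ^ 2 * kap N ^ 2) kerSextic 1 3 := by
    refine ⟨by decide, fun f n hi hj => ?_⟩
    rw [e13, hprod _ _ _ _ _ (by decide) (by decide) (by decide)]
    refine (maj_le_param hi (fun m => (m 0, m 4, m 5, m 2)) _ ?_ ?_).trans
      ((sextic_quad_sum hN (f 0) (f 4) (f 5) (f 2) (fun _ _ => n)
        (fun _ _ r => r)).trans (le_of_eq (by ring)))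
    · intro m hm hn
      rw [(kerSextic_ne hm).2, Fin.prod_univ_six, hi, hj, hn, J_sub_comm _ n]
      simp only [Pi.single_eq_same]
      exact le_of_eq (by ring)
    · intro m m' hm hm' hn hn' h
      have := (kerSextic_ne hm).1
      have := (kerSextic_ne hm').1
      simp only [Prod.mk.injEq] at h
      refine fin6_ext ?_ ?_ ?_ ?_ ?_ ?_ <;> omega
  have h31 : PairBound N (ENNReal.ofReal N ^ 2 * kap N ^ 2) kerSextic 3 1 := by
    refine ⟨by decide, fun f n hi hj => ?_⟩
    rw [e31, hprod _ _ _ _ _ (by decide) (by decide) (by decide)]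
    refine (maj_le_param hi (fun m => (m 0, m 4, m 2, m 5)) _ ?_ ?_).trans
      ((sextic_quad_sum hN (f 0) (f 4) (f 2) (f 5) (fun p q => n + q - p)
        (fun _ _ r => r)).trans (le_of_eq (by ring)))
    · intro m hm hn
      have hl := (kerSextic_ne hm).1
      rw [(kerSextic_ne hm).2, Fin.prod_univ_six, hi, hj, hn,
        show m 5 - m 1 = m 2 - (n + m 4 - m 0) by omega, J_sub_comm, J_sub_comm (m 2) (_ - _)]
      simp only [Pi.single_eq_same]
      exact le_of_eq (by ring)
    · intro m m' hm hm' hn hn' h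
      have := (kerSextic_ne hm).1
      have := (kerSextic_ne hm').1
      simp only [Prod.mk.injEq] at h
      refine fin6_ext ?_ ?_ ?_ ?_ ?_ ?_ <;> omega
  refine slotBound_of_symm hN (fun m => ?_) (fun m => ?_) ⟨5, h05⟩ ⟨3, h13⟩ ⟨1, h31⟩ ⟨0, h50⟩
    ⟨5, h50⟩ ⟨3, h31⟩ ⟨1, h13⟩ ⟨0, h05⟩
  · simp only [kerSextic, Function.comp_apply, show Equiv.swap (1 : Fin 6) 2 0 = 0 by decide,
      show Equiv.swap (1 : Fin 6) 2 1 = 2 by decide, show Equiv.swap (1 : Fin 6) 2 2 = 1 by decide,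
      show Equiv.swap (1 : Fin 6) 2 3 = 3 by decide, show Equiv.swap (1 : Fin 6) 2 4 = 4 by decide,
      show Equiv.swap (1 : Fin 6) 2 5 = 5 by decide]
    rw [add_right_comm, mul_comm]
  · simp only [kerSextic, Function.comp_apply, show Equiv.swap (3 : Fin 6) 4 0 = 0 by decide,
      show Equiv.swap (3 : Fin 6) 4 1 = 1 by decide, show Equiv.swap (3 : Fin 6) 4 2 = 2 by decide,
      show Equiv.swap (3 : Fin 6) 4 3 = 4 by decide, show Equiv.swap (3 : Fin 6) 4 4 = 3 by decide,
      show Equiv.swap (3 : Fin 6) 4 5 = 5 by decide]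
    rw [sub_right_comm _ (m 4)]

end SlotBounds

/-! ### Pair bounds for the kernel with the additional weight 1/|q| -/

section PairBounds

variable {N : ℝ} {k : ℕ}

/-- For given m 1, m 2, m 5 the argument of the third weight is quadratic in m 4, so the sum over m
4 costs a logarithm instead of N. -/
lemma kerNonres_pair03 (hN : 1 ≤ N) :
    PairBound N (10 * ENNReal.ofReal N * kap N ^ 3) kerNonres 0 3 := by
  have e : (((Finset.univ : Finset (Fin 6)).erase 0).erase 3) = {5, 1, 2, 4} := by decide
  refine ⟨by decide, fun f n hi hj => ?_⟩
  rw [e, Finset.prod_insert (by decide), Finset.prod_insert (by decide),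
    Finset.prod_pair (by decide)]
  have hsum : ∑' p : ℤ × ℤ × ℤ × ℤ, f 5 p.1 * (J (p.1 - p.2.1) * f 1 p.2.1 *
      (J (p.1 - p.2.2.1) * f 2 p.2.2.1 * (f 4 p.2.2.2 *
        J ((n - p.2.2.2) * (p.2.2.2 - (p.2.1 + p.2.2.1 - p.1))
          - (p.1 - p.2.2.1) * (p.1 - p.2.1)))))
      ≤ (ENNReal.ofReal N * nB 0 N (f 5)) * ((kap N * nB 0 N (f 1)) *
        ((kap N * nB 0 N (f 2)) * (2 * kap N * nB 0 N (f 4)))) :=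
    tsum_prod_le (tsum_le_nB le_rfl hN _) fun p => tsum_mul_le_mul <|
      tsum_prod_le (f := fun x => J (p - x) * f 1 x) (J_shift_le hN _ p) fun x =>
      tsum_mul_le_mul <| tsum_prod_le (f := fun y => J (p - y) * f 2 y) (J_shift_le hN _ p)
      fun y => tsum_mul_le_mul <|
        tsum_quadratic_le hN (f 4) n (x + y - p) ((p - y) * (p - x))
  calc maj kerNonres f ≤ _ := (maj_le_param hi (fun m => (m 5, m 1, m 2, m 4)) _ ?_ ?_).trans hsum
    _ = 2 * (ENNReal.ofReal N * kap N ^ 3) *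
        (nB 0 N (f 5) * (nB 0 N (f 1) * (nB 0 N (f 2) * nB 0 N (f 4)))) := by ring
    _ ≤ 10 * (ENNReal.ofReal N * kap N ^ 3) *
        (nB 0 N (f 5) * (nB 0 N (f 1) * (nB 0 N (f 2) * nB 0 N (f 4)))) := by
        gcongr; norm_num
    _ = _ := by ring
  · intro m hm hn
    obtain ⟨hl, -, -, hK⟩ := kerNonres_ne hm
    rw [hK, Fin.prod_univ_six, hi, hj, hn, show n - m 3 = m 4 - (m 1 + m 2 - m 5) by omega]
    simp only [Pi.single_eq_same]
    exact le_of_eq (by ring)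
  · intro m m' hm hm' hn hn' h
    have := (kerNonres_ne hm).1
    have := (kerNonres_ne hm').1
    simp only [Prod.mk.injEq] at h
    refine fin6_ext ?_ ?_ ?_ ?_ ?_ ?_ <;> omega

/-- For given m 1, m 2, m 5 the difference m 0 - m 4 is constant, and it is nonzero on the support;
the argument of the third weight is then affine and injective in m 4. -/
lemma kerNonres_pair30 (hN : 1 ≤ N) :
    PairBound N (10 * ENNReal.ofReal N * kap N ^ 3) kerNonres 3 0 := by
  have e : (((Finset.univ : Finset (Fin 6)).erase 3).erase 0) = {5, 1, 2, 4} := by decide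
  refine ⟨by decide, fun f n hi hj => ?_⟩
  rw [e, Finset.prod_insert (by decide), Finset.prod_insert (by decide),
    Finset.prod_pair (by decide)]
  have hsum : ∑' p : ℤ × ℤ × ℤ × ℤ, f 5 p.1 * (J (p.1 - p.2.1) * f 1 p.2.1 *
      (J (p.1 - p.2.2.1) * f 2 p.2.2.1 * (if n - p.2.1 - p.2.2.1 + p.1 ≠ 0 then f 4 p.2.2.2 *
        J ((n - p.2.1 - p.2.2.1 + p.1) * (p.2.2.2 - p.2.1 - p.2.2.1 + p.1)
          - (p.1 - p.2.2.1) * (p.1 - p.2.1)) else 0)))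
      ≤ (ENNReal.ofReal N * nB 0 N (f 5)) * ((kap N * nB 0 N (f 1)) *
        ((kap N * nB 0 N (f 2)) * (kap N * nB 0 N (f 4)))) :=
    tsum_prod_le (tsum_le_nB le_rfl hN _) fun p => tsum_mul_le_mul <|
      tsum_prod_le (f := fun x => J (p - x) * f 1 x) (J_shift_le hN _ p) fun x =>
      tsum_mul_le_mul <| tsum_prod_le (f := fun y => J (p - y) * f 2 y) (J_shift_le hN _ p)
      fun y => tsum_mul_le_mul <| tsum_ite_J_mul_le hN (f 4)
        (p := fun _ => n - x - y + p ≠ 0)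
        (φ := fun s => (n - x - y + p) * (s - x - y + p) - (p - y) * (p - x))
        (ψ := fun s => s)
        (fun s s' h _ he => mul_left_cancel₀ h (by linear_combination he)) (fun _ _ h => h)
  calc maj kerNonres f ≤ _ := (maj_le_param hi (fun m => (m 5, m 1, m 2, m 4)) _ ?_ ?_).trans hsum
    _ = 1 * (ENNReal.ofReal N * kap N ^ 3) *
        (nB 0 N (f 5) * (nB 0 N (f 1) * (nB 0 N (f 2) * nB 0 N (f 4)))) := by ring
    _ ≤ 10 * (ENNReal.ofReal N * kap N ^ 3) *
        (nB 0 N (f 5) * (nB 0 N (f 1) * (nB 0 N (f 2) * nB 0 N (f 4)))) := by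
        gcongr; norm_num
    _ = _ := by ring
  · intro m hm hn
    obtain ⟨hl, h4, -, hK⟩ := kerNonres_ne hm
    have e1 : m 0 - m 4 = n - m 1 - m 2 + m 5 := by omega
    have e2 : m 0 - m 3 = m 4 - m 1 - m 2 + m 5 := by omega
    have e3 : n - m 1 - m 2 + m 5 ≠ 0 := by omega
    rw [hK, Fin.prod_univ_six, hi, hj, hn, ← hn, e2, hn, e1]
    simp only [Pi.single_eq_same, if_pos e3]
    exact le_of_eq (by ring)
  · intro m m' hm hm' hn hn' h
    have := (kerNonres_ne hm).1
    have := (kerNonres_ne hm').1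
    simp only [Prod.mk.injEq] at h
    refine fin6_ext ?_ ?_ ?_ ?_ ?_ ?_ <;> omega

/-- Slot 1 carries no function, so the weight in b = n - m 1 has nothing to be matched with;
`tsum_unmatched_le` treats it together with the third weight, in the variables b and y = m 0 - m 3.
-/
lemma kerNonres_pair51 (hN : 1 ≤ N) :
    PairBound N (10 * ENNReal.ofReal N * kap N ^ 3) kerNonres 5 1 := by
  have e : (((Finset.univ : Finset (Fin 6)).erase 5).erase 1) = {3, 2, 0, 4} := by decide
  refine ⟨by decide, fun f n hi hj => ?_⟩
  rw [e, Finset.prod_insert (by decide), Finset.prod_insert (by decide),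
    Finset.prod_pair (by decide)]
  have hsum : ∑' p : ℤ × ℤ × ℤ × ℤ, f 3 p.1 * (J (n - p.2.1) * f 2 p.2.1 *
      (if p.1 - p.2.1 + p.2.2.1 ≠ 0 then
      J p.2.2.1 * (J ((p.1 - p.2.1) * p.2.2.2 + p.2.2.1 * (p.2.2.2 - (n - p.2.1))) *
        (f 0 (p.1 + p.2.2.2) * f 4 (p.2.2.2 - p.2.2.1 + p.2.1))) else 0))
      ≤ (ENNReal.ofReal N * nB 0 N (f 3)) * ((kap N * nB 0 N (f 2)) *
        (3 * kap N ^ 2 * (nB 0 N (f 0) * nB 0 N (f 4)))) :=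
    tsum_prod_le (tsum_le_nB le_rfl hN _) fun p => tsum_mul_le_mul <|
      tsum_prod_le (f := fun x => J (n - x) * f 2 x) (J_shift_le hN _ n) fun x =>
      tsum_mul_le_mul <| by
        rw [ENNReal.tsum_prod']
        exact tsum_unmatched_le hN (f 0) (f 4) (p - x) (n - x) p x
  calc maj kerNonres f ≤ _ := (maj_le_param hi (fun m => (m 3, m 2, n - m 1, m 0 - m 3)) _ ?_ ?_).trans hsum
    _ = 3 * (ENNReal.ofReal N * kap N ^ 3) *
        (nB 0 N (f 3) * (nB 0 N (f 2) * (nB 0 N (f 0) * nB 0 N (f 4)))) := by ring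
    _ ≤ 10 * (ENNReal.ofReal N * kap N ^ 3) *
        (nB 0 N (f 3) * (nB 0 N (f 2) * (nB 0 N (f 0) * nB 0 N (f 4)))) := by
        gcongr; norm_num
    _ = _ := by ring
  · intro m hm hn
    obtain ⟨hl, h4, -, hK⟩ := kerNonres_ne hm
    have e1 : m 3 - m 2 + (n - m 1) = m 0 - m 4 := by omega
    have e2 : m 0 - m 3 - (n - m 1) + m 2 = m 4 := by omega
    have e3 : m 0 - m 4 ≠ 0 := by omega
    have e4 : (m 3 - m 2) * (m 0 - m 3) + (n - m 1) * (m 0 - m 3 - (n - m 2))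
      = (m 0 - m 4) * (m 0 - m 3) - (n - m 2) * (n - m 1) := by rw [← e1]; ring
    rw [hK, Fin.prod_univ_six, hi, hj, hn]
    simp only [Pi.single_eq_same, e1, e2, if_pos e3, e4, add_sub_cancel]
    exact le_of_eq (by ring)
  · intro m m' hm hm' hn hn' h
    have := (kerNonres_ne hm).1
    have := (kerNonres_ne hm').1
    simp only [Prod.mk.injEq] at h
    refine fin6_ext ?_ ?_ ?_ ?_ ?_ ?_ <;> omega

/-- Slot 5 carries no function and both its weights involve m 5. With b = m 5 - n and a = m 5 - m 2
one has m 2 = n + b - a, the situation of `tsum_J_J_diff_le`, which is the origin of the constant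
10. The third weight, of slope m 0 - m 4 ≠ 0, serves the sum over m 4; m 3 costs N, and `f 0` is
bounded by its sup. -/
lemma kerNonres_pair15 (hN : 1 ≤ N) :
    PairBound N (10 * ENNReal.ofReal N * kap N ^ 3) kerNonres 1 5 := by
  have e : (((Finset.univ : Finset (Fin 6)).erase 1).erase 5) = {0, 2, 3, 4} := by decide
  refine ⟨by decide, fun f n hi hj => ?_⟩
  rw [e, Finset.prod_insert (by decide), Finset.prod_insert (by decide),
    Finset.prod_pair (by decide)]
  have hsum : ∑' p : (ℤ × ℤ) × ℤ × ℤ, J p.1.1 * (J p.1.2 * f 2 (n + p.1.1 - p.1.2)) *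
      (f 3 p.2.1 * (nB 0 N (f 0) * (if p.2.1 + p.1.2 - n ≠ 0 then f 4 p.2.2 *
        J ((p.2.1 + p.1.2 - n) * (p.2.2 + p.1.2 - n) - p.1.2 * p.1.1) else 0)))
      ≤ (10 * kap N ^ 2 * nB 0 N (f 2)) * ((ENNReal.ofReal N * nB 0 N (f 3)) *
        (nB 0 N (f 0) * (kap N * nB 0 N (f 4)))) :=
    tsum_prod_le (f := fun q : ℤ × ℤ => J q.1 * (J q.2 * f 2 (n + q.1 - q.2)))
      (by rw [ENNReal.tsum_prod']; exact tsum_J_J_diff_le hN (f 2) n)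
      fun q => tsum_mul_le_mul <| tsum_prod_le (tsum_le_nB le_rfl hN _) fun p =>
      tsum_mul_le_mul <| tsum_mul_le_mul <| tsum_ite_J_mul_le hN (f 4)
        (p := fun _ => p + q.2 - n ≠ 0)
        (φ := fun s => (p + q.2 - n) * (s + q.2 - n) - q.2 * q.1) (ψ := fun s => s)
        (fun s s' h _ he => mul_left_cancel₀ h (by linear_combination he)) (fun _ _ h => h)
  calc maj kerNonres f ≤ _ := (maj_le_param hi
        (fun m => ((m 5 - n, m 5 - m 2), m 3, m 4)) _ ?_ ?_).trans hsum
    _ = _ := by ring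
  · intro m hm hn
    obtain ⟨hl, h4, -, hK⟩ := kerNonres_ne hm
    have e1 : m 3 + (m 5 - m 2) - n = m 0 - m 4 := by omega
    have e2 : m 4 + (m 5 - m 2) - n = m 0 - m 3 := by omega
    have e3 : m 0 - m 4 ≠ 0 := by omega
    have e4 : n + (m 5 - n) - (m 5 - m 2) = m 2 := by omega
    rw [hK, Fin.prod_univ_six, hi, hj, hn]
    simp only [Pi.single_eq_same, e1, e2, if_pos e3, e4]
    calc _ ≤ J (m 5 - m 2) * J (m 5 - n) *
        J ((m 0 - m 4) * (m 0 - m 3) - (m 5 - m 2) * (m 5 - n)) *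
          (nB 0 N (f 0) * 1 * f 2 (m 2) * f 3 (m 3) * f 4 (m 4) * 1) := by
          gcongr; exact le_nB_zero _ _
      _ = _ := by ring
  · intro m m' hm hm' hn hn' h
    have := (kerNonres_ne hm).1
    have := (kerNonres_ne hm').1
    simp only [Prod.mk.injEq] at h
    refine fin6_ext ?_ ?_ ?_ ?_ ?_ ?_ <;> omega

lemma slotBound_kerNonres (hN : 1 ≤ N) :
    SlotBound 0 N (10 * ENNReal.ofReal N * kap N ^ 3) kerNonres := by
  refine slotBound_of_symm hN (fun m => ?_) (fun m => ?_) ⟨3, kerNonres_pair03 hN⟩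
    ⟨5, kerNonres_pair15 hN⟩ ⟨0, kerNonres_pair30 hN⟩ ⟨1, kerNonres_pair51 hN⟩
    ⟨3, kerNonres_pair30 hN⟩ ⟨5, kerNonres_pair51 hN⟩ ⟨0, kerNonres_pair03 hN⟩
    ⟨1, kerNonres_pair15 hN⟩
  · simp only [kerNonres, Function.comp_apply, show Equiv.swap (1 : Fin 6) 2 0 = 0 by decide,
      show Equiv.swap (1 : Fin 6) 2 1 = 2 by decide, show Equiv.swap (1 : Fin 6) 2 2 = 1 by decide,
      show Equiv.swap (1 : Fin 6) 2 3 = 3 by decide, show Equiv.swap (1 : Fin 6) 2 4 = 4 by decide,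
      show Equiv.swap (1 : Fin 6) 2 5 = 5 by decide]
    rw [add_right_comm, mul_comm (J (m 5 - m 1)), mul_comm (m 5 - m 1)]
  · simp only [kerNonres, Function.comp_apply, show Equiv.swap (3 : Fin 6) 4 0 = 0 by decide,
      show Equiv.swap (3 : Fin 6) 4 1 = 1 by decide, show Equiv.swap (3 : Fin 6) 4 2 = 2 by decide,
      show Equiv.swap (3 : Fin 6) 4 3 = 4 by decide, show Equiv.swap (3 : Fin 6) 4 4 = 3 by decide,
      show Equiv.swap (3 : Fin 6) 4 5 = 5 by decide]
    rw [sub_right_comm _ (m 4), mul_comm (m 0 - m 4)]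
    exact if_congr (by tauto) rfl rfl

end PairBounds

/-! ### The Banach space of sequences with norm `max (sup, N⁻¹ ∑)` and weight -/

section SequenceSpace

/-- Sequences `f` with finite norm `nB δ N`; the underlying element of `ℓ¹` is `e^{δ|n|} f(n)`. -/
def X (_δ _N : ℝ) : Type := lp (fun _ : ℤ => ℂ) 1

variable {δ N : ℝ} {k : ℕ}

instance : AddCommGroup (X δ N) := inferInstanceAs (AddCommGroup (lp (fun _ : ℤ => ℂ) 1))
instance : Module ℝ (X δ N) := inferInstanceAs (Module ℝ (lp (fun _ : ℤ => ℂ) 1))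

/-- The identity map to `ℓ¹`. -/
def X.toLp : X δ N ≃ₗ[ℝ] lp (fun _ : ℤ => ℂ) 1 := LinearEquiv.refl ℝ _

/-- The sequence which belongs to an element of `X δ N`. -/
def ev : X δ N →ₗ[ℝ] (ℤ → ℂ) where
  toFun u n := Real.exp (-(δ * |(n : ℝ)|)) • (X.toLp u : ℤ → ℂ) n
  map_add' u v := by ext n; simp
  map_smul' c u := by ext n; simp; ring

lemma exp_smul_ev (u : X δ N) (n : ℤ) :
    Real.exp (δ * |(n : ℝ)|) • ev u n = (X.toLp u : ℤ → ℂ) n := by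
  simp only [ev, LinearMap.coe_mk, AddHom.coe_mk, smul_smul, ← Real.exp_add]
  simp

lemma enorm_exp_smul (δ : ℝ) (n : ℤ) (z : ℂ) :
    ‖Real.exp (δ * |(n : ℝ)|) • z‖ₑ = wt δ n * ‖z‖ₑ := by
  rw [enorm_smul, wt, Real.enorm_eq_ofReal (Real.exp_pos _).le]

lemma wt_mul_enorm_ev (u : X δ N) (n : ℤ) : wt δ n * ‖ev u n‖ₑ = ‖(X.toLp u : ℤ → ℂ) n‖ₑ := by
  rw [← enorm_exp_smul, exp_smul_ev]

lemma ev_injective : Function.Injective (ev : X δ N → ℤ → ℂ) := by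
  intro u v h
  apply X.toLp.injective
  apply lp.ext
  ext n
  rw [← exp_smul_ev, ← exp_smul_ev, h]

lemma lp_one_norm (u : lp (fun _ : ℤ => ℂ) 1) : ‖u‖ = ∑' n, ‖(u : ℤ → ℂ) n‖ := by
  rw [lp.norm_eq_tsum_rpow (by simp)]; simp

lemma lp_one_summable (u : lp (fun _ : ℤ => ℂ) 1) : Summable fun n => ‖(u : ℤ → ℂ) n‖ := by
  have := lp.memℓp u
  rw [memℓp_gen_iff (by simp)] at this
  simpa using this

lemma lp_one_enorm (u : lp (fun _ : ℤ => ℂ) 1) : ‖u‖ₑ = ∑' n, ‖(u : ℤ → ℂ) n‖ₑ := by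
  rw [← ofReal_norm, lp_one_norm, ENNReal.ofReal_tsum_of_nonneg (fun _ => norm_nonneg _)
    (lp_one_summable u)]
  simp_rw [ofReal_norm]

lemma nB_ev_le (hN : 1 ≤ N) (u : X δ N) : nB δ N (fun n => ‖ev u n‖ₑ) ≤ ‖X.toLp u‖ₑ := by
  have h : ∑' n, wt δ n * ‖ev u n‖ₑ = ‖X.toLp u‖ₑ := by
    rw [lp_one_enorm]; simp_rw [wt_mul_enorm_ev]
  refine nB_le hN (fun n => ?_) ?_
  · rw [← h]; exact ENNReal.le_tsum n
  · rw [h]; exact le_mul_of_one_le_left zero_le (one_le_ofReal hN)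

lemma toLp_enorm_le (hN : 1 ≤ N) (u : X δ N) :
    ‖X.toLp u‖ₑ ≤ ENNReal.ofReal N * nB δ N (fun n => ‖ev u n‖ₑ) := by
  rw [lp_one_enorm]
  simp_rw [← wt_mul_enorm_ev]
  exact tsum_wt_mul_le_nB hN _

lemma nB_ev_ne_top (hN : 1 ≤ N) (u : X δ N) : nB δ N (fun n => ‖ev u n‖ₑ) ≠ ∞ :=
  ne_top_of_le_ne_top enorm_ne_top (nB_ev_le hN u)

lemma nB_enorm_add_le (f g : ℤ → ℂ) : nB δ N (fun n => ‖f n + g n‖ₑ) ≤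
    nB δ N (fun n => ‖f n‖ₑ) + nB δ N (fun n => ‖g n‖ₑ) :=
  (nB_mono fun _ => enorm_add_le _ _).trans (nB_add_le _ _)

lemma X.ext {u v : X δ N} (h : ∀ n, ev u n = ev v n) : u = v := ev_injective (funext h)

lemma update_ev_comp [DecidableEq (Fin k)] (u : Fin k → X δ N) (i : Fin k) (x : X δ N) :
    (fun l => ev (Function.update u i x l)) = Function.update (fun l => ev (u l)) i (ev x) := by
  ext1 l
  by_cases h : l = i
  · subst h; simp
  · simp [h]

instance instNormedAddCommGroupX [hN : Fact (1 ≤ N)] : NormedAddCommGroup (X δ N) :=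
  AddGroupNorm.toNormedAddCommGroup
    { toFun := fun u => (nB δ N (fun n => ‖ev u n‖ₑ)).toReal
      map_zero' := by
        simp [nB]
      add_le' := fun u v => by
        rw [← ENNReal.toReal_add (nB_ev_ne_top hN.out u) (nB_ev_ne_top hN.out v)]
        refine ENNReal.toReal_mono (by simp [nB_ev_ne_top hN.out]) ?_
        rw [map_add]; exact nB_enorm_add_le _ _
      neg' := fun u => by simp
      eq_zero_of_map_eq_zero' := fun u hu => by
        rw [ENNReal.toReal_eq_zero_iff] at hu
        have h := hu.resolve_right (nB_ev_ne_top hN.out u)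
        apply ev_injective
        ext n
        have := wt_mul_le_nB δ N (fun n => ‖ev u n‖ₑ) n
        rw [h, nonpos_iff_eq_zero, mul_eq_zero] at this
        simpa using this.resolve_left (wt_ne_zero δ n) }

variable [hN : Fact (1 ≤ N)]

lemma X.enorm_eq (u : X δ N) : ‖u‖ₑ = nB δ N (fun n => ‖ev u n‖ₑ) := by
  rw [← ofReal_norm]
  exact ENNReal.ofReal_toReal (nB_ev_ne_top hN.out u)

lemma X.norm_le_iff {u : X δ N} {M : ℝ} (hM : 0 ≤ M) :
    ‖u‖ ≤ M ↔ nB δ N (fun n => ‖ev u n‖ₑ) ≤ ENNReal.ofReal M := by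
  rw [← X.enorm_eq, ← ofReal_norm, ENNReal.ofReal_le_ofReal_iff hM]

instance : NormedSpace ℝ (X δ N) where
  norm_smul_le c u := by
    rw [X.norm_le_iff (by positivity), map_smul, ENNReal.ofReal_mul (norm_nonneg _),
      ofReal_norm, ofReal_norm, X.enorm_eq, ← nB_const_mul]
    exact nB_mono fun n => by rw [Pi.smul_apply, enorm_smul]

/-- The identity as a continuous linear equivalence with `ℓ¹`. -/
def X.toLpL : X δ N ≃L[ℝ] lp (fun _ : ℤ => ℂ) 1 :=
  X.toLp.toContinuousLinearEquivOfBounds N 1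
    (fun u => by
      have h := toLp_enorm_le hN.out u
      rw [← X.enorm_eq, ← ofReal_norm, ← ofReal_norm,
        ← ENNReal.ofReal_mul (by linarith [hN.out])] at h
      exact (ENNReal.ofReal_le_ofReal_iff (mul_nonneg (by linarith [hN.out]) (norm_nonneg _))).mp h)
    (fun u => by
      have h := nB_ev_le hN.out (X.toLp.symm u : X δ N)
      rw [← X.enorm_eq, ← ofReal_norm, ← ofReal_norm,
        ENNReal.ofReal_le_ofReal_iff (norm_nonneg _)] at h
      simpa using h)

lemma X.toLpL_apply (u : X δ N) : X.toLpL u = X.toLp u := rfl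

instance : CompleteSpace (X δ N) :=
  (completeSpace_congr (e := (X.toLpL (δ := δ) (N := N)).toEquiv)
    (X.toLpL (δ := δ) (N := N)).isUniformEmbedding).mpr inferInstance

/-- The element of `X δ N` with a given sequence. -/
def mkX (f : ℤ → ℂ) (hf : nB δ N (fun n => ‖f n‖ₑ) ≠ ∞) : X δ N :=
  X.toLp.symm ⟨fun n : ℤ => Real.exp (δ * |(n : ℝ)|) • f n, by
    refine memℓp_gen ?_
    simp only [ENNReal.toReal_one, Real.rpow_one]
    have h : ∑' n : ℤ, ‖Real.exp (δ * |(n : ℝ)|) • f n‖ₑ ≠ ∞ := by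
      simp_rw [enorm_exp_smul]
      exact ne_top_of_le_ne_top (ENNReal.mul_ne_top ENNReal.ofReal_ne_top hf)
        (tsum_wt_mul_le_nB hN.out _)
    exact summable_norm_iff.mpr (Summable.of_enorm h)⟩

@[simp] lemma ev_mkX (f : ℤ → ℂ) (hf : nB δ N (fun n => ‖f n‖ₑ) ≠ ∞) : ev (mkX f hf) = f := by
  ext n
  change Real.exp (-(δ * |(n : ℝ)|)) • Real.exp (δ * |(n : ℝ)|) • f n = f n
  rw [smul_smul, ← Real.exp_add]; simp

/-- The coordinates are continuous. -/
def coord (n : ℤ) : X δ N →L[ℝ] ℂ :=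
  (Real.exp (-(δ * |(n : ℝ)|))) •
    ((lp.evalCLM ℝ (fun _ : ℤ => ℂ) 1 n).comp (X.toLpL (δ := δ) (N := N)).toContinuousLinearMap)

@[simp] lemma coord_apply (n : ℤ) (u : X δ N) : coord n u = ev u n := rfl

/-- The sequence with one nonzero entry. -/
def sg (n : ℤ) : ℂ →L[ℝ] X δ N :=
  (Real.exp (δ * |(n : ℝ)|)) •
    ((X.toLpL (δ := δ) (N := N)).symm.toContinuousLinearMap.comp
      (lp.singleContinuousLinearMap ℝ (fun _ : ℤ => ℂ) 1 n))

@[simp] lemma ev_sg (n : ℤ) (z : ℂ) : ev (sg n z : X δ N) = Pi.single n z := by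
  ext m
  change Real.exp (-(δ * |(m : ℝ)|)) • (Real.exp (δ * |(n : ℝ)|) •
    ((lp.single (E := fun _ : ℤ => ℂ) 1 n z : lp (fun _ : ℤ => ℂ) 1) : ℤ → ℂ) m) = _
  by_cases h : m = n
  · subst h
    rw [smul_smul, ← Real.exp_add]; simp
  · simp [h]

lemma X.hasSum_sg (u : X δ N) : HasSum (fun n => sg n (ev u n)) u := by
  have h := lp.hasSum_single (E := fun _ : ℤ => ℂ) (p := 1) (by simp) (X.toLp u)
  have h2 := h.mapL (X.toLpL (δ := δ) (N := N)).symm.toContinuousLinearMap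
  have e : (X.toLpL (δ := δ) (N := N)).symm.toContinuousLinearMap (X.toLp u) = u :=
    X.toLpL.symm_apply_apply u
  rw [e] at h2
  convert h2 using 2 with n
  apply X.ext
  intro m
  rw [ev_sg]
  change _ = Real.exp (-(δ * |(m : ℝ)|)) •
    ((lp.single (E := fun _ : ℤ => ℂ) 1 n (X.toLp u n) : lp (fun _ : ℤ => ℂ) 1) : ℤ → ℂ) m
  by_cases hm : m = n
  · subst hm; simp [ev]
  · simp [hm]

/-- Changing one coordinate is a translation along `sg n`; coordinate derivatives thereby reduce to
Fréchet derivatives on `X δ N`. -/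
lemma update_ev (u : X δ N) (n : ℤ) (z : ℂ) :
    Function.update (ev u) n z = ev (u + sg n (z - ev u n)) := by
  ext m
  rw [map_add, ev_sg, Pi.add_apply]
  by_cases h : m = n
  · subst h; simp
  · simp [h]

/-! ### Multilinear forms -/

/-- `z` or its conjugate. -/
def cjL (b : Bool) : ℂ →ₗ[ℝ] ℂ := if b then Complex.conjLIE.toLinearEquiv.toLinearMap else LinearMap.id

@[simp] lemma cjL_true (z : ℂ) : cjL true z = conj z := rfl
@[simp] lemma cjL_false (z : ℂ) : cjL false z = z := rfl

@[simp] lemma enorm_cjL (b : Bool) (z : ℂ) : ‖cjL b z‖ₑ = ‖z‖ₑ := by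
  cases b
  · simp
  · simp only [cjL_true, ← ofReal_norm, RCLike.norm_conj]

/-- The monomial `∏ f_i(m_i)`, with conjugates on the slots marked by `cj`. -/
def mono (cj : Fin k → Bool) (m : Fin k → ℤ) : MultilinearMap ℝ (fun _ : Fin k => ℤ → ℂ) ℂ :=
  (MultilinearMap.mkPiAlgebra ℝ (Fin k) ℂ).compLinearMap
    fun i => (cjL (cj i)).comp (LinearMap.proj (m i))

@[simp] lemma mono_apply (cj : Fin k → Bool) (m : Fin k → ℤ) (f : Fin k → ℤ → ℂ) :
    mono cj m f = ∏ i, cjL (cj i) (f i (m i)) := by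
  simp [mono]

/-- The multilinear form with kernel `c`. -/
def form (c : (Fin k → ℤ) → ℂ) (cj : Fin k → Bool) (f : Fin k → ℤ → ℂ) : ℂ :=
  ∑' m, c m * mono cj m f

lemma enorm_mul_mono (c : (Fin k → ℤ) → ℂ) (cj : Fin k → Bool) (f : Fin k → ℤ → ℂ)
    (m : Fin k → ℤ) : ‖c m * mono cj m f‖ₑ = ‖c m‖ₑ * ∏ i, ‖f i (m i)‖ₑ := by
  rw [enorm_mul, mono_apply]
  congr 1
  rw [← ofReal_norm, norm_prod, ENNReal.ofReal_prod_of_nonneg (fun _ _ => norm_nonneg _)]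
  simp [ofReal_norm]

lemma enorm_form_le (c : (Fin k → ℤ) → ℂ) (cj : Fin k → Bool) (f : Fin k → ℤ → ℂ) :
    ‖form c cj f‖ₑ ≤ maj (fun m => ‖c m‖ₑ) (fun i n => ‖f i n‖ₑ) := by
  refine (enorm_tsum_le_tsum_enorm).trans (le_of_eq ?_)
  unfold maj
  simp_rw [enorm_mul_mono]

lemma summable_form {c : (Fin k → ℤ) → ℂ} {cj : Fin k → Bool} {f : Fin k → ℤ → ℂ}
    (h : maj (fun m => ‖c m‖ₑ) (fun i n => ‖f i n‖ₑ) ≠ ∞) :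
    Summable fun m => c m * mono cj m f := by
  refine Summable.of_enorm ?_
  simp_rw [enorm_mul_mono]
  exact h

/-- Boundedness of a multilinear form. -/
def Bdd (δ N : ℝ) (M : ℝ≥0) (c : (Fin k → ℤ) → ℂ) : Prop :=
  ∀ f : Fin k → ℤ → ℝ≥0∞, maj (fun m => ‖c m‖ₑ) f ≤ M * ∏ i, nB δ N (f i)

/-- Only finiteness matters: the constant in `Bdd` is crude and serves summability and continuity,
while the quantitative bounds come from `SlotBound`. -/
lemma Bdd.ne_top {M : ℝ≥0} {c : (Fin k → ℤ) → ℂ} (h : Bdd δ N M c) (u : Fin k → X δ N) :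
    maj (fun m => ‖c m‖ₑ) (fun i n => ‖ev (u i) n‖ₑ) ≠ ∞ := by
  refine ne_top_of_le_ne_top ?_ (h _)
  refine ENNReal.mul_ne_top ENNReal.coe_ne_top (ENNReal.prod_ne_top fun i _ => ?_)
  exact nB_ev_ne_top hN.out _

/-- The multilinear form with kernel `c` on `X δ N`. -/
def formL {M : ℝ≥0} {c : (Fin k → ℤ) → ℂ} (h : Bdd δ N M c) (cj : Fin k → Bool) :
    ContinuousMultilinearMap ℝ (fun _ : Fin k => X δ N) ℂ :=
  MultilinearMap.mkContinuous
    { toFun := fun u => form c cj fun i => ev (u i)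
      map_update_add' := fun u i x y => by
        have h1 := h.ne_top (Function.update u i x)
        have h2 := h.ne_top (Function.update u i y)
        have s1 := summable_form (cj := cj) h1
        have s2 := summable_form (cj := cj) h2
        simp only [update_ev_comp] at s1 s2 ⊢
        unfold form
        rw [← s1.tsum_add s2]
        congr 1; ext m
        rw [map_add, MultilinearMap.map_update_add]; ring
      map_update_smul' := fun u i r x => by
        simp only [update_ev_comp]
        unfold form
        rw [← tsum_const_smul'']
        congr 1; ext m
        rw [map_smul, MultilinearMap.map_update_smul, mul_smul_comm] } M
    (fun u => by
      have h1 := (enorm_form_le c cj fun i => ev (u i)).trans (h _)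
      simp_rw [← X.enorm_eq] at h1
      have h2 : ‖form c cj fun i => ev (u i)‖ₑ ≤ ENNReal.ofReal (M * ∏ i, ‖u i‖) := by
        refine h1.trans (le_of_eq ?_)
        rw [ENNReal.ofReal_mul (by positivity),
          ENNReal.ofReal_prod_of_nonneg (fun _ _ => norm_nonneg _)]
        simp [ofReal_norm]
      rw [← ofReal_norm, ENNReal.ofReal_le_ofReal_iff (by positivity)] at h2
      exact h2)

@[simp] lemma formL_apply {M : ℝ≥0} {c : (Fin k → ℤ) → ℂ} (h : Bdd δ N M c) (cj : Fin k → Bool)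
    (u : Fin k → X δ N) : formL h cj u = form c cj fun i => ev (u i) := rfl

end SequenceSpace

section Differences

variable {δ N : ℝ} {k : ℕ}

/-! ### Differences of multilinear forms -/

/-- Telescoping: the factors are exchanged one at a time, and `G` dominates both families. -/
lemma enorm_prod_sub_prod_le {α : Type*} [DecidableEq α] (s : Finset α) {a b : α → ℂ}
    {G D : α → ℝ≥0∞} (ha : ∀ i, ‖a i‖ₑ ≤ G i) (hb : ∀ i, ‖b i‖ₑ ≤ G i)
    (hD : ∀ i, ‖a i - b i‖ₑ ≤ D i) :
    ‖∏ i ∈ s, a i - ∏ i ∈ s, b i‖ₑ ≤ ∑ j ∈ s, D j * ∏ i ∈ s.erase j, G i := by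
  induction s using Finset.induction_on with
  | empty => simp
  | insert x s hx ih =>
    rw [Finset.prod_insert hx, Finset.prod_insert hx, Finset.sum_insert hx,
      Finset.erase_insert hx]
    have e : a x * ∏ i ∈ s, a i - b x * ∏ i ∈ s, b i
        = (a x - b x) * ∏ i ∈ s, a i + b x * (∏ i ∈ s, a i - ∏ i ∈ s, b i) := by ring
    have hp : ‖∏ i ∈ s, a i‖ₑ ≤ ∏ i ∈ s, G i := by
      rw [← ofReal_norm, norm_prod, ENNReal.ofReal_prod_of_nonneg (fun _ _ => norm_nonneg _)]
      simp_rw [ofReal_norm]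
      exact Finset.prod_le_prod' fun i _ => ha i
    rw [e]
    refine (enorm_add_le _ _).trans (add_le_add ?_ ?_)
    · rw [enorm_mul]; exact mul_le_mul' (hD x) hp
    · rw [enorm_mul]
      calc ‖b x‖ₑ * ‖∏ i ∈ s, a i - ∏ i ∈ s, b i‖ₑ
          ≤ G x * ∑ j ∈ s, D j * ∏ i ∈ s.erase j, G i := mul_le_mul' (hb x) ih
        _ = _ := by
          rw [Finset.mul_sum]
          refine Finset.sum_congr rfl fun j hj => ?_
          have hjx : x ≠ j := fun h => hx (h ▸ hj)
          rw [Finset.erase_insert_of_ne hjx,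
            Finset.prod_insert (fun h => hx (Finset.mem_of_mem_erase h))]
          ring

lemma enorm_form_sub_le {c : (Fin k → ℤ) → ℂ} (cj : Fin k → Bool) {f g : Fin k → ℤ → ℂ}
    {G D : Fin k → ℤ → ℝ≥0∞} (hf : ∀ i n, ‖f i n‖ₑ ≤ G i n) (hg : ∀ i n, ‖g i n‖ₑ ≤ G i n)
    (hD : ∀ i n, ‖f i n - g i n‖ₑ ≤ D i n) (hG : maj (fun m => ‖c m‖ₑ) G ≠ ∞) :
    ‖form c cj f - form c cj g‖ₑ
      ≤ ∑ j, maj (fun m => ‖c m‖ₑ) (Function.update G j (D j)) := by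
  have sf := summable_form (cj := cj)
    (ne_top_of_le_ne_top hG (maj_mono (fun m => le_refl ‖c m‖ₑ) hf))
  have sg := summable_form (cj := cj)
    (ne_top_of_le_ne_top hG (maj_mono (fun m => le_refl ‖c m‖ₑ) hg))
  unfold form
  rw [← sf.tsum_sub sg]
  refine enorm_tsum_le_tsum_enorm.trans ?_
  unfold maj
  rw [← Summable.tsum_finsetSum (fun _ _ => ENNReal.summable)]
  refine ENNReal.tsum_le_tsum fun m => ?_
  rw [← mul_sub, enorm_mul, ← Finset.mul_sum]
  gcongr
  simp_rw [mono_apply, prod_update_apply]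
  refine enorm_prod_sub_prod_le _ (fun i => ?_) (fun i => ?_) (fun i => ?_)
  · rw [enorm_cjL]; exact hf _ _
  · rw [enorm_cjL]; exact hg _ _
  · rw [← map_sub, enorm_cjL]; exact hD _ _

lemma SlotBound.enorm_form_sub_le (hN : 1 ≤ N) {β : ℝ≥0∞} {c : (Fin k → ℤ) → ℂ}
    (h : SlotBound δ N β fun m => ‖c m‖ₑ)
    (cj : Fin k → Bool) {f g : Fin k → ℤ → ℂ}
    {G D : Fin k → ℤ → ℝ≥0∞} (hf : ∀ i n, ‖f i n‖ₑ ≤ G i n) (hg : ∀ i n, ‖g i n‖ₑ ≤ G i n)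
    (hD : ∀ i n, ‖f i n - g i n‖ₑ ≤ D i n) (hG : maj (fun m => ‖c m‖ₑ) G ≠ ∞) :
    ‖form c cj f - form c cj g‖ₑ
      ≤ ∑ j, β * (∏ i ∈ Finset.univ.erase j, nB δ N (G i)) * nD δ N (D j) := by
  refine (QuasiLinear.enorm_form_sub_le cj hf hg hD hG).trans (Finset.sum_le_sum fun j _ => ?_)
  refine (h.maj_le hN j _).trans (le_of_eq ?_)
  rw [Function.update_self]
  congr 2
  refine Finset.prod_congr rfl fun i hi => ?_
  rw [Function.update_of_ne (Finset.ne_of_mem_erase hi)]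

/-! ### Gradients -/

/-- The `n`-th component of the gradient of `L ∘ form c cj` in slot `j`. -/
def gradRaw (L : ℂ →L[ℝ] ℂ) (c : (Fin (k + 1) → ℤ) → ℂ) (cj : Fin (k + 1) → Bool)
    (j : Fin (k + 1)) (f : Fin k → ℤ → ℂ) (n : ℤ) : ℂ :=
  (1 / 2 : ℂ) * (L (form c cj (Fin.insertNth (α := fun _ => ℤ → ℂ) j (Pi.single n 1) f))
    + Complex.I * L (form c cj (Fin.insertNth (α := fun _ => ℤ → ℂ) j (Pi.single n Complex.I) f)))

lemma enorm_half_add_le {a b : ℂ} {M : ℝ≥0∞} (ha : ‖a‖ₑ ≤ M) (hb : ‖b‖ₑ ≤ M) :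
    ‖(1 / 2 : ℂ) * (a + Complex.I * b)‖ₑ ≤ M := by
  by_cases hM : M = ∞
  · rw [hM]; exact le_top
  lift M to ℝ≥0 using hM
  rw [← ofReal_norm, ← ENNReal.ofReal_coe_nnreal, ENNReal.ofReal_le_ofReal_iff M.coe_nonneg]
    at ha hb ⊢
  have h : ‖a + Complex.I * b‖ ≤ ‖a‖ + ‖b‖ := (norm_add_le _ _).trans (by simp)
  rw [norm_mul]
  norm_num
  linarith

lemma enorm_clm_le (L : ℂ →L[ℝ] ℂ) (z : ℂ) : ‖L z‖ₑ ≤ ‖L‖ₑ * ‖z‖ₑ := L.le_opENorm z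

lemma enorm_single {z : ℂ} (hz : ‖z‖ₑ = 1) (n m : ℤ) :
    ‖(Pi.single n z : ℤ → ℂ) m‖ₑ = (Pi.single n 1 : ℤ → ℝ≥0∞) m := by
  by_cases h : m = n
  · subst h; simp [hz]
  · simp [h]

/-- Functions on `Fin (k+1)` from functions on `Fin k`, with a dummy value at `j`. -/
def ins (j : Fin (k + 1)) (h : ℤ → ℝ≥0∞) (F : Fin k → ℤ → ℝ≥0∞) : Fin (k + 1) → ℤ → ℝ≥0∞ :=
  Fin.insertNth (α := fun _ => ℤ → ℝ≥0∞) j h F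

@[simp] lemma ins_same (j : Fin (k + 1)) (h : ℤ → ℝ≥0∞) (F : Fin k → ℤ → ℝ≥0∞) :
    ins j h F j = h := by simp [ins]

@[simp] lemma ins_succAbove (j : Fin (k + 1)) (h : ℤ → ℝ≥0∞) (F : Fin k → ℤ → ℝ≥0∞) (i : Fin k) :
    ins j h F (j.succAbove i) = F i := by simp [ins]

lemma update_ins (j : Fin (k + 1)) (h h' : ℤ → ℝ≥0∞) (F : Fin k → ℤ → ℝ≥0∞) :
    Function.update (ins j h F) j h' = ins j h' F := by
  simp [ins]

lemma update_ins_succAbove (j : Fin (k + 1)) (h : ℤ → ℝ≥0∞) (F : Fin k → ℤ → ℝ≥0∞) (i : Fin k)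
    (g : ℤ → ℝ≥0∞) :
    Function.update (ins j h F) (j.succAbove i) g = ins j h (Function.update F i g) := by
  simp [ins]

lemma prod_erase_succAbove {M : Type*} [CommMonoid M] (j : Fin (k + 1)) (F : Fin (k + 1) → M) :
    ∏ i ∈ Finset.univ.erase j, F i = ∏ i : Fin k, F (j.succAbove i) := by
  have : (Finset.univ.erase j) = Finset.univ.map (Fin.succAboveEmb j) := by
    ext i; simp only [Finset.mem_erase, Finset.mem_univ, and_true, Finset.mem_map, true_and,
      Fin.coe_succAboveEmb]
    exact Fin.exists_succAbove_eq_iff.symm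
  rw [this, Finset.prod_map]; rfl

lemma enorm_insertNth_le {z : ℂ} (hz : ‖z‖ₑ = 1) (n : ℤ) (j : Fin (k + 1)) {f : Fin k → ℤ → ℂ}
    {F : Fin k → ℤ → ℝ≥0∞} (hF : ∀ i m, ‖f i m‖ₑ ≤ F i m) (i : Fin (k + 1)) (m : ℤ) :
    ‖(Fin.insertNth (α := fun _ => ℤ → ℂ) j (Pi.single n z) f : Fin (k + 1) → ℤ → ℂ) i m‖ₑ
      ≤ ins j (Pi.single n 1) F i m := by
  rcases Fin.eq_self_or_eq_succAbove j i with rfl | ⟨l, rfl⟩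
  · simp [enorm_single hz]
  · simpa using hF l m

lemma enorm_gradRaw_le (L : ℂ →L[ℝ] ℂ) (c : (Fin (k + 1) → ℤ) → ℂ) (cj : Fin (k + 1) → Bool)
    (j : Fin (k + 1)) (f : Fin k → ℤ → ℂ) (n : ℤ) :
    ‖gradRaw L c cj j f n‖ₑ ≤ ‖L‖ₑ *
      maj (fun m => ‖c m‖ₑ) (ins j (Pi.single n 1) fun i m => ‖f i m‖ₑ) := by
  refine enorm_half_add_le ((enorm_clm_le L _).trans ?_) ((enorm_clm_le L _).trans ?_)
  · gcongr
    exact (enorm_form_le _ _ _).trans (maj_mono (fun _ => le_rfl)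
      (enorm_insertNth_le (by simp) n j fun _ _ => le_rfl))
  · gcongr
    exact (enorm_form_le _ _ _).trans (maj_mono (fun _ => le_rfl)
      (enorm_insertNth_le (by simp [← ofReal_norm]) n j fun _ _ => le_rfl))

lemma SlotBound.nB_ins_le {β : ℝ≥0∞} {K : (Fin (k + 1) → ℤ) → ℝ≥0∞} (h : SlotBound δ N β K)
    (j : Fin (k + 1)) (F : Fin k → ℤ → ℝ≥0∞) :
    nB δ N (fun n => maj K (ins j (Pi.single n 1) F)) ≤ β * ∏ i, nB δ N (F i) := by
  have := h j (ins j 0 F)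
  simp_rw [update_ins, prod_erase_succAbove, ins_succAbove] at this
  exact this

lemma SlotBound.nB_gradRaw_le {β : ℝ≥0∞} {c : (Fin (k + 1) → ℤ) → ℂ}
    (h : SlotBound δ N β fun m => ‖c m‖ₑ) (L : ℂ →L[ℝ] ℂ) (cj : Fin (k + 1) → Bool)
    (j : Fin (k + 1)) (f : Fin k → ℤ → ℂ) :
    nB δ N (fun n => ‖gradRaw L c cj j f n‖ₑ)
      ≤ ‖L‖ₑ * (β * ∏ i, nB δ N (fun n => ‖f i n‖ₑ)) := by
  refine (nB_mono fun n => enorm_gradRaw_le L c cj j f n).trans ?_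
  rw [nB_const_mul]
  gcongr
  exact h.nB_ins_le j _

variable [hN : Fact (1 ≤ N)]

lemma insertNth_ev (j : Fin (k + 1)) (n : ℤ) (z : ℂ) (u : Fin k → X δ N) :
    (Fin.insertNth (α := fun _ => ℤ → ℂ) j (Pi.single n z) fun i => ev (u i))
      = fun i => ev (Fin.insertNth (α := fun _ => X δ N) j (sg n z) u i) := by
  ext1 i
  rcases Fin.eq_self_or_eq_succAbove j i with rfl | ⟨l, rfl⟩ <;> simp

lemma gradRaw_ev {M : ℝ≥0} {c : (Fin (k + 1) → ℤ) → ℂ} (h : Bdd δ N M c) (L : ℂ →L[ℝ] ℂ)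
    (cj : Fin (k + 1) → Bool) (j : Fin (k + 1)) (u : Fin k → X δ N) (n : ℤ) :
    gradRaw L c cj j (fun i => ev (u i)) n = (1 / 2 : ℂ) *
      (L (formL h cj (Fin.insertNth (α := fun _ => X δ N) j (sg n 1) u))
      + Complex.I * L (formL h cj (Fin.insertNth (α := fun _ => X δ N) j (sg n Complex.I) u))) := by
  simp only [gradRaw, insertNth_ev, formL_apply]

/-- The gradient of `L ∘ form c cj` in slot `j` as a multilinear map into `X δ N`. -/
def gradL {M β : ℝ≥0} {c : (Fin (k + 1) → ℤ) → ℂ} (hM : Bdd δ N M c)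
    (h : SlotBound δ N β fun m => ‖c m‖ₑ) (L : ℂ →L[ℝ] ℂ) (cj : Fin (k + 1) → Bool)
    (j : Fin (k + 1)) : ContinuousMultilinearMap ℝ (fun _ : Fin k => X δ N) (X δ N) :=
  MultilinearMap.mkContinuous
    { toFun := fun u => mkX (gradRaw L c cj j fun i => ev (u i))
        (ne_top_of_le_ne_top (ENNReal.mul_ne_top enorm_ne_top (ENNReal.mul_ne_top
          ENNReal.coe_ne_top (ENNReal.prod_ne_top fun i _ => nB_ev_ne_top hN.out _)))
          (h.nB_gradRaw_le L cj j _))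
      map_update_add' := fun {inst} u i x y => by
        obtain rfl := Subsingleton.elim inst (instDecidableEqFin k)
        apply X.ext; intro n
        simp only [ev_mkX, map_add, Pi.add_apply]
        simp only [gradRaw_ev hM, Fin.insertNth_update, ContinuousMultilinearMap.map_update_add,
          map_add]
        ring
      map_update_smul' := fun {inst} u i r x => by
        obtain rfl := Subsingleton.elim inst (instDecidableEqFin k)
        apply X.ext; intro n
        simp only [ev_mkX, map_smul, Pi.smul_apply]
        simp only [gradRaw_ev hM, Fin.insertNth_update, ContinuousMultilinearMap.map_update_smul,
          map_smul]
        simp only [Complex.real_smul]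
        ring } (‖L‖ * β)
    (fun u => by
      rw [X.norm_le_iff (by positivity)]
      have := h.nB_gradRaw_le L cj j (fun i => ev (u i))
      simp only [MultilinearMap.coe_mk, ev_mkX]
      refine this.trans (le_of_eq ?_)
      simp_rw [← X.enorm_eq]
      rw [ENNReal.ofReal_mul (by positivity), ENNReal.ofReal_mul (by positivity),
          ENNReal.ofReal_prod_of_nonneg (fun _ _ => norm_nonneg _)]
      simp [mul_assoc])

@[simp] lemma ev_gradL {M β : ℝ≥0} {c : (Fin (k + 1) → ℤ) → ℂ} (hM : Bdd δ N M c)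
    (h : SlotBound δ N β fun m => ‖c m‖ₑ) (L : ℂ →L[ℝ] ℂ) (cj : Fin (k + 1) → Bool)
    (j : Fin (k + 1)) (u : Fin k → X δ N) :
    ev (gradL hM h L cj j u) = gradRaw L c cj j fun i => ev (u i) := by
  simp [gradL]

/-- The gradient of `f ↦ L (form c cj (f, …, f))` with respect to the conjugate variables. -/
def fieldRaw (L : ℂ →L[ℝ] ℂ) (c : (Fin (k + 1) → ℤ) → ℂ) (cj : Fin (k + 1) → Bool)
    (f : ℤ → ℂ) (n : ℤ) : ℂ :=
  ∑ j, gradRaw L c cj j (fun _ => f) n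

/-- The multilinear map whose diagonal is `fieldRaw`. -/
def fieldL {M β : ℝ≥0} {c : (Fin (k + 1) → ℤ) → ℂ} (hM : Bdd δ N M c)
    (h : SlotBound δ N β fun m => ‖c m‖ₑ) (L : ℂ →L[ℝ] ℂ) (cj : Fin (k + 1) → Bool) :
    ContinuousMultilinearMap ℝ (fun _ : Fin k => X δ N) (X δ N) :=
  ∑ j, gradL hM h L cj j

lemma ev_fieldL {M β : ℝ≥0} {c : (Fin (k + 1) → ℤ) → ℂ} (hM : Bdd δ N M c)
    (h : SlotBound δ N β fun m => ‖c m‖ₑ) (L : ℂ →L[ℝ] ℂ) (cj : Fin (k + 1) → Bool)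
    (u : X δ N) : ev (fieldL hM h L cj fun _ => u) = fieldRaw L c cj (ev u) := by
  ext n
  simp only [fieldL, _root_.sum_apply, map_sum, Finset.sum_apply, ev_gradL,
    fieldRaw]

lemma norm_gradL_le {M β : ℝ≥0} {c : (Fin (k + 1) → ℤ) → ℂ} (hM : Bdd δ N M c)
    (h : SlotBound δ N β fun m => ‖c m‖ₑ) (L : ℂ →L[ℝ] ℂ) (cj : Fin (k + 1) → Bool)
    (j : Fin (k + 1)) : ‖gradL hM h L cj j‖ ≤ ‖L‖ * β :=
  MultilinearMap.mkContinuous_norm_le _ (by positivity) _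

lemma norm_fieldL_le {M β : ℝ≥0} {c : (Fin (k + 1) → ℤ) → ℂ} (hM : Bdd δ N M c)
    (h : SlotBound δ N β fun m => ‖c m‖ₑ) (L : ℂ →L[ℝ] ℂ) (cj : Fin (k + 1) → Bool) :
    ‖fieldL hM h L cj‖ ≤ (k + 1) * (‖L‖ * β) := by
  refine (norm_sum_le _ _).trans ((Finset.sum_le_sum fun j _ => norm_gradL_le hM h L cj j).trans ?_)
  simp

lemma hasFDerivAt_diag {E F : Type*} [NormedAddCommGroup E] [NormedSpace ℝ E]
    [NormedAddCommGroup F] [NormedSpace ℝ F]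
    (T : ContinuousMultilinearMap ℝ (fun _ : Fin k => E) F) (u : E) :
    HasFDerivAt (fun u => T fun _ => u)
      ((T.linearDeriv fun _ => u).comp (ContinuousLinearMap.pi fun _ => ContinuousLinearMap.id ℝ E))
      u :=
  (T.hasFDerivAt (fun _ => u)).comp u
    (ContinuousLinearMap.pi fun _ => ContinuousLinearMap.id ℝ E).hasFDerivAt

lemma linearDeriv_diag_apply {E F : Type*} [NormedAddCommGroup E] [NormedSpace ℝ E]
    [NormedAddCommGroup F] [NormedSpace ℝ F]
    (T : ContinuousMultilinearMap ℝ (fun _ : Fin k => E) F) (u h : E) :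
    ((T.linearDeriv fun _ => u).comp
      (ContinuousLinearMap.pi fun _ => ContinuousLinearMap.id ℝ E)) h
      = ∑ j, T (Function.update (fun _ => u) j h) := by
  simp [ContinuousMultilinearMap.linearDeriv_apply]

lemma insertNth_const {α : Type*} (j : Fin (k + 1)) (x u : α) :
    Fin.insertNth (α := fun _ => α) j x (fun _ => u) = Function.update (fun _ => u) j x := by
  ext i
  rcases Fin.eq_self_or_eq_succAbove j i with rfl | ⟨l, rfl⟩ <;> simp

lemma hasFDerivAt_comp_update {F : Type*} [NormedAddCommGroup F] [NormedSpace ℝ F]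
    {A : X δ N → F} {u : X δ N} {A' : X δ N →L[ℝ] F} (h : HasFDerivAt A A' u) (n : ℤ) :
    HasFDerivAt (fun z : ℂ => A (u + sg n (z - ev u n))) (A'.comp (sg n)) (ev u n) := by
  have h1 : HasFDerivAt (fun z : ℂ => u + sg n (z - ev u n)) (sg n : ℂ →L[ℝ] X δ N) (ev u n) := by
    simp_rw [map_sub]
    exact ((sg n : ℂ →L[ℝ] X δ N).hasFDerivAt.sub_const _).const_add u
  have h2 : HasFDerivAt A A' (u + sg n (ev u n - ev u n)) := by simpa using h
  exact h2.comp (ev u n) h1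

/-- The derivative of the diagonal of a multilinear map is the sum over slots, and `gradRaw` is the
Wirtinger combination of the directions 1 and i in one slot. -/
lemma dbar_form {M : ℝ≥0} {c : (Fin (k + 1) → ℤ) → ℂ} (hM : Bdd δ N M c)
    (L : ℂ →L[ℝ] ℂ) (cj : Fin (k + 1) → Bool) (u : X δ N) (n : ℤ) :
    dbar (fun f => L (form c cj fun _ => f)) (ev u) n = fieldRaw L c cj (ev u) n := by
  have h1 := hasFDerivAt_comp_update (L.hasFDerivAt.comp u (hasFDerivAt_diag (formL hM cj) u)) n
  have e : (fun z : ℂ => L (form c cj fun _ => Function.update (ev u) n z)) =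
      fun z : ℂ => (⇑L ∘ fun u => formL hM cj fun _ => u) (u + sg n (z - ev u n)) := by
    ext z; simp only [update_ev, Function.comp, formL_apply]
  unfold dbar
  rw [e, h1.fderiv]
  simp only [ContinuousLinearMap.comp_apply, fieldRaw, gradRaw_ev hM, insertNth_const]
  have key := fun h => linearDeriv_diag_apply (formL hM cj) u h
  simp only [ContinuousLinearMap.comp_apply] at key
  rw [key, key, map_sum, map_sum, ← Finset.mul_sum, Finset.sum_add_distrib,
    Finset.mul_sum (a := Complex.I)]

end Differences

section DualEstimates

variable {δ N : ℝ} {k : ℕ}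

/-! ### Lipschitz estimates in the dual norm -/

lemma nB_add_le_two_mul {f g : ℤ → ℂ} {r : ℝ≥0∞} (hf : nB δ N (fun n => ‖f n‖ₑ) ≤ r)
    (hg : nB δ N (fun n => ‖g n‖ₑ) ≤ r) : nB δ N (fun n => ‖f n‖ₑ + ‖g n‖ₑ) ≤ 2 * r :=
  (nB_add_le _ _).trans ((add_le_add hf hg).trans (two_mul r).ge)

lemma maj_update_zero {K : (Fin k → ℤ) → ℝ≥0∞} (F : Fin k → ℤ → ℝ≥0∞) (j : Fin k) :
    maj K (Function.update F j 0) = 0 := by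
  unfold maj
  simp_rw [prod_update_apply]
  simp

lemma prod_erase_eq_update {M α : Type*} [CommMonoid M] [Fintype α] [DecidableEq α] (g : α → M)
    (s : α) : ∏ i ∈ Finset.univ.erase s, g i = ∏ i, Function.update g s 1 i := by
  rw [Finset.prod_update_of_mem (Finset.mem_univ s), one_mul, Finset.sdiff_singleton_eq_erase]

/-- The slot bound is applied in a slot other than `j`: the test sequence `g` in slot `j` is
measured in `nB`, and the difference sits in slot `l`, measured in `nD`. -/
lemma SlotBound.maj_ins_le (hN : 1 ≤ N) {β : ℝ≥0∞} {K : (Fin (k + 1) → ℤ) → ℝ≥0∞}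
    (h : SlotBound δ N β K) (j : Fin (k + 1)) (g : ℤ → ℝ≥0∞) (F : Fin k → ℤ → ℝ≥0∞) (l : Fin k) :
    maj K (ins j g F)
      ≤ β * (nB δ N g * ∏ i ∈ Finset.univ.erase l, nB δ N (F i)) * nD δ N (F l) := by
  refine (h.maj_le hN (j.succAbove l) _).trans (le_of_eq ?_)
  rw [ins_succAbove, prod_erase_eq_update, Fin.prod_univ_succAbove _ j, prod_erase_eq_update]
  congr 3
  · rw [Function.update_of_ne (Fin.succAbove_ne j l).symm, ins_same]
  · refine Finset.prod_congr rfl fun i _ => ?_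
    by_cases hi : i = l
    · subst hi; simp
    · rw [Function.update_of_ne hi, Function.update_of_ne
        (fun e => hi (Fin.succAbove_right_injective e)), ins_succAbove]

lemma Bdd.maj_ne_top {M : ℝ≥0} {c : (Fin k → ℤ) → ℂ} (hM : Bdd δ N M c)
    {F : Fin k → ℤ → ℝ≥0∞} (hF : ∀ i, nB δ N (F i) ≠ ∞) : maj (fun m => ‖c m‖ₑ) F ≠ ∞ :=
  ne_top_of_le_ne_top (ENNReal.mul_ne_top ENNReal.coe_ne_top
    (ENNReal.prod_ne_top fun i _ => hF i)) (hM F)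

/-- A polynomial with bounded gradient is Lipschitz for the dual norm. -/
lemma SlotBound.form_diag_sub_le (hN : 1 ≤ N) {β : ℝ≥0∞} {M : ℝ≥0} {c : (Fin (k + 1) → ℤ) → ℂ}
    (h : SlotBound δ N β fun m => ‖c m‖ₑ) (hM : Bdd δ N M c) (cj : Fin (k + 1) → Bool)
    {f g : ℤ → ℂ} {r : ℝ≥0∞} (hr : r ≠ ∞) (hf : nB δ N (fun n => ‖f n‖ₑ) ≤ r)
    (hg : nB δ N (fun n => ‖g n‖ₑ) ≤ r) :
    ‖form c cj (fun _ => f) - form c cj (fun _ => g)‖ₑ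
      ≤ (k + 1) * (β * (2 * r) ^ k) * nD δ N (fun n => ‖f n - g n‖ₑ) := by
  have hG := nB_add_le_two_mul hf hg
  have h1 := h.enorm_form_sub_le hN cj (f := fun _ => f) (g := fun _ => g)
    (G := fun _ n => ‖f n‖ₑ + ‖g n‖ₑ) (D := fun _ n => ‖f n - g n‖ₑ)
    (fun _ _ => le_self_add) (fun _ _ => le_add_self) (fun _ _ => le_rfl)
    (hM.maj_ne_top fun _ => ne_top_of_le_ne_top (ENNReal.mul_ne_top (by simp) hr) hG)
  refine h1.trans ?_
  simp only [Finset.prod_const, Finset.card_erase_of_mem (Finset.mem_univ _), Finset.card_univ,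
    Fintype.card_fin, add_tsub_cancel_right, Finset.sum_const, nsmul_eq_mul]
  push_cast
  calc _ ≤ ((k : ℝ≥0∞) + 1) * (β * (2 * r) ^ k * nD δ N (fun n => ‖f n - g n‖ₑ)) := by gcongr
    _ = _ := by ring

/-- The derivative of the form in the direction `v`. -/
def brk (c : (Fin k → ℤ) → ℂ) (cj : Fin k → Bool) (f v : ℤ → ℂ) : ℂ :=
  ∑ j, form c cj (Function.update (fun _ => f) j v)

/-- Here θ stands for a Lipschitz constant of a vector field: `v` and `w` have size θr and differ by
θ times the dual distance of `f` and `g`. In each of the (k + 1)² terms the direction occupies one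
slot and the difference sits in one slot, equal or not; either way exactly one factor θ appears. -/
lemma SlotBound.brk_sub_le (hN : 1 ≤ N) {β : ℝ≥0∞} {M : ℝ≥0} {c : (Fin (k + 1) → ℤ) → ℂ}
    (h : SlotBound δ N β fun m => ‖c m‖ₑ) (hM : Bdd δ N M c) (cj : Fin (k + 1) → Bool)
    {f g v w : ℤ → ℂ} {r θ : ℝ≥0∞} (hr : r ≠ ∞) (hθ : θ ≠ ∞)
    (hf : nB δ N (fun n => ‖f n‖ₑ) ≤ r) (hg : nB δ N (fun n => ‖g n‖ₑ) ≤ r)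
    (hv : nB δ N (fun n => ‖v n‖ₑ) ≤ θ * r) (hw : nB δ N (fun n => ‖w n‖ₑ) ≤ θ * r)
    (hvw : nD δ N (fun n => ‖v n - w n‖ₑ) ≤ θ * nD δ N (fun n => ‖f n - g n‖ₑ)) :
    ‖brk c cj f v - brk c cj g w‖ₑ
      ≤ (k + 1) * ((k + 1) * (β * (θ * (2 * r) ^ k))) * nD δ N (fun n => ‖f n - g n‖ₑ) := by
  have hG := nB_add_le_two_mul hf hg
  have hH := nB_add_le_two_mul hv hw
  have hG' : nB δ N (fun n => ‖f n‖ₑ + ‖g n‖ₑ) ≠ ∞ :=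
    ne_top_of_le_ne_top (ENNReal.mul_ne_top (by simp) hr) hG
  have hH' : nB δ N (fun n => ‖v n‖ₑ + ‖w n‖ₑ) ≠ ∞ :=
    ne_top_of_le_ne_top (ENNReal.mul_ne_top (by simp) (ENNReal.mul_ne_top hθ hr)) hH
  unfold brk
  rw [← Finset.sum_sub_distrib]
  refine (enorm_sum_le _ _).trans ?_
  have key : ∀ j : Fin (k + 1), ‖form c cj (Function.update (fun _ => f) j v)
      - form c cj (Function.update (fun _ => g) j w)‖ₑ
      ≤ (k + 1) * (β * (θ * (2 * r) ^ k)) * nD δ N (fun n => ‖f n - g n‖ₑ) := by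
    intro j
    have h1 := h.enorm_form_sub_le hN cj (f := Function.update (fun _ => f) j v)
      (g := Function.update (fun _ => g) j w)
      (G := Function.update (fun _ n => ‖f n‖ₑ + ‖g n‖ₑ) j fun n => ‖v n‖ₑ + ‖w n‖ₑ)
      (D := Function.update (fun _ n => ‖f n - g n‖ₑ) j fun n => ‖v n - w n‖ₑ)
      (fun i _ => by
        by_cases hi : i = j
        · subst hi; simp
        · simp [hi])
      (fun i _ => by
        by_cases hi : i = j
        · subst hi; simp
        · simp [hi])
      (fun i _ => by
        by_cases hi : i = j
        · subst hi; simp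
        · simp [hi])
      (hM.maj_ne_top fun i => by
        by_cases hi : i = j
        · subst hi; simpa using hH'
        · simpa [hi] using hG')
    refine h1.trans ?_
    refine (Finset.sum_le_card_nsmul _ _
      ((β * (θ * (2 * r) ^ k)) * nD δ N (fun n => ‖f n - g n‖ₑ)) fun i _ => ?_).trans
      (le_of_eq (by simp [mul_assoc]))
    by_cases hi : i = j
    · subst hi
      rw [Function.update_self, Finset.prod_congr rfl (g := fun _ =>
        nB δ N (fun n => ‖f n‖ₑ + ‖g n‖ₑ)) (fun l hl => by
          rw [Function.update_of_ne (Finset.ne_of_mem_erase hl)])]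
      simp only [Finset.prod_const, Finset.card_erase_of_mem (Finset.mem_univ _),
        Finset.card_univ, Fintype.card_fin, add_tsub_cancel_right]
      calc _ ≤ β * (2 * r) ^ k * (θ * nD δ N (fun n => ‖f n - g n‖ₑ)) := by gcongr
        _ = _ := by ring
    · rw [Function.update_of_ne hi]
      have hle : ∏ l ∈ Finset.univ.erase i, nB δ N (Function.update
          (fun _ n => ‖f n‖ₑ + ‖g n‖ₑ) j (fun n => ‖v n‖ₑ + ‖w n‖ₑ) l) ≤ θ * (2 * r) ^ k := by
        have hji : j ∈ Finset.univ.erase i := Finset.mem_erase.mpr ⟨Ne.symm hi, Finset.mem_univ _⟩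
        rw [← Finset.mul_prod_erase _ _ hji, Function.update_self,
          Finset.prod_congr rfl (g := fun _ => nB δ N (fun n => ‖f n‖ₑ + ‖g n‖ₑ)) (fun l hl => by
          rw [Function.update_of_ne (Finset.ne_of_mem_erase hl)])]
        simp only [Finset.prod_const, Finset.card_erase_of_mem hji,
          Finset.card_erase_of_mem (Finset.mem_univ _), Finset.card_univ, Fintype.card_fin,
          add_tsub_cancel_right]
        -- Two distinct slots exist, so k ≥ 1 and the factor 2r from the direction completes
        -- (2r)^{k-1} to (2r)^k.
        have hk : k ≠ 0 := by
          rintro rfl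
          exact hi (Subsingleton.elim (α := Fin 1) i j)
        calc _ ≤ (2 * (θ * r)) * (2 * r) ^ (k - 1) := by gcongr
          _ = θ * ((2 * r) ^ (k - 1) * (2 * r)) := by ring
          _ = _ := by rw [← pow_succ, Nat.sub_add_cancel (Nat.pos_of_ne_zero hk)]
      gcongr
  refine (Finset.sum_le_card_nsmul _ _ _ fun j _ => key j).trans (le_of_eq ?_)
  simp [mul_assoc]

lemma SlotBound.nB_fieldRaw_le {β : ℝ≥0∞} {c : (Fin (k + 1) → ℤ) → ℂ}
    (h : SlotBound δ N β fun m => ‖c m‖ₑ) (L : ℂ →L[ℝ] ℂ) (cj : Fin (k + 1) → Bool)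
    {f : ℤ → ℂ} {r : ℝ≥0∞} (hf : nB δ N (fun n => ‖f n‖ₑ) ≤ r) :
    nB δ N (fun n => ‖fieldRaw L c cj f n‖ₑ) ≤ (k + 1) * (‖L‖ₑ * (β * r ^ k)) := by
  have h1 : nB δ N (fun n => ‖fieldRaw L c cj f n‖ₑ) ≤
      ∑ j, nB δ N (fun n => ‖gradRaw L c cj j (fun _ => f) n‖ₑ) :=
    (nB_mono fun n => enorm_sum_le _ _).trans (nB_sum_le _ _)
  refine h1.trans ((Finset.sum_le_card_nsmul _ _ (‖L‖ₑ * (β * r ^ k)) fun j _ => ?_).trans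
    (le_of_eq (by simp)))
  refine (h.nB_gradRaw_le L cj j _).trans ?_
  simp only [Finset.prod_const, Finset.card_univ, Fintype.card_fin]
  gcongr

/-- A vector field whose Hamiltonian has bounded gradient is Lipschitz for the dual norm. -/
lemma SlotBound.nD_fieldRaw_sub_le (hN : 1 ≤ N) {β : ℝ≥0∞} {M : ℝ≥0} {c : (Fin (k + 1) → ℤ) → ℂ}
    (h : SlotBound δ N β fun m => ‖c m‖ₑ) (hM : Bdd δ N M c) (L : ℂ →L[ℝ] ℂ)
    (cj : Fin (k + 1) → Bool)
    {f g : ℤ → ℂ} {r : ℝ≥0∞} (hr : r ≠ ∞) (hf : nB δ N (fun n => ‖f n‖ₑ) ≤ r)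
    (hg : nB δ N (fun n => ‖g n‖ₑ) ≤ r) :
    nD δ N (fun n => ‖fieldRaw L c cj f n - fieldRaw L c cj g n‖ₑ)
      ≤ (k + 1) * (‖L‖ₑ * (k * (β * (2 * r) ^ (k - 1)))) * nD δ N (fun n => ‖f n - g n‖ₑ) := by
  set G : ℤ → ℝ≥0∞ := fun n => ‖f n‖ₑ + ‖g n‖ₑ
  set D : ℤ → ℝ≥0∞ := fun n => ‖f n - g n‖ₑ
  set K : (Fin (k + 1) → ℤ) → ℝ≥0∞ := fun m => ‖c m‖ₑ
  have hG : nB δ N G ≤ 2 * r := nB_add_le_two_mul hf hg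
  have hG' : nB δ N G ≠ ∞ := ne_top_of_le_ne_top (ENNReal.mul_ne_top (by simp) hr) hG
  have hform : ∀ (j : Fin (k + 1)) (n : ℤ) (z : ℂ), ‖z‖ₑ = 1 →
      ‖form c cj (Fin.insertNth (α := fun _ => ℤ → ℂ) j (Pi.single n z) fun _ => f)
        - form c cj (Fin.insertNth (α := fun _ => ℤ → ℂ) j (Pi.single n z) fun _ => g)‖ₑ
      ≤ ∑ l : Fin k, maj K (ins j (Pi.single n 1) (Function.update (fun _ => G) l D)) := by
    intro j n z hz
    refine (QuasiLinear.enorm_form_sub_le cj (G := ins j (Pi.single n 1) fun _ => G)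
      (D := ins j 0 fun _ => D)
      (enorm_insertNth_le hz n j fun _ _ => le_self_add)
      (enorm_insertNth_le hz n j fun _ _ => le_add_self) ?_ ?_).trans ?_
    · intro i m
      rcases Fin.eq_self_or_eq_succAbove j i with rfl | ⟨l, rfl⟩
      · simp
      · simp [D]
    · refine hM.maj_ne_top fun i => ?_
      rcases Fin.eq_self_or_eq_succAbove j i with rfl | ⟨l, rfl⟩
      · rw [ins_same]
        refine ne_top_of_le_ne_top ?_ (nB_single_le hN n 1)
        simpa using wt_ne_top δ n
      · simpa using hG'
    -- Slot `j` holds the same unit vector on both sides, so its difference is 0 and its term drops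
    -- out.
    · rw [Fin.sum_univ_succAbove _ j, ins_same, maj_update_zero, zero_add]
      simp_rw [ins_succAbove, update_ins_succAbove]
      exact le_rfl
  have hgrad : ∀ (j : Fin (k + 1)) (n : ℤ),
      ‖gradRaw L c cj j (fun _ => f) n - gradRaw L c cj j (fun _ => g) n‖ₑ
      ≤ ‖L‖ₑ * ∑ l : Fin k, maj K (ins j (Pi.single n 1) (Function.update (fun _ => G) l D)) := by
    intro j n
    unfold gradRaw
    rw [← mul_sub, add_sub_add_comm, ← mul_sub, ← map_sub, ← map_sub]
    refine enorm_half_add_le ((enorm_clm_le L _).trans ?_) ((enorm_clm_le L _).trans ?_)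
    · gcongr; exact hform j n 1 (by simp)
    · gcongr; exact hform j n Complex.I (by simp [← ofReal_norm])
  refine nD_le fun a ha => ?_
  calc ∑' n, a n * ‖fieldRaw L c cj f n - fieldRaw L c cj g n‖ₑ
      ≤ ∑' n, a n * ∑ j, (‖L‖ₑ *
        ∑ l : Fin k, maj K (ins j (Pi.single n 1) (Function.update (fun _ => G) l D))) := by
        refine ENNReal.tsum_le_tsum fun n => ?_
        gcongr
        unfold fieldRaw
        rw [← Finset.sum_sub_distrib]
        exact (enorm_sum_le _ _).trans (Finset.sum_le_sum fun j _ => hgrad j n)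
    _ = ∑ j, ‖L‖ₑ * ∑ l : Fin k, maj K (ins j a (Function.update (fun _ => G) l D)) := by
        simp_rw [Finset.mul_sum]
        rw [Summable.tsum_finsetSum (fun _ _ => ENNReal.summable)]
        refine Finset.sum_congr rfl fun j _ => ?_
        rw [Summable.tsum_finsetSum (fun _ _ => ENNReal.summable)]
        refine Finset.sum_congr rfl fun l _ => ?_
        simp_rw [mul_left_comm _ ‖L‖ₑ]
        rw [ENNReal.tsum_mul_left]
        congr 1
        have := tsum_mul_maj_update K (ins j 0 (Function.update (fun _ => G) l D)) j a
        simp_rw [update_ins] at this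
        exact this
    _ ≤ ∑ _j : Fin (k + 1), ‖L‖ₑ * ∑ _l : Fin k, β * (2 * r) ^ (k - 1) * nD δ N D := by
        refine Finset.sum_le_sum fun j _ => ?_
        gcongr with l
        refine (h.maj_ins_le hN j a _ l).trans ?_
        rw [Function.update_self, Finset.prod_congr rfl (g := fun _ => nB δ N G) (fun i hi => by
          rw [Function.update_of_ne (Finset.ne_of_mem_erase hi)])]
        simp only [Finset.prod_const, Finset.card_erase_of_mem (Finset.mem_univ _),
          Finset.card_univ, Fintype.card_fin]
        calc _ ≤ β * (1 * (2 * r) ^ (k - 1)) * nD δ N D := by gcongr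
          _ = _ := by rw [one_mul]
    _ = _ := by
        simp only [Finset.sum_const, Finset.card_univ, Fintype.card_fin, nsmul_eq_mul]
        push_cast
        ring

end DualEstimates

/-! ### Flows of small multilinear vector fields -/

section Flow

variable {E : Type*} [NormedAddCommGroup E]

/-- Continuous curves on `[0, 1]`. -/
abbrev Curve (E : Type*) [NormedAddCommGroup E] := C(Set.Icc (0 : ℝ) 1, E)

/-- The extension of a curve on `[0, 1]` to `ℝ`. -/
def Curve.ext (w : Curve E) (r : ℝ) : E := w (Set.projIcc 0 1 zero_le_one r)

lemma Curve.continuous_ext (w : Curve E) : Continuous w.ext :=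
  w.continuous.comp continuous_projIcc

lemma Curve.norm_ext_le (w : Curve E) (r : ℝ) : ‖w.ext r‖ ≤ ‖w‖ := w.norm_coe_le_norm _

lemma Curve.ext_of_mem (w : Curve E) {r : ℝ} (hr : r ∈ Set.Icc (0 : ℝ) 1) : w.ext r = w ⟨r, hr⟩ := by
  rw [Curve.ext, Set.projIcc_of_mem]

variable [NormedSpace ℝ E] {k : ℕ}

/-- Pointwise application of a multilinear map to curves. -/
def pointwise {F : Type*} [NormedAddCommGroup F] [NormedSpace ℝ F]
    (Φ : ContinuousMultilinearMap ℝ (fun _ : Fin k => E) F) :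
    ContinuousMultilinearMap ℝ (fun _ : Fin k => Curve E) (Curve F) :=
  MultilinearMap.mkContinuous
    { toFun := fun w => ⟨fun s => Φ fun i => w i s,
        Φ.cont.comp (continuous_pi fun i => (w i).continuous)⟩
      map_update_add' := fun {inst} w i x y => by
        obtain rfl := Subsingleton.elim inst (instDecidableEqFin k)
        ext s
        have e : ∀ z : Curve E, (fun l => (Function.update w i z l) s)
            = Function.update (fun l => w l s) i (z s) := by
          intro z; ext1 l
          by_cases h : l = i
          · subst h; simp
          · simp [h]
        simp [e]
      map_update_smul' := fun {inst} w i r x => by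
        obtain rfl := Subsingleton.elim inst (instDecidableEqFin k)
        ext s
        have e : ∀ z : Curve E, (fun l => (Function.update w i z l) s)
            = Function.update (fun l => w l s) i (z s) := by
          intro z; ext1 l
          by_cases h : l = i
          · subst h; simp
          · simp [h]
        simp [e] } ‖Φ‖ (fun w => by
      refine (ContinuousMap.norm_le _ (by positivity)).mpr fun s => ?_
      refine (Φ.le_opNorm _).trans ?_
      gcongr with i
      exact (w i).norm_coe_le_norm s)

@[simp] lemma pointwise_apply {F : Type*} [NormedAddCommGroup F] [NormedSpace ℝ F]
    (Φ : ContinuousMultilinearMap ℝ (fun _ : Fin k => E) F) (w : Fin k → Curve E)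
    (s : Set.Icc (0 : ℝ) 1) : pointwise Φ w s = Φ fun i => w i s := rfl

lemma norm_pointwise_le {F : Type*} [NormedAddCommGroup F] [NormedSpace ℝ F]
    (Φ : ContinuousMultilinearMap ℝ (fun _ : Fin k => E) F) : ‖pointwise Φ‖ ≤ ‖Φ‖ :=
  MultilinearMap.mkContinuous_norm_le _ (norm_nonneg _) _

lemma norm_integral_ext_le (w : Curve E) (s : Set.Icc (0 : ℝ) 1) :
    ‖∫ r in (0 : ℝ)..s, w.ext r‖ ≤ ‖w‖ := by
  have h := intervalIntegral.norm_integral_le_of_norm_le_const (a := (0 : ℝ)) (b := s)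
    (C := ‖w‖) (f := w.ext) (fun r _ => w.norm_ext_le r)
  refine h.trans ?_
  have h1 := s.2.1
  have h2 := s.2.2
  rw [sub_zero, abs_of_nonneg h1]
  nlinarith [norm_nonneg w]

/-- The primitive of a curve. -/
def volterra : Curve E →L[ℝ] Curve E :=
  LinearMap.mkContinuous
    { toFun := fun w => ⟨fun s => ∫ r in (0 : ℝ)..s, w.ext r,
        (intervalIntegral.continuous_primitive
          (fun _ _ => w.continuous_ext.intervalIntegrable _ _) 0).comp continuous_subtype_val⟩
      map_add' := fun w w' => by
        ext s
        exact intervalIntegral.integral_add (w.continuous_ext.intervalIntegrable _ _)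
          (w'.continuous_ext.intervalIntegrable _ _)
      map_smul' := fun c w => by
        ext s
        exact intervalIntegral.integral_smul c _ } 1 (fun w => by
      rw [one_mul]
      exact (ContinuousMap.norm_le _ (norm_nonneg w)).mpr (norm_integral_ext_le w))

lemma norm_volterra_le (w : Curve E) : ‖volterra w‖ ≤ ‖w‖ :=
  (ContinuousMap.norm_le _ (norm_nonneg w)).mpr (norm_integral_ext_le w)

variable (Φ : ContinuousMultilinearMap ℝ (fun _ : Fin k => E) E)

/-- The Picard map `w ↦ ∫ Φ(w, …, w)`. -/
def picard (w : Curve E) : Curve E := volterra (pointwise Φ fun _ => w)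

lemma differentiableAt_picard (w : Curve E) : DifferentiableAt ℝ (picard Φ) w :=
  DifferentiableAt.comp (g := (volterra : Curve E →L[ℝ] Curve E)) w
    (volterra : Curve E →L[ℝ] Curve E).differentiableAt
    (hasFDerivAt_diag (pointwise Φ) w).differentiableAt

/-- Smallness of the vector field on the ball of radius `2ρ`. -/
def Small (ρ : ℝ) : Prop := 0 < ρ ∧ ‖Φ‖ * (k + 1) * (2 * ρ) ^ (k - 1) ≤ 1 / 4

variable {Φ} {ρ : ℝ}

lemma Small.picard_sub (h : Small Φ ρ) {w w' : Curve E} (hw : ‖w‖ ≤ 2 * ρ) (hw' : ‖w'‖ ≤ 2 * ρ) :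
    ‖picard Φ w - picard Φ w'‖ ≤ 1 / 4 * ‖w - w'‖ := by
  have h0 := h.1
  unfold picard
  rw [← map_sub]
  refine (norm_volterra_le _).trans (((pointwise Φ).norm_image_sub_le _ _).trans ?_)
  have e : (fun _ : Fin k => w) - (fun _ => w') = fun _ => w - w' := rfl
  rw [e, Fintype.card_fin]
  have hm : max ‖fun _ : Fin k => w‖ ‖fun _ : Fin k => w'‖ ≤ 2 * ρ :=
    max_le ((pi_norm_const_le w).trans hw) ((pi_norm_const_le w').trans hw')
  calc _ ≤ ‖Φ‖ * (k + 1) * (2 * ρ) ^ (k - 1) * ‖w - w'‖ := by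
        gcongr
        · exact norm_pointwise_le Φ
        · linarith
        · exact pi_norm_const_le _
    _ ≤ _ := by gcongr; exact h.2

lemma Small.norm_picard_le (hk : k ≠ 0) (h : Small Φ ρ) {w : Curve E} (hw : ‖w‖ ≤ 2 * ρ) :
    ‖picard Φ w‖ ≤ ρ / 2 := by
  have h0 := h.1
  refine (norm_volterra_le _).trans (((pointwise Φ).le_opNorm _).trans ?_)
  rw [Finset.prod_const, Finset.card_univ, Fintype.card_fin]
  have h2 := h.2
  calc ‖pointwise Φ‖ * ‖w‖ ^ k ≤ ‖Φ‖ * (2 * ρ) ^ k := by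
        gcongr; exact norm_pointwise_le Φ
    _ = ‖Φ‖ * 1 * (2 * ρ) ^ (k - 1) * (2 * ρ) := by
        rw [mul_one, mul_assoc, ← pow_succ, Nat.sub_add_cancel (Nat.pos_of_ne_zero hk)]
    _ ≤ ‖Φ‖ * (k + 1) * (2 * ρ) ^ (k - 1) * (2 * ρ) := by
        gcongr; linarith [Nat.cast_nonneg (α := ℝ) k]
    _ ≤ 1 / 4 * (2 * ρ) := by gcongr
    _ = ρ / 2 := by ring

/-- The Picard map contracts by 1/4 and has size at most ρ/2 on the ball of radius 2ρ. As ρ + ρ/2 <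
2ρ, the fixed point lies strictly inside, which the differentiability argument needs. -/
lemma Small.exists_solution [CompleteSpace E] (hk : k ≠ 0) (h : Small Φ ρ) {φ : Curve E}
    (hφ : ‖φ‖ ≤ ρ) : ∃ w : Curve E, ‖w‖ < 2 * ρ ∧ w = φ + picard Φ w := by
  have h0 := h.1
  have hmaps : Set.MapsTo (fun w => φ + picard Φ w) (Metric.closedBall 0 (2 * ρ))
      (Metric.closedBall 0 (2 * ρ)) := by
    intro w hw
    rw [mem_closedBall_zero_iff] at hw ⊢
    refine (norm_add_le _ _).trans ?_
    linarith [h.norm_picard_le hk hw]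
  have hcontr : ContractingWith (1 / 4) (hmaps.restrict _ _ _) := by
    refine ⟨by norm_num, LipschitzWith.of_dist_le_mul fun x y => ?_⟩
    have hx := mem_closedBall_zero_iff.mp x.2
    have hy := mem_closedBall_zero_iff.mp y.2
    rw [Subtype.dist_eq, Subtype.dist_eq, dist_eq_norm, dist_eq_norm]
    simp only [Set.MapsTo.val_restrict_apply, add_sub_add_left_eq_sub]
    simpa using h.picard_sub hx hy
  obtain ⟨w, hw, hfix, -⟩ := hcontr.exists_fixedPoint' Metric.isClosed_closedBall.isComplete hmaps
    (x := 0) (by simp [h0.le]) (edist_ne_top _ _)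
  rw [mem_closedBall_zero_iff] at hw
  refine ⟨w, ?_, hfix.symm⟩
  have e : w = φ + picard Φ w := hfix.symm
  rw [e]
  refine (norm_add_le _ _).trans_lt ?_
  linarith [h.norm_picard_le hk hw]

variable (Φ ρ) in
open Classical in
/-- The solution of `w = φ + ∫ Φ(w, …, w)`. -/
def sol (φ : Curve E) : Curve E :=
  if h : ∃ w : Curve E, ‖w‖ < 2 * ρ ∧ w = φ + picard Φ w then h.choose else 0

lemma Small.sol_spec [CompleteSpace E] (hk : k ≠ 0) (h : Small Φ ρ) {φ : Curve E} (hφ : ‖φ‖ ≤ ρ) :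
    ‖sol Φ ρ φ‖ < 2 * ρ ∧ sol Φ ρ φ = φ + picard Φ (sol Φ ρ φ) := by
  have h1 := h.exists_solution hk hφ
  rw [sol, dif_pos h1]
  exact h1.choose_spec

lemma Small.sol_sub [CompleteSpace E] (hk : k ≠ 0) (h : Small Φ ρ) {φ ψ : Curve E} (hφ : ‖φ‖ ≤ ρ)
    (hψ : ‖ψ‖ ≤ ρ) : ‖sol Φ ρ φ - sol Φ ρ ψ‖ ≤ 2 * ‖φ - ψ‖ := by
  obtain ⟨h1, e1⟩ := h.sol_spec hk hφ
  obtain ⟨h2, e2⟩ := h.sol_spec hk hψ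
  have h3 := h.picard_sub h1.le h2.le
  have e : sol Φ ρ φ - sol Φ ρ ψ = (φ - ψ) + (picard Φ (sol Φ ρ φ) - picard Φ (sol Φ ρ ψ)) := by
    rw [← add_sub_add_comm]
    exact congrArg₂ _ e1 e2
  have h4 := norm_add_le (φ - ψ) (picard Φ (sol Φ ρ φ) - picard Φ (sol Φ ρ ψ))
  rw [← e] at h4
  linarith [norm_nonneg (φ - ψ)]

/-- `sol` is a local inverse of w ↦ w - `picard Φ w`. The derivative 1 - D is invertible by a
Neumann series, since the contraction estimate gives ‖D‖ ≤ 1/4, and `sol` is continuous by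
`Small.sol_sub`. -/
lemma Small.differentiableAt_sol [CompleteSpace E] (hk : k ≠ 0) (h : Small Φ ρ) {φ : Curve E}
    (hφ : ‖φ‖ < ρ) : DifferentiableAt ℝ (sol Φ ρ) φ := by
  obtain ⟨h1, e1⟩ := h.sol_spec hk hφ.le
  set w := sol Φ ρ φ with hw
  have hd := (differentiableAt_picard Φ w).hasFDerivAt
  set D := fderiv ℝ (picard Φ) w
  have hball : ∀ᶠ x in nhds w, ‖x‖ < 2 * ρ :=
    (continuous_norm.tendsto w).eventually (gt_mem_nhds h1)
  have hD : ‖D‖ ≤ 1 / 4 := by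
    refine hd.le_of_lip' (by norm_num) ?_
    filter_upwards [hball] with x hx
    exact h.picard_sub hx.le h1.le
  let U : (Curve E →L[ℝ] Curve E)ˣ := Units.oneSub D (by linarith)
  have hf : HasFDerivAt (fun x => x - picard Φ x)
      ((ContinuousLinearEquiv.unitsEquiv ℝ (Curve E) U : Curve E ≃L[ℝ] Curve E) :
        Curve E →L[ℝ] Curve E) w := (hasFDerivAt_id w).sub hd
  have hφball : ∀ᶠ x in nhds φ, ‖x‖ < ρ := (continuous_norm.tendsto φ).eventually (gt_mem_nhds hφ)
  have hcont : ContinuousAt (sol Φ ρ) φ := by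
    rw [Metric.continuousAt_iff']
    intro ε hε
    filter_upwards [hφball, Metric.ball_mem_nhds φ (half_pos hε)] with x hx hx'
    rw [dist_eq_norm]
    have := h.sol_sub hk hx.le hφ.le
    rw [Metric.mem_ball, dist_eq_norm] at hx'
    linarith
  refine (HasFDerivAt.of_local_left_inverse hcont hf ?_).differentiableAt
  filter_upwards [hφball] with x hx
  rw [sub_eq_iff_eq_add]
  exact (h.sol_spec hk hx.le).2

/-- Constant curves. -/
def constCurve : E →L[ℝ] Curve E :=
  LinearMap.mkContinuous
    { toFun := fun v => ContinuousMap.const _ v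
      map_add' := fun _ _ => rfl
      map_smul' := fun _ _ => rfl } 1 (fun v => by
      rw [one_mul]
      exact (ContinuousMap.norm_le _ (norm_nonneg v)).mpr fun s => le_rfl)

lemma norm_constCurve (v : E) : ‖constCurve v‖ = ‖v‖ := by
  refine le_antisymm ((ContinuousMap.norm_le _ (norm_nonneg _)).mpr fun s => le_rfl) ?_
  exact (constCurve v).norm_coe_le_norm ⟨0, by simp⟩

variable (Φ ρ) in
/-- The flow of the vector field `u ↦ Φ(u, …, u)`. -/
def flow (v : E) (s : ℝ) : E :=
  v + ∫ r in (0 : ℝ)..s, (pointwise Φ fun _ => sol Φ ρ (constCurve v)).ext r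

lemma flow_zero (v : E) : flow Φ ρ v 0 = v := by simp [flow]

/-- The integral formula extends the fixed point to all real s, so that derivatives at the end
points of [0, 1] need no separate care. -/
lemma Small.flow_eq [CompleteSpace E] (hk : k ≠ 0) (h : Small Φ ρ) {v : E} (hv : ‖v‖ ≤ ρ)
    (s : Set.Icc (0 : ℝ) 1) : flow Φ ρ v s = sol Φ ρ (constCurve v) s := by
  rw [← norm_constCurve] at hv
  rw [(h.sol_spec hk hv).2]
  rw [← (h.sol_spec hk hv).2]
  conv_rhs => rw [(h.sol_spec hk hv).2]
  rfl

lemma Small.norm_flow_le [CompleteSpace E] (hk : k ≠ 0) (h : Small Φ ρ) {v : E} (hv : ‖v‖ ≤ ρ)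
    {s : ℝ} (hs : s ∈ Set.Icc (0 : ℝ) 1) : ‖flow Φ ρ v s‖ ≤ 2 * ρ := by
  rw [h.flow_eq hk hv ⟨s, hs⟩]
  rw [← norm_constCurve] at hv
  exact (ContinuousMap.norm_coe_le_norm _ _).trans (h.sol_spec hk hv).1.le

lemma Small.hasDerivWithinAt_flow [CompleteSpace E] (hk : k ≠ 0) (h : Small Φ ρ) {v : E}
    (hv : ‖v‖ ≤ ρ) {s : ℝ} (hs : s ∈ Set.Icc (0 : ℝ) 1) :
    HasDerivWithinAt (flow Φ ρ v) (Φ fun _ => flow Φ ρ v s) (Set.Icc 0 1) s := by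
  have hc := (pointwise Φ fun _ => sol Φ ρ (constCurve v)).continuous_ext
  have h1 := (intervalIntegral.integral_hasDerivAt_right (hc.intervalIntegrable 0 s)
    (hc.stronglyMeasurableAtFilter _ _) hc.continuousAt).const_add v
  have e : (pointwise Φ fun _ => sol Φ ρ (constCurve v)).ext s = Φ fun _ => flow Φ ρ v s := by
    rw [Curve.ext_of_mem _ hs, pointwise_apply, h.flow_eq hk hv ⟨s, hs⟩]
  rw [e] at h1
  exact h1.hasDerivWithinAt

lemma Small.differentiableAt_flow [CompleteSpace E] (hk : k ≠ 0) (h : Small Φ ρ) {v : E}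
    (hv : ‖v‖ < ρ) : DifferentiableAt ℝ (fun v => flow Φ ρ v 1) v := by
  have hv' : ‖constCurve v‖ < ρ := by rwa [norm_constCurve]
  have h1 : DifferentiableAt ℝ (fun v => sol Φ ρ (constCurve v)) v :=
    DifferentiableAt.comp (f := constCurve) v (h.differentiableAt_sol hk hv')
      (constCurve : E →L[ℝ] Curve E).differentiableAt
  let ev1 : Curve E →L[ℝ] E := ContinuousMap.evalCLM ℝ (⟨1, by simp⟩ : Set.Icc (0 : ℝ) 1)
  have h2 : DifferentiableAt ℝ (fun v => ev1 (sol Φ ρ (constCurve v))) v :=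
    ev1.differentiableAt.comp v h1
  refine h2.congr_of_eventuallyEq ?_
  filter_upwards [(continuous_norm.tendsto v).eventually (gt_mem_nhds hv)] with x hx
  exact h.flow_eq hk hx.le ⟨1, by simp⟩

end Flow

/-! ### Flow lines -/

section FlowLine

variable {δ N : ℝ} {k : ℕ}

lemma nB_zero_one_le (hδ : 0 ≤ δ) (hN : 1 ≤ N) (g : ℤ → ℝ≥0∞) :
    nB 0 1 g ≤ ENNReal.ofReal N * nB δ N g := by
  refine nB_le le_rfl (fun n => ?_) ?_
  · rw [wt_zero, one_mul]
    exact (ENNReal.le_tsum n).trans (tsum_le_nB hδ hN g)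
  · simpa [wt_zero] using tsum_le_nB hδ hN g

variable [hN : Fact (1 ≤ N)]

lemma nD_ev_le (hδ : 0 ≤ δ) (u : X δ N) :
    nD δ N (fun n => ‖ev u n‖ₑ) ≤ ENNReal.ofReal N * ‖u‖ₑ := by
  rw [X.enorm_eq]
  exact nD_le_nB hδ hN.out _

lemma enorm_ev_sub_le {z z' : ℝ → X δ N}
    (hz : ∀ s ∈ Set.Icc (0 : ℝ) 1, HasDerivWithinAt z (z' s) (Set.Icc 0 1) s)
    (hz' : ContinuousOn z' (Set.Icc 0 1)) {s : ℝ} (hs : s ∈ Set.Icc (0 : ℝ) 1) (n : ℤ) :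
    ‖ev (z s) n - ev (z 0) n‖ₑ ≤ ∫⁻ r in Set.Icc (0 : ℝ) 1, ‖ev (z' r) n‖ₑ := by
  have hsub : Set.Icc 0 s ⊆ Set.Icc (0 : ℝ) 1 := Set.Icc_subset_Icc_right hs.2
  have hc : ContinuousOn (fun r => coord n (z' r)) (Set.Icc 0 1) :=
    (coord n).continuous.comp_continuousOn hz'
  have h := intervalIntegral.integral_eq_sub_of_hasDerivAt_of_le (f := fun r => coord n (z r))
    (f' := fun r => coord n (z' r)) hs.1
    ((coord n).continuous.comp_continuousOn fun r hr =>
      ((hz r (hsub hr)).continuousWithinAt.mono hsub))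
    (fun r hr => (coord n).hasFDerivAt.comp_hasDerivAt r
      ((hz r (hsub (Set.Ioo_subset_Icc_self hr))).hasDerivAt
        (Icc_mem_nhds hr.1 (hr.2.trans_le hs.2))))
    ((hc.mono hsub).intervalIntegrable_of_Icc hs.1)
  simp only [coord_apply] at h
  rw [← h, intervalIntegral.integral_of_le hs.1]
  refine (MeasureTheory.enorm_integral_le_lintegral_enorm _).trans ?_
  exact MeasureTheory.lintegral_mono_set (Set.Ioc_subset_Icc_self.trans hsub)

/-- Gronwall's inequality for the dual norm, with a small constant. -/
lemma nD_ev_le_two_mul (hδ : 0 ≤ δ) {z z' : ℝ → X δ N}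
    (hz : ∀ s ∈ Set.Icc (0 : ℝ) 1, HasDerivWithinAt z (z' s) (Set.Icc 0 1) s)
    (hz' : ContinuousOn z' (Set.Icc 0 1))
    (H : ∀ s ∈ Set.Icc (0 : ℝ) 1,
      nD δ N (fun n => ‖ev (z' s) n‖ₑ) ≤ 1 / 2 * nD δ N (fun n => ‖ev (z s) n‖ₑ))
    {s : ℝ} (hs : s ∈ Set.Icc (0 : ℝ) 1) :
    nD δ N (fun n => ‖ev (z s) n‖ₑ) ≤ 2 * nD δ N (fun n => ‖ev (z 0) n‖ₑ) := by
  set M := ⨆ s ∈ Set.Icc (0 : ℝ) 1, nD δ N (fun n => ‖ev (z s) n‖ₑ) with hM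
  set D := nD δ N (fun n => ‖ev (z 0) n‖ₑ) with hD
  have hle : ∀ s ∈ Set.Icc (0 : ℝ) 1, nD δ N (fun n => ‖ev (z s) n‖ₑ) ≤ M := fun s hs =>
    le_iSup₂_of_le s hs le_rfl
  -- Finiteness of M allows M/2 to be absorbed below; the dual norm is at most N times the norm,
  -- which is bounded along the curve by compactness.
  have hMtop : M ≠ ∞ := by
    obtain ⟨B, hB⟩ := isCompact_Icc.exists_bound_of_continuousOn
      (fun s hs => (hz s hs).continuousWithinAt : ContinuousOn z (Set.Icc 0 1))
    refine ne_top_of_le_ne_top (b := ENNReal.ofReal N * ENNReal.ofReal B)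
      (ENNReal.mul_ne_top ENNReal.ofReal_ne_top ENNReal.ofReal_ne_top) (iSup₂_le fun s hs => ?_)
    refine (nD_ev_le hδ _).trans ?_
    gcongr
    rw [← ofReal_norm]
    exact ENNReal.ofReal_le_ofReal (hB s hs)
  -- Test against the unit ball of `nB` and exchange the sum with the time integral.
  have hstep : M ≤ D + 1 / 2 * M := by
    refine iSup₂_le fun s hs => nD_le fun g hg => ?_
    have h1 : ∀ n, ‖ev (z s) n‖ₑ
        ≤ ‖ev (z 0) n‖ₑ + ∫⁻ r in Set.Icc (0 : ℝ) 1, ‖ev (z' r) n‖ₑ := by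
      intro n
      have := enorm_ev_sub_le hz hz' hs n
      calc ‖ev (z s) n‖ₑ = ‖ev (z 0) n + (ev (z s) n - ev (z 0) n)‖ₑ := by rw [add_sub_cancel]
        _ ≤ _ := (enorm_add_le _ _).trans (by gcongr)
    have hmeas : ∀ n, AEMeasurable (fun r => ‖ev (z' r) n‖ₑ)
        (MeasureTheory.volume.restrict (Set.Icc (0 : ℝ) 1)) := fun n =>
      (((coord n).continuous.comp_continuousOn hz').aestronglyMeasurable
        measurableSet_Icc).enorm
    have hint : ∑' n, g n * ∫⁻ r in Set.Icc (0 : ℝ) 1, ‖ev (z' r) n‖ₑ ≤ 1 / 2 * M := by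
      have e : ∀ n, g n * ∫⁻ r in Set.Icc (0 : ℝ) 1, ‖ev (z' r) n‖ₑ
          = ∫⁻ r in Set.Icc (0 : ℝ) 1, g n * ‖ev (z' r) n‖ₑ := fun n =>
        (MeasureTheory.lintegral_const_mul'' _ (hmeas n)).symm
      rw [tsum_congr e, ← MeasureTheory.lintegral_tsum fun n => (hmeas n).const_mul _]
      refine (MeasureTheory.setLIntegral_mono' (g := fun _ => 1 / 2 * M) measurableSet_Icc
        fun r hr => ?_).trans ?_
      · exact (tsum_mul_le_nD hg).trans ((H r hr).trans (by gcongr; exact hle r hr))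
      · simp
    calc ∑' n, g n * ‖ev (z s) n‖ₑ
        ≤ ∑' n, (g n * ‖ev (z 0) n‖ₑ + g n * ∫⁻ r in Set.Icc (0 : ℝ) 1, ‖ev (z' r) n‖ₑ) :=
          ENNReal.tsum_le_tsum fun n => by rw [← mul_add]; gcongr; exact h1 n
      _ ≤ D + 1 / 2 * M := by
          rw [ENNReal.tsum_add]
          exact add_le_add (tsum_mul_le_nD hg) hint
  refine (hle s hs).trans ?_
  have hDtop : D ≠ ∞ := ne_top_of_le_ne_top hMtop (hle 0 (by simp))
  have h2 : M.toReal ≤ D.toReal + 1 / 2 * M.toReal := by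
    have := ENNReal.toReal_mono (by finiteness) hstep
    rwa [ENNReal.toReal_add hDtop (by finiteness), ENNReal.toReal_mul,
      ENNReal.toReal_div, ENNReal.toReal_one, ENNReal.toReal_ofNat] at this
  rw [← ENNReal.toReal_le_toReal hMtop (by finiteness), ENNReal.toReal_mul, ENNReal.toReal_ofNat]
  linarith

instance : Fact ((1 : ℝ) ≤ 1) := ⟨le_rfl⟩

/-- The inclusion in the space without weights. -/
def incl (hδ : 0 ≤ δ) : X δ N →L[ℝ] X 0 1 :=
  LinearMap.mkContinuous
    { toFun := fun u => mkX (ev u) (ne_top_of_le_ne_top (ENNReal.mul_ne_top ENNReal.ofReal_ne_top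
        (nB_ev_ne_top hN.out u)) (nB_zero_one_le hδ hN.out _))
      map_add' := fun u u' => X.ext fun n => by simp
      map_smul' := fun c u => X.ext fun n => by simp } N (fun u => by
    have hN0 : 0 ≤ N := zero_le_one.trans hN.out
    rw [X.norm_le_iff (by positivity)]
    simp only [LinearMap.coe_mk, AddHom.coe_mk, ev_mkX]
    refine (nB_zero_one_le hδ hN.out _).trans ?_
    rw [← X.enorm_eq, ENNReal.ofReal_mul hN0, ofReal_norm])

@[simp] lemma ev_incl (hδ : 0 ≤ δ) (u : X δ N) : ev (incl hδ u) = ev u :=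
  ev_mkX (ev u) (ne_top_of_le_ne_top (ENNReal.mul_ne_top ENNReal.ofReal_ne_top
    (nB_ev_ne_top hN.out u)) (nB_zero_one_le hδ hN.out _))

lemma toLp_apply_zero (u : X 0 1) (n : ℤ) : (X.toLp u : ℤ → ℂ) n = ev u n := by
  rw [← exp_smul_ev]; simp

lemma isFlowLine_of_hasDerivWithinAt (hδ : 0 ≤ δ) {F : (ℤ → ℂ) → ℂ} {V : X δ N → X δ N}
    (hV : ∀ u n, dbar F (ev u) n = ev (V u) n) {w : ℝ → X δ N}
    (hw : ∀ s ∈ Set.Icc (0 : ℝ) 1, HasDerivWithinAt w (V (w s)) (Set.Icc 0 1) s) :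
    IsFlowLine F (ev (w 0)) fun s => X.toLpL (incl hδ (w s)) where
  initial := by
    ext n
    rw [X.toLpL_apply, toLp_apply_zero, ev_incl]
  continuousOn := X.toLpL.continuous.comp_continuousOn
    ((incl hδ).continuous.comp_continuousOn fun s hs => (hw s hs).continuousWithinAt)
  hasDeriv := fun s hs n => by
    have e : ∀ t, (X.toLpL (incl hδ (w t)) : ℤ → ℂ) = ev (w t) := fun t => by
      ext m
      rw [X.toLpL_apply, toLp_apply_zero, ev_incl]
    simp only [e, hV]
    exact (coord n).hasFDerivAt.comp_hasDerivWithinAt s (hw s hs)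

/-- A flow line is assumed differentiable only coordinate by coordinate. Since it is continuous in
ℓ¹, so is the field along it; the fundamental theorem in each coordinate gives an integral equation
in the Banach space, and this gives differentiability in norm. -/
lemma IsFlowLine.hasDerivWithinAt {F : (ℤ → ℂ) → ℂ} {V : X 0 1 → X 0 1} (hVc : Continuous V)
    (hV : ∀ u n, dbar F (ev u) n = ev (V u) n) {v : ℤ → ℂ} {w : ℝ → lp (fun _ : ℤ => ℂ) 1}
    (h : IsFlowLine F v w) {s : ℝ} (hs : s ∈ Set.Icc (0 : ℝ) 1) :
    HasDerivWithinAt (fun t => (X.toLpL.symm (w t) : X 0 1)) (V (X.toLpL.symm (w s)))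
      (Set.Icc 0 1) s := by
  set W : ℝ → X 0 1 := fun t => X.toLpL.symm (w t) with hW
  have hWc : ContinuousOn W (Set.Icc 0 1) := X.toLpL.symm.continuous.comp_continuousOn h.continuousOn
  have evW : ∀ t, (w t : ℤ → ℂ) = ev (W t) := fun t => by
    ext n
    rw [← toLp_apply_zero, ← X.toLpL_apply, hW, ContinuousLinearEquiv.apply_symm_apply]
  have hd : ∀ t ∈ Set.Icc (0 : ℝ) 1, ∀ n, HasDerivWithinAt (fun t => coord n (W t))
      (coord n (V (W t))) (Set.Icc 0 1) t := by
    intro t ht n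
    have := h.hasDeriv t ht n
    simp only [evW, hV] at this
    exact this
  -- The field along the curve, extended by constants outside [0, 1] so as to be continuous on ℝ.
  set G : ℝ → X 0 1 := fun r => V (W (Set.projIcc 0 1 zero_le_one r)) with hG
  have hGc : Continuous G :=
    hVc.comp ((continuousOn_iff_continuous_domRestrict.mp hWc).comp continuous_projIcc)
  have hGe : ∀ t ∈ Set.Icc (0 : ℝ) 1, G t = V (W t) := fun t ht => by
    simp only [hG]
    rw [Set.projIcc_of_mem _ ht]
  have key : ∀ t ∈ Set.Icc (0 : ℝ) 1, W t = W 0 + ∫ r in (0 : ℝ)..t, G r := by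
    intro t ht
    have hsub : Set.Icc 0 t ⊆ Set.Icc (0 : ℝ) 1 := Set.Icc_subset_Icc_right ht.2
    refine X.ext fun n => ?_
    rw [← coord_apply, ← coord_apply, map_add, ← sub_eq_iff_eq_add',
      ← ContinuousLinearMap.intervalIntegral_comp_comm _ (hGc.intervalIntegrable _ _)]
    refine (intervalIntegral.integral_eq_sub_of_hasDerivAt_of_le ht.1
      ((coord n).continuous.comp_continuousOn (hWc.mono hsub)) (fun r hr => ?_)
      (((coord n).continuous.comp hGc).intervalIntegrable _ _)).symm
    have hr' := hsub (Set.Ioo_subset_Icc_self hr)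
    have e : (coord n ∘ G) r = coord n (V (W r)) := congrArg (coord n) (hGe r hr')
    rw [e]
    exact (hd r hr' n).hasDerivAt (Icc_mem_nhds hr.1 (hr.2.trans_le ht.2))
  have hder : HasDerivAt (fun t => W 0 + ∫ r in (0 : ℝ)..t, G r) (G s) s :=
    (intervalIntegral.integral_hasDerivAt_right (hGc.intervalIntegrable 0 s)
      (hGc.stronglyMeasurableAtFilter _ _) hGc.continuousAt).const_add _
  rw [hGe s hs] at hder
  exact hder.hasDerivWithinAt.congr key (key s hs)

/-- No smallness is required: two continuous curves on [0, 1] lie in a common ball of ℓ¹, on which a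
polynomial vector field is Lipschitz. -/
lemma IsFlowLine.eqOn {F : (ℤ → ℂ) → ℂ}
    {T : ContinuousMultilinearMap ℝ (fun _ : Fin k => X 0 1) (X 0 1)}
    (hV : ∀ u n, dbar F (ev u) n = ev (T fun _ => u) n) {v : ℤ → ℂ}
    {w w' : ℝ → lp (fun _ : ℤ => ℂ) 1} (h : IsFlowLine F v w) (h' : IsFlowLine F v w') :
    Set.EqOn w w' (Set.Icc 0 1) := by
  have hTc : Continuous fun u : X 0 1 => T fun _ => u := T.cont.comp (by fun_prop)
  have hw := fun s hs => h.hasDerivWithinAt hTc hV (s := s) hs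
  have hw' := fun s hs => h'.hasDerivWithinAt hTc hV (s := s) hs
  have hc : ContinuousOn _ (Set.Icc (0 : ℝ) 1) := fun s hs => (hw s hs).continuousWithinAt
  have hc' : ContinuousOn _ (Set.Icc (0 : ℝ) 1) := fun s hs => (hw' s hs).continuousWithinAt
  obtain ⟨B, hB⟩ := isCompact_Icc.exists_bound_of_continuousOn hc
  obtain ⟨B', hB'⟩ := isCompact_Icc.exists_bound_of_continuousOn hc'
  set R := max B B' with hR
  have hR0 : 0 ≤ R := (norm_nonneg _).trans ((hB 0 (by simp)).trans (le_max_left _ _))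
  have hlip : LipschitzOnWith (‖T‖ * k * R ^ (k - 1)).toNNReal (fun u : X 0 1 => T fun _ => u)
      (Metric.closedBall 0 R) := by
    refine LipschitzOnWith.of_dist_le_mul fun x hx y hy => ?_
    rw [mem_closedBall_zero_iff] at hx hy
    rw [dist_eq_norm, dist_eq_norm, Real.coe_toNNReal _ (by positivity)]
    refine (T.norm_image_sub_le _ _).trans ?_
    rw [Fintype.card_fin]
    have e : (fun _ : Fin k => x) - (fun _ => y) = fun _ => x - y := rfl
    rw [e]
    have hm : max ‖fun _ : Fin k => x‖ ‖fun _ : Fin k => y‖ ≤ R :=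
      max_le ((pi_norm_const_le x).trans hx) ((pi_norm_const_le y).trans hy)
    gcongr
    exact pi_norm_const_le _
  have key := ODE_solution_unique_of_mem_Icc_right (v := fun _ u => T fun _ => u)
    (s := fun _ => Metric.closedBall 0 R) (fun _ _ => hlip) hc
    (fun t ht => (hw t (Set.Ico_subset_Icc_self ht)).mono_of_mem_nhdsWithin
      (Icc_mem_nhdsGE_of_mem ht))
    (fun t ht => mem_closedBall_zero_iff.mpr
      ((hB t (Set.Ico_subset_Icc_self ht)).trans (le_max_left _ _))) hc'
    (fun t ht => (hw' t (Set.Ico_subset_Icc_self ht)).mono_of_mem_nhdsWithin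
      (Icc_mem_nhdsGE_of_mem ht))
    (fun t ht => mem_closedBall_zero_iff.mpr
      ((hB' t (Set.Ico_subset_Icc_self ht)).trans (le_max_right _ _)))
    (by
      have : w 0 = w' 0 := by
        ext n
        rw [h.initial, h'.initial]
      rw [this])
  intro s hs
  exact X.toLpL.symm.injective (key hs)

lemma hasUniqueFlowLine_of_hasDerivWithinAt (hδ : 0 ≤ δ) {F : (ℤ → ℂ) → ℂ}
    {T : ContinuousMultilinearMap ℝ (fun _ : Fin k => X 0 1) (X 0 1)}
    (hT : ∀ u n, dbar F (ev u) n = ev (T fun _ => u) n) {V : X δ N → X δ N}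
    (hV : ∀ u n, dbar F (ev u) n = ev (V u) n) {w : ℝ → X δ N}
    (hw : ∀ s ∈ Set.Icc (0 : ℝ) 1, HasDerivWithinAt w (V (w s)) (Set.Icc 0 1) s) :
    HasUniqueFlowLine F (ev (w 0)) :=
  ⟨_, isFlowLine_of_hasDerivWithinAt hδ hV hw, fun _ h' =>
    h'.eqOn hT (isFlowLine_of_hasDerivWithinAt hδ hV hw)⟩

/-- `flowMap` selects some flow line; uniqueness in ℓ¹ identifies it with the curve constructed in
the weighted space. -/
lemma flowMap_one_eq (hδ : 0 ≤ δ) {F : (ℤ → ℂ) → ℂ}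
    {T : ContinuousMultilinearMap ℝ (fun _ : Fin k => X 0 1) (X 0 1)}
    (hT : ∀ u n, dbar F (ev u) n = ev (T fun _ => u) n) {V : X δ N → X δ N}
    (hV : ∀ u n, dbar F (ev u) n = ev (V u) n) {w : ℝ → X δ N}
    (hw : ∀ s ∈ Set.Icc (0 : ℝ) 1, HasDerivWithinAt w (V (w s)) (Set.Icc 0 1) s) :
    flowMap F 1 (ev (w 0)) = ev (w 1) := by
  have h := isFlowLine_of_hasDerivWithinAt hδ hV hw
  have hex : ∃ w', IsFlowLine F (ev (w 0)) w' := ⟨_, h⟩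
  rw [flowMap, dif_pos hex, hex.choose_spec.eqOn hT h ⟨zero_le_one, le_rfl⟩]
  ext n
  change (X.toLp (incl hδ (w 1)) : ℤ → ℂ) n = _
  rw [toLp_apply_zero, ev_incl]

end FlowLine

/-! ### Expansion of forms in one slot, gradients of imaginary Hamiltonians -/

section Pairing

variable {δ N : ℝ} {k : ℕ}

lemma tsum_prod_apply (f : Fin k → ℤ → ℝ≥0∞) :
    ∑' m : Fin k → ℤ, ∏ i, f i (m i) = ∏ i, ∑' n, f i n := by
  induction k with
  | zero => simp
  | succ k ih =>
    rw [← (Fin.consEquiv fun _ : Fin (k + 1) => ℤ).tsum_eq, ENNReal.tsum_prod', Fin.prod_univ_succ,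
      ← ih, ← ENNReal.tsum_mul_right]
    refine tsum_congr fun n => ?_
    rw [← ENNReal.tsum_mul_left]
    refine tsum_congr fun m => ?_
    rw [Fin.prod_univ_succ]
    simp [Fin.consEquiv]

/-- The kernel may grow like the product of the weights, which admits a factor n² when δ > 0. -/
lemma bdd_of_enorm_le (hN : 1 ≤ N) {B : ℝ≥0} {c : (Fin k → ℤ) → ℂ}
    (hc : ∀ m, ‖c m‖ₑ ≤ B * ∏ i, wt δ (m i)) : Bdd δ N (B * N.toNNReal ^ k) c := by
  intro f
  calc maj (fun m => ‖c m‖ₑ) f ≤ ∑' m : Fin k → ℤ, B * ∏ i, (wt δ (m i) * f i (m i)) := by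
        refine ENNReal.tsum_le_tsum fun m => ?_
        rw [Finset.prod_mul_distrib, ← mul_assoc]
        gcongr
        exact hc m
    _ = B * ∏ i, ∑' n, wt δ n * f i n := by
        rw [ENNReal.tsum_mul_left, tsum_prod_apply fun i n => wt δ n * f i n]
    _ ≤ B * ∏ i, (ENNReal.ofReal N * nB δ N (f i)) := by
        gcongr with i
        exact tsum_wt_mul_le_nB hN _
    _ = _ := by
        rw [Finset.prod_mul_distrib, Finset.prod_const, Finset.card_univ, Fintype.card_fin]
        push_cast
        rw [ENNReal.ofReal, mul_assoc]

lemma mono_update (cj : Fin k → Bool) (m : Fin k → ℤ) (f : Fin k → ℤ → ℂ) (j : Fin k)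
    (h : ℤ → ℂ) : mono cj m (Function.update f j h)
      = cjL (cj j) (h (m j)) * ∏ i ∈ Finset.univ.erase j, cjL (cj i) (f i (m i)) := by
  rw [mono_apply, ← Finset.mul_prod_erase _ _ (Finset.mem_univ j), Function.update_self]
  congr 1
  refine Finset.prod_congr rfl fun i hi => ?_
  rw [Function.update_of_ne (Finset.ne_of_mem_erase hi)]

lemma form_update_single (c : (Fin k → ℤ) → ℂ) (cj : Fin k → Bool) (f : Fin k → ℤ → ℂ) (j : Fin k)
    (n : ℤ) (z : ℂ) : form c cj (Function.update f j (Pi.single n z))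
      = cjL (cj j) z * form c cj (Function.update f j (Pi.single n 1)) := by
  unfold form
  rw [← tsum_mul_left]
  refine tsum_congr fun m => ?_
  rw [mono_update, mono_update]
  by_cases h : m j = n
  · rw [h, Pi.single_eq_same, Pi.single_eq_same]
    cases cj j <;> simp <;> ring
  · rw [Pi.single_eq_of_ne h, Pi.single_eq_of_ne h]
    simp

lemma form_mul_update_single (c : (Fin k → ℤ) → ℂ) (cj : Fin k → Bool) (f : Fin k → ℤ → ℂ)
    (j : Fin k) (d : ℤ → ℝ) (n : ℤ) (z : ℂ) :
    form (fun m => c m * d (m j)) cj (Function.update f j (Pi.single n z))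
      = d n * form c cj (Function.update f j (Pi.single n z)) := by
  unfold form
  rw [← tsum_mul_left]
  refine tsum_congr fun m => ?_
  rw [mono_update]
  beta_reduce
  by_cases h : m j = n
  · rw [h]; ring
  · rw [Pi.single_eq_of_ne h]
    simp

/-- `i Im z`. -/
def imL : ℂ →L[ℝ] ℂ := (Complex.imCLM).smulRight Complex.I

@[simp] lemma imL_apply (z : ℂ) : imL z = z.im * Complex.I := by
  simp [imL]

lemma enorm_imL_le : ‖imL‖ₑ ≤ 1 := by
  rw [← ofReal_norm, ENNReal.ofReal_le_one]
  refine ContinuousLinearMap.opNorm_le_bound _ zero_le_one fun z => ?_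
  rw [imL_apply, norm_mul, Complex.norm_I, mul_one, one_mul, Complex.norm_real]
  exact Complex.abs_im_le_norm z

/-- The slot derivative in the direction of the `n`-th coordinate. -/
def slot (c : (Fin k → ℤ) → ℂ) (cj : Fin k → Bool) (f : ℤ → ℂ) (j : Fin k) (n : ℤ) : ℂ :=
  form c cj (Function.update (fun _ => f) j (Pi.single n 1))

/-- Since i Im Z = (Z - Z̄)/2, only the half which is antilinear in the given slot survives ∂/∂v̄: Z
itself on a conjugated slot, -Z̄ on the others. -/
lemma gradRaw_imL (c : (Fin (k + 1) → ℤ) → ℂ) (cj : Fin (k + 1) → Bool) (j : Fin (k + 1))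
    (f : ℤ → ℂ) (n : ℤ) : gradRaw imL c cj j (fun _ => f) n
      = (1 / 2 : ℂ) * if cj j then slot c cj f j n else -conj (slot c cj f j n) := by
  rw [gradRaw, insertNth_const, insertNth_const, form_update_single _ _ _ _ _ Complex.I]
  change _ * (imL (slot c cj f j n) + Complex.I * imL (_ * slot c cj f j n)) = _
  congr 1
  cases cj j <;> apply Complex.ext <;> simp

/-- The diagonal kernel of `∑ d(n) |v(n)|²`. -/
def kerQuad (d : ℤ → ℝ) (m : Fin 2 → ℤ) : ℂ := if m 0 = m 1 then (d (m 0) : ℂ) else 0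

/-- The conjugation pattern of `∑ d(n) |v(n)|²`. -/
def cj2 : Fin 2 → Bool := ![false, true]

lemma form_kerQuad_single_zero (d : ℤ → ℝ) (f : ℤ → ℂ) (n : ℤ) (z : ℂ) :
    form (kerQuad d) cj2 (Function.update (fun _ => f) 0 (Pi.single n z))
      = d n * (z * conj (f n)) := by
  unfold form
  rw [tsum_eq_single ![n, n]]
  · simp [kerQuad, cj2, Fin.prod_univ_two]
  · intro m hm
    rw [mono_update]
    by_cases h0 : m 0 = n
    · have h1 : m 0 ≠ m 1 := fun h => hm (by ext i; fin_cases i <;> simp [h0, ← h])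
      simp [kerQuad, h1]
    · simp [h0]

lemma form_kerQuad_single_one (d : ℤ → ℝ) (f : ℤ → ℂ) (n : ℤ) (z : ℂ) :
    form (kerQuad d) cj2 (Function.update (fun _ => f) 1 (Pi.single n z))
      = d n * (f n * conj z) := by
  unfold form
  rw [tsum_eq_single ![n, n]]
  · simp [kerQuad, cj2, Fin.prod_univ_two]
  · intro m hm
    rw [mono_update]
    by_cases h0 : m 1 = n
    · have h1 : m 0 ≠ m 1 := fun h => hm (by ext i; fin_cases i <;> simp [h0, h])
      simp [kerQuad, h1]
    · simp [h0]

/-- The sign in `∑ ± d(m_j)`: minus on the conjugated slots. -/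
def sgn (b : Bool) : ℂ := if b then -1 else 1

variable [hN : Fact (1 ≤ N)]

lemma Bdd.hasSum_update {M : ℝ≥0} {c : (Fin k → ℤ) → ℂ} (h : Bdd δ N M c) (cj : Fin k → Bool)
    (u : X δ N) (j : Fin k) (x : X δ N) :
    HasSum (fun n => form c cj (Function.update (fun _ => ev u) j (Pi.single n (ev x n))))
      (form c cj (Function.update (fun _ => ev u) j (ev x))) := by
  have h1 := (X.hasSum_sg x).mapL ((formL h cj).toContinuousLinearMap (fun _ => u) j)
  simpa only [ContinuousMultilinearMap.toContinuousLinearMap_apply, formL_apply, update_ev_comp,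
    ev_sg] using h1

lemma Bdd.hasSum_diag {M : ℝ≥0} {c : (Fin k → ℤ) → ℂ} (h : Bdd δ N M c) (cj : Fin k → Bool)
    (u : X δ N) (j : Fin k) :
    HasSum (fun n => form c cj (Function.update (fun _ => ev u) j (Pi.single n (ev u n))))
      (form c cj (fun _ => ev u)) := by
  have := h.hasSum_update cj u j u
  rwa [Function.update_eq_self_iff.mpr rfl] at this

lemma hasSum_quad {M : ℝ≥0} {d : ℤ → ℝ} (h : Bdd δ N M (kerQuad d)) (u : X δ N) :
    HasSum (fun n => d n * ‖ev u n‖ ^ 2) (form (kerQuad d) cj2 fun _ => ev u).re := by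
  have := Complex.hasSum_re (h.hasSum_diag cj2 u 0)
  simp only [form_kerQuad_single_zero, Complex.mul_conj, Complex.normSq_eq_norm_sq] at this
  exact_mod_cast this

lemma Bdd.summable {M : ℝ≥0} {c : (Fin k → ℤ) → ℂ} (h : Bdd δ N M c) (cj : Fin k → Bool)
    (u : X δ N) : Summable fun m => c m * mono cj m fun _ => ev u :=
  summable_form (h.ne_top fun _ => u)

/-- The derivative of `∑ d(n) |v(n)|²` along the flow of an imaginary Hamiltonian. -/
lemma brk_kerQuad {M M₁ : ℝ≥0} {d : ℤ → ℝ} {c : (Fin (k + 1) → ℤ) → ℂ} {cj : Fin (k + 1) → Bool}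
    (hd : Bdd δ N M (kerQuad d)) (hc : ∀ j, Bdd δ N M₁ fun m => c m * d (m j))
    {u V : X δ N} (hV : ev V = fieldRaw imL c cj (ev u)) :
    brk (kerQuad d) cj2 (ev u) (ev V)
      = -(form (fun m => c m * ∑ j, sgn (cj j) * d (m j)) cj fun _ => ev u).re := by
  have h1 : HasSum (fun n => (d n : ℂ) * (ev V n * conj (ev u n)) +
      d n * (ev u n * conj (ev V n))) (brk (kerQuad d) cj2 (ev u) (ev V)) := by
    have := (hd.hasSum_update cj2 u 0 V).add (hd.hasSum_update cj2 u 1 V)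
    simp only [form_kerQuad_single_zero, form_kerQuad_single_one] at this
    rwa [brk, Fin.sum_univ_two]
  have e : form (fun m => c m * ∑ j, sgn (cj j) * d (m j)) cj (fun _ => ev u)
      = ∑ j, sgn (cj j) * form (fun m => c m * d (m j)) cj fun _ => ev u := by
    unfold form
    simp_rw [← tsum_mul_left]
    rw [← Summable.tsum_finsetSum fun j _ => ((hc j).summable cj u).mul_left _]
    refine tsum_congr fun m => ?_
    rw [Finset.mul_sum, Finset.sum_mul]
    exact Finset.sum_congr rfl fun j _ => by ring
  have h2 : HasSum (fun n => ∑ j, sgn (cj j) * ((d n : ℂ) * (cjL (cj j) (ev u n) *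
      slot c cj (ev u) j n))) (form (fun m => c m * ∑ j, sgn (cj j) * d (m j)) cj fun _ => ev u) := by
    rw [e]
    refine hasSum_sum fun j _ => HasSum.mul_left _ ?_
    have := (hc j).hasSum_diag cj u j
    simp only [form_mul_update_single] at this
    simp only [form_update_single c cj _ j _ (ev u _)] at this
    exact this
  have h3 := (Complex.hasSum_ofReal.mpr (Complex.hasSum_re h2)).neg
  refine h1.unique ?_
  suffices e3 : (fun n => (d n : ℂ) * (ev V n * conj (ev u n)) + d n * (ev u n * conj (ev V n)))
      = fun n => -((∑ j, sgn (cj j) *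
        ((d n : ℂ) * (cjL (cj j) (ev u n) * slot c cj (ev u) j n))).re : ℂ) by
    rw [e3]; exact h3
  funext n
  -- The two cases of `gradRaw_imL` differ by a sign in the real part of the pairing with v̄(n);
  -- that sign is the origin of `sgn`.
  have e2 : ∀ j, (sgn (cj j) * ((d n : ℂ) * (cjL (cj j) (ev u n) * slot c cj (ev u) j n))).re
      = -2 * d n * (gradRaw imL c cj j (fun _ => ev u) n * conj (ev u n)).re := by
    intro j
    rw [gradRaw_imL]
    cases cj j <;> simp [sgn] <;> ring
  rw [Complex.re_sum, Finset.sum_congr rfl fun j _ => e2 j, ← Finset.mul_sum, ← Complex.re_sum,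
    ← Finset.sum_mul, ← fieldRaw, ← hV]
  apply Complex.ext <;> simp <;> ring

end Pairing

/-! ### The kernels of the Hamiltonians -/

section Kernels

/-- The conjugation pattern of quartic monomials. -/
def cj4 : Fin 4 → Bool := ![false, false, true, true]

/-- The conjugation pattern of sextic monomials. -/
def cj6 : Fin 6 → Bool := ![false, false, false, true, true, true]

lemma mono_cj4 (m : Fin 4 → ℤ) (f : Fin 4 → ℤ → ℂ) :
    mono cj4 m f = f 0 (m 0) * f 1 (m 1) * conj (f 2 (m 2)) * conj (f 3 (m 3)) := by
  rw [mono_apply, Fin.prod_univ_four]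
  rfl

lemma mono_cj6 (m : Fin 6 → ℤ) (f : Fin 6 → ℤ → ℂ) :
    mono cj6 m f = f 0 (m 0) * f 1 (m 1) * f 2 (m 2) * conj (f 3 (m 3)) * conj (f 4 (m 4))
      * conj (f 5 (m 5)) := by
  rw [mono_apply, Fin.prod_univ_six]
  rfl

open Classical in
/-- The kernel of `F₁`. -/
def kF1 (σ : ℝ) (m : Fin 4 → ℤ) : ℂ := if m ∈ nonres4 then σ / (q4 m : ℂ) else 0

open Classical in
/-- The kernel of the nonresonant quartic terms. -/
def kH (m : Fin 4 → ℤ) : ℂ := if m ∈ nonres4 then 1 else 0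

/-- The factor `1 / ((m₂ - m₆)(m₆ - m₃))`. -/
def denom (m : Fin 6 → ℤ) : ℂ := (((m 1 - m 5 : ℤ) : ℂ) * ((m 5 - m 2 : ℤ) : ℂ))⁻¹

open Classical in
/-- The kernel of `F₂`. -/
def kF2 (m : Fin 6 → ℤ) : ℂ := if m ∈ nonres6 then 2 * ((q6 m : ℂ)⁻¹ * denom m) else 0

/-- The indices of the sextic terms, resonant or not. -/
def index6 : Set (Fin 6 → ℤ) :=
  {m | m 0 + m 1 + m 2 - m 3 - m 4 - m 5 = 0 ∧ m 3 ≠ m 0 ∧ m 4 ≠ m 0 ∧ m 1 ≠ m 5 ∧ m 2 ≠ m 5}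

open Classical in
/-- The kernel of the sextic terms. -/
def kZ (m : Fin 6 → ℤ) : ℂ := if m ∈ index6 then denom m else 0

open Classical in
/-- The kernel of the nonresonant sextic terms. -/
def kZnr (m : Fin 6 → ℤ) : ℂ := if m ∈ nonres6 then denom m else 0

open Classical in
/-- The kernel of the resonant sextic terms. -/
def kZr (m : Fin 6 → ℤ) : ℂ := if m ∈ index6 ∧ q6 m = 0 then denom m else 0

open Classical in
/-- The kernel of `∑ |v(n)|⁴`. -/
def kDiag (m : Fin 4 → ℤ) : ℂ := if ∀ i, m i = m 0 then 1 else 0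

lemma kZnr_add_kZr (m : Fin 6 → ℤ) : kZnr m + kZr m = kZ m := by
  unfold kZnr kZr kZ
  have : m ∈ nonres6 ↔ m ∈ index6 ∧ q6 m ≠ 0 := by
    simp only [nonres6, index6, Set.mem_ofPred_eq]
    tauto
  by_cases h1 : m ∈ index6 <;> by_cases h2 : q6 m = 0 <;> simp [h1, h2, this]

lemma q4_eq {m : Fin 4 → ℤ} (h : m ∈ zeroSum4) :
    q4 m = -2 * ((m 2 - m 0) * (m 2 - m 1)) := by
  have h0 : m 0 = m 2 + m 3 - m 1 := by
    have : m 0 + m 1 - m 2 - m 3 = 0 := h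
    linarith
  rw [q4, h0]
  ring

lemma q6_eq {m : Fin 6 → ℤ} (h : m 0 + m 1 + m 2 - m 3 - m 4 - m 5 = 0) :
    q6 m = 2 * ((m 0 - m 4) * (m 0 - m 3) - (m 5 - m 2) * (m 5 - m 1)) := by
  have h0 : m 0 = m 3 + m 4 + m 5 - m 1 - m 2 := by linarith
  rw [q6, h0]
  ring

lemma enorm_inv_le_J (a : ℤ) : ‖((a : ℂ))⁻¹‖ₑ ≤ J a := by
  rcases eq_or_ne a 0 with rfl | ha
  · simp
  · have h1 : 1 ≤ a.natAbs := Nat.one_le_iff_ne_zero.mpr (Int.natAbs_ne_zero.mpr ha)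
    rw [J, max_eq_right h1, enorm_inv (by exact_mod_cast ha)]
    refine le_of_eq ?_
    congr 1
    rw [← ofReal_norm, Complex.norm_intCast, ← Int.cast_abs, ← Nat.cast_natAbs,
      ENNReal.ofReal_natCast]

lemma enorm_denom_le (m : Fin 6 → ℤ) : ‖denom m‖ₑ ≤ J (m 5 - m 2) * J (m 5 - m 1) := by
  rw [denom, mul_inv, enorm_mul, mul_comm, J_sub_comm (m 5) (m 1)]
  gcongr <;> exact enorm_inv_le_J _

lemma enorm_kF1_le {σ : ℝ} (hσ : |σ| = 1) (m : Fin 4 → ℤ) : ‖kF1 σ m‖ₑ ≤ kerQuartic m := by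
  unfold kF1
  split_ifs with h
  · have h0 := h.1
    rw [kerQuartic, if_pos (show m 0 + m 1 - m 2 - m 3 = 0 from h0), q4_eq h0]
    push_cast
    have e : (σ : ℂ) / (-2 * ((m 2 - m 0) * (m 2 - m 1)))
        = (-(σ / 2 : ℝ) : ℂ) * ((((m 2 - m 0 : ℤ) : ℂ))⁻¹ * (((m 2 - m 1 : ℤ) : ℂ))⁻¹) := by
      push_cast
      rw [div_eq_mul_inv, mul_inv, mul_inv]
      ring
    rw [e, enorm_mul, enorm_mul]
    have e1 : ‖(-(σ / 2 : ℝ) : ℂ)‖ₑ ≤ 1 := by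
      rw [enorm_neg, ← ofReal_norm, Complex.norm_real, Real.norm_eq_abs, abs_div, hσ,
        ENNReal.ofReal_le_one]
      norm_num
    calc _ ≤ 1 * (J (m 2 - m 0) * J (m 2 - m 1)) := by
          gcongr <;> exact enorm_inv_le_J _
      _ = _ := one_mul _
  · simp

lemma enorm_kF2_le (m : Fin 6 → ℤ) : ‖kF2 m‖ₑ ≤ kerNonres m := by
  unfold kF2
  split_ifs with h
  · obtain ⟨h0, -, h3, h4, -⟩ := h
    rw [kerNonres, if_pos ⟨h0, h4, h3⟩, q6_eq h0, ← mul_assoc, enorm_mul, mul_comm]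
    gcongr
    · exact enorm_denom_le m
    · have e : (2 : ℂ) * ((2 * ((m 0 - m 4) * (m 0 - m 3) - (m 5 - m 2) * (m 5 - m 1)) : ℤ) : ℂ)⁻¹
          = (((m 0 - m 4) * (m 0 - m 3) - (m 5 - m 2) * (m 5 - m 1) : ℤ) : ℂ)⁻¹ := by
        rw [Int.cast_mul, mul_inv, ← mul_assoc, Int.cast_ofNat, mul_inv_cancel₀ two_ne_zero, one_mul]
      rw [e]
      exact enorm_inv_le_J _
  · simp

lemma enorm_kZ_le (m : Fin 6 → ℤ) : ‖kZ m‖ₑ ≤ kerSextic m := by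
  unfold kZ
  split_ifs with h
  · rw [kerSextic, if_pos h.1]
    exact enorm_denom_le m
  · simp

lemma enorm_kZnr_le (m : Fin 6 → ℤ) : ‖kZnr m‖ₑ ≤ kerSextic m := by
  unfold kZnr
  split_ifs with h
  · rw [kerSextic, if_pos h.1]
    exact enorm_denom_le m
  · simp

/-- On q = 0 the third weight of `kerNonres` is J 0 = 1: restriction to the resonant set saves as
much as division by |q| does elsewhere. -/
lemma enorm_kZr_le (m : Fin 6 → ℤ) : ‖kZr m‖ₑ ≤ kerNonres m := by
  unfold kZr
  split_ifs with h
  · obtain ⟨⟨h0, h3, h4, -⟩, hq⟩ := h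
    rw [q6_eq h0] at hq
    have hq' : (m 0 - m 4) * (m 0 - m 3) - (m 5 - m 2) * (m 5 - m 1) = 0 := by linarith
    have hJ : J 0 = 1 := by simp [J]
    rw [kerNonres, if_pos ⟨h0, h4, h3⟩, hq', hJ, mul_one]
    exact enorm_denom_le m
  · simp

lemma enorm_kDiag (m : Fin 4 → ℤ) : ‖kDiag m‖ₑ = kerDiag m := by
  unfold kDiag kerDiag
  split_ifs <;> simp

lemma kerQuartic_le_one (m : Fin 4 → ℤ) : kerQuartic m ≤ 1 := by
  unfold kerQuartic
  split_ifs
  · exact mul_le_one' (J_le_one _) (J_le_one _)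
  · simp

lemma kerNonres_le_one (m : Fin 6 → ℤ) : kerNonres m ≤ 1 := by
  unfold kerNonres
  split_ifs
  · exact mul_le_one' (mul_le_one' (J_le_one _) (J_le_one _)) (J_le_one _)
  · simp

lemma kerSextic_le_one (m : Fin 6 → ℤ) : kerSextic m ≤ 1 := by
  unfold kerSextic
  split_ifs
  · exact mul_le_one' (J_le_one _) (J_le_one _)
  · simp

lemma enorm_kH_le (m : Fin 4 → ℤ) : ‖kH m‖ₑ ≤ 1 := by
  unfold kH
  split_ifs <;> simp

/-! ### Gradient bounds with weights -/

lemma abs_le_sum_erase {k : ℕ} {s m : Fin k → ℤ} (hs : ∀ i, |s i| = 1) (h : ∑ i, s i * m i = 0)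
    (j : Fin k) : |m j| ≤ ∑ i ∈ Finset.univ.erase j, |m i| := by
  rw [← Finset.add_sum_erase _ _ (Finset.mem_univ j), add_comm, ← eq_neg_iff_add_eq_zero] at h
  have h1 : |m j| = |∑ i ∈ Finset.univ.erase j, s i * m i| := by
    rw [h, abs_neg, abs_mul, hs, one_mul]
  rw [h1]
  refine (Finset.abs_sum_le_sum_abs _ _).trans (le_of_eq (Finset.sum_congr rfl fun i _ => ?_))
  rw [abs_mul, hs, one_mul]

lemma balanced4 {m : Fin 4 → ℤ} (h : m 0 + m 1 - m 2 - m 3 = 0) (j : Fin 4) :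
    |m j| ≤ ∑ i ∈ Finset.univ.erase j, |m i| := by
  refine abs_le_sum_erase (s := ![1, 1, -1, -1]) (fun i => by fin_cases i <;> simp) ?_ j
  simp [Fin.sum_univ_four]
  linarith

lemma balanced6 {m : Fin 6 → ℤ} (h : m 0 + m 1 + m 2 - m 3 - m 4 - m 5 = 0) (j : Fin 6) :
    |m j| ≤ ∑ i ∈ Finset.univ.erase j, |m i| := by
  refine abs_le_sum_erase (s := ![1, 1, 1, -1, -1, -1]) (fun i => by fin_cases i <;> simp) ?_ j
  simp [Fin.sum_univ_six]
  linarith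

variable {δ N : ℝ}

lemma slotBound_kF1 (hδ : 0 ≤ δ) (hN : 1 ≤ N) {σ : ℝ} (hσ : |σ| = 1) :
    SlotBound δ N (kap N ^ 2) fun m => ‖kF1 σ m‖ₑ :=
  ((slotBound_kerQuartic hN).weight hδ fun _ h => balanced4 (kerQuartic_ne h).1).mono
    (enorm_kF1_le hσ) le_rfl

lemma slotBound_wt_kerNonres (hδ : 0 ≤ δ) (hN : 1 ≤ N) :
    SlotBound δ N (10 * ENNReal.ofReal N * kap N ^ 3) kerNonres :=
  (slotBound_kerNonres hN).weight hδ fun _ h => balanced6 (kerNonres_ne h).1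

lemma slotBound_wt_kerSextic (hδ : 0 ≤ δ) (hN : 1 ≤ N) :
    SlotBound δ N (ENNReal.ofReal N ^ 2 * kap N ^ 2) kerSextic :=
  (slotBound_kerSextic hN).weight hδ fun _ h => balanced6 (kerSextic_ne h).1

lemma slotBound_kF2 (hδ : 0 ≤ δ) (hN : 1 ≤ N) :
    SlotBound δ N (10 * ENNReal.ofReal N * kap N ^ 3) fun m => ‖kF2 m‖ₑ :=
  (slotBound_wt_kerNonres hδ hN).mono enorm_kF2_le le_rfl

lemma slotBound_kZr (hδ : 0 ≤ δ) (hN : 1 ≤ N) :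
    SlotBound δ N (10 * ENNReal.ofReal N * kap N ^ 3) fun m => ‖kZr m‖ₑ :=
  (slotBound_wt_kerNonres hδ hN).mono enorm_kZr_le le_rfl

lemma slotBound_kZ (hδ : 0 ≤ δ) (hN : 1 ≤ N) :
    SlotBound δ N (ENNReal.ofReal N ^ 2 * kap N ^ 2) fun m => ‖kZ m‖ₑ :=
  (slotBound_wt_kerSextic hδ hN).mono enorm_kZ_le le_rfl

lemma slotBound_kZnr (hδ : 0 ≤ δ) (hN : 1 ≤ N) :
    SlotBound δ N (ENNReal.ofReal N ^ 2 * kap N ^ 2) fun m => ‖kZnr m‖ₑ :=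
  (slotBound_wt_kerSextic hδ hN).mono enorm_kZnr_le le_rfl

lemma slotBound_kDiag (hδ : 0 ≤ δ) (hN : 1 ≤ N) : SlotBound δ N 1 fun m => ‖kDiag m‖ₑ := by
  simp only [enorm_kDiag]
  refine (slotBound_kerDiag hN).weight hδ fun m h => balanced4 ?_
  have h' : ∀ i, m i = m 0 := by
    by_contra h'
    exact h (if_neg h')
  rw [h' 1, h' 2, h' 3]
  ring

lemma bdd_of_enorm_le_one {k : ℕ} (hδ : 0 ≤ δ) (hN : 1 ≤ N) {c : (Fin k → ℤ) → ℂ}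
    (hc : ∀ m, ‖c m‖ₑ ≤ 1) : Bdd δ N (1 * N.toNNReal ^ k) c :=
  bdd_of_enorm_le hN fun m => by
    rw [ENNReal.coe_one, one_mul]
    exact (hc m).trans (Finset.one_le_prod' fun i _ => one_le_wt hδ (m i))

lemma bdd_mul {k : ℕ} (hδ : 0 ≤ δ) (hN : 1 ≤ N) {c : (Fin k → ℤ) → ℂ} (hc : ∀ m, ‖c m‖ₑ ≤ 1)
    {B : ℝ≥0} {d : ℤ → ℝ} (hd : ∀ n, ‖d n‖ₑ ≤ B * wt δ n) (j : Fin k) :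
    Bdd δ N (B * N.toNNReal ^ k) fun m => c m * d (m j) :=
  bdd_of_enorm_le hN fun m => by
    rw [← Finset.mul_prod_erase _ _ (Finset.mem_univ j), enorm_mul]
    have h1 : ‖(d (m j) : ℂ)‖ₑ ≤ B * wt δ (m j) := by
      rw [← ofReal_norm, Complex.norm_real, ofReal_norm]; exact hd _
    have h2 : (1 : ℝ≥0∞) ≤ ∏ i ∈ Finset.univ.erase j, wt δ (m i) :=
      Finset.one_le_prod' fun i _ => one_le_wt hδ (m i)
    calc ‖c m‖ₑ * ‖(d (m j) : ℂ)‖ₑ ≤ 1 * (B * wt δ (m j)) * 1 := by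
          rw [mul_one]; gcongr; exact hc m
      _ ≤ _ := by rw [one_mul, ← mul_assoc]; gcongr

lemma bdd_kerQuad (hδ : 0 ≤ δ) (hN : 1 ≤ N) {B : ℝ≥0} {d : ℤ → ℝ} (hd : ∀ n, ‖d n‖ₑ ≤ B * wt δ n) :
    Bdd δ N (B * N.toNNReal ^ 2) (kerQuad d) := by
  have h := bdd_mul hδ hN (c := fun m : Fin 2 → ℤ => if m 0 = m 1 then (1 : ℂ) else 0)
    (fun m => by split_ifs <;> simp) hd 0
  convert h using 2 with m
  unfold kerQuad
  split_ifs <;> simp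

/-- From 1 + x + x²/2 ≤ e^x at x = δ|n|. This is where δ > 0 is needed; the constant depends on δ
but is used only through `Bdd`. -/
lemma enorm_sq_le_wt (hδ : 0 < δ) (n : ℤ) :
    ‖((n : ℝ) ^ 2)‖ₑ ≤ (2 / δ ^ 2).toNNReal * wt δ n := by
  rw [wt, ← ENNReal.ofReal, ← ENNReal.ofReal_mul (by positivity), ← ofReal_norm]
  refine ENNReal.ofReal_le_ofReal ?_
  rw [Real.norm_of_nonneg (by positivity), div_mul_eq_mul_div, le_div_iff₀ (by positivity)]
  have h := Real.quadratic_le_exp_of_nonneg (x := δ * |(n : ℝ)|) (by positivity)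
  have h2 : (δ * |(n : ℝ)|) ^ 2 = (n : ℝ) ^ 2 * δ ^ 2 := by rw [mul_pow, sq_abs]; ring
  nlinarith [show 0 ≤ δ * |(n : ℝ)| by positivity]

lemma enorm_one_le_wt (hδ : 0 ≤ δ) (n : ℤ) : ‖(1 : ℝ)‖ₑ ≤ ((1 : ℝ≥0) : ℝ≥0∞) * wt δ n := by
  simpa using one_le_wt hδ n

/-- As many slots are conjugated as not: the source of mass conservation. -/
lemma kF1_mul_sum_one (σ : ℝ) (m : Fin 4 → ℤ) :
    kF1 σ m * ∑ j, sgn (cj4 j) * ((1 : ℝ) : ℂ) = 0 := by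
  simp [Fin.sum_univ_four, cj4, sgn]

lemma kF2_mul_sum_one (m : Fin 6 → ℤ) : kF2 m * ∑ j, sgn (cj6 j) * ((1 : ℝ) : ℂ) = 0 := by
  simp [Fin.sum_univ_six, cj6, sgn]

/-- The homological equation: the frequency sum of a monomial is q, which cancels the divisor of F₁.
-/
lemma kF1_mul_sum_sq (σ : ℝ) (m : Fin 4 → ℤ) :
    kF1 σ m * ∑ j, sgn (cj4 j) * (((m j : ℝ) ^ 2 : ℝ) : ℂ) = σ * kH m := by
  have e : ∑ j, sgn (cj4 j) * (((m j : ℝ) ^ 2 : ℝ) : ℂ) = (q4 m : ℂ) := by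
    simp [Fin.sum_univ_four, cj4, sgn, q4]
    ring
  rw [e, kF1, kH]
  split_ifs with h
  · rw [mul_one, div_mul_cancel₀ _ (by exact_mod_cast h.2)]
  · simp

/-- The homological equation for F₂; the right side is the nonresonant part of the sextic term 2Z
produced by the first transformation. -/
lemma kF2_mul_sum_sq (m : Fin 6 → ℤ) :
    kF2 m * ∑ j, sgn (cj6 j) * (((m j : ℝ) ^ 2 : ℝ) : ℂ) = 2 * kZnr m := by
  have e : ∑ j, sgn (cj6 j) * (((m j : ℝ) ^ 2 : ℝ) : ℂ) = (q6 m : ℂ) := by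
    simp [Fin.sum_univ_six, cj6, sgn, q6]
    ring
  rw [e, kF2, kZnr]
  split_ifs with h
  · have : (q6 m : ℂ) ≠ 0 := by exact_mod_cast h.2.1
    field_simp
  · simp

end Kernels

/-! ### Symmetries, and the derivative of the quartic part along the first flow -/

section Identities

variable {k : ℕ}

lemma form_perm {c c' : (Fin k → ℤ) → ℂ} {cj : Fin k → Bool} (π : Equiv.Perm (Fin k))
    (hc : ∀ m, c (m ∘ π) = c' m) (hcj : ∀ i, cj (π i) = cj i) (f : Fin k → ℤ → ℂ) :
    form c cj (f ∘ π) = form c' cj f := by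
  unfold form
  rw [← (Equiv.arrowCongr π.symm (Equiv.refl ℤ)).tsum_eq]
  refine tsum_congr fun m => ?_
  have e : (Equiv.arrowCongr π.symm (Equiv.refl ℤ)) m = m ∘ π := rfl
  rw [e, hc, mono_apply, mono_apply, ← Equiv.prod_comp π fun i => cjL (cj i) (f i (m i))]
  simp [hcj]

lemma form_perm_conj {c : (Fin k → ℤ) → ℂ} {a : ℂ} {cj : Fin k → Bool} (π : Equiv.Perm (Fin k))
    (hc : ∀ m, c (m ∘ π) = a * conj (c m)) (hcj : ∀ i, cj (π i) = !cj i) (f : Fin k → ℤ → ℂ) :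
    form c cj (f ∘ π) = a * conj (form c cj f) := by
  unfold form
  rw [Complex.conj_tsum, ← tsum_mul_left, ← (Equiv.arrowCongr π.symm (Equiv.refl ℤ)).tsum_eq]
  refine tsum_congr fun m => ?_
  have e : (Equiv.arrowCongr π.symm (Equiv.refl ℤ)) m = m ∘ π := rfl
  rw [e, hc, mono_apply, mono_apply, map_mul, map_prod,
    ← Equiv.prod_comp π fun i => conj (cjL (cj i) (f i (m i))), mul_assoc]
  congr 2
  refine Finset.prod_congr rfl fun i _ => ?_
  simp only [Function.comp_apply, hcj]
  cases cj i <;> simp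

lemma update_const_comp {α β : Type*} [DecidableEq α] (π : Equiv.Perm α) (f h : β) (j : α) :
    Function.update (fun _ => f) (π j) h ∘ π = Function.update (fun _ => f) j h := by
  rw [Function.update_comp_equiv, Equiv.symm_apply_apply]
  rfl

/-- The exchange of the conjugated and the other slots. -/
def rot : Equiv.Perm (Fin 4) := Equiv.swap 0 2 * Equiv.swap 1 3

lemma mem_nonres4_rot (m : Fin 4 → ℤ) : m ∘ rot ∈ nonres4 ↔ m ∈ nonres4 := by
  have h0 : rot 0 = 2 := by decide
  have h1 : rot 1 = 3 := by decide
  have h2 : rot 2 = 0 := by decide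
  have h3 : rot 3 = 1 := by decide
  simp only [nonres4, zeroSum4, q4, Set.mem_ofPred_eq, Function.comp_apply, h0, h1, h2, h3]
  constructor <;> exact fun ⟨a, b⟩ => ⟨by linarith, fun h => b (by linarith)⟩

lemma mem_nonres4_swap01 (m : Fin 4 → ℤ) : m ∘ Equiv.swap 0 1 ∈ nonres4 ↔ m ∈ nonres4 := by
  have h0 : Equiv.swap (0 : Fin 4) 1 0 = 1 := by decide
  have h1 : Equiv.swap (0 : Fin 4) 1 1 = 0 := by decide
  have h2 : Equiv.swap (0 : Fin 4) 1 2 = 2 := by decide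
  have h3 : Equiv.swap (0 : Fin 4) 1 3 = 3 := by decide
  simp only [nonres4, zeroSum4, q4, Set.mem_ofPred_eq, Function.comp_apply, h0, h1, h2, h3]
  constructor <;> exact fun ⟨a, b⟩ => ⟨by linarith, fun h => b (by linarith)⟩

lemma mem_nonres4_swap23 (m : Fin 4 → ℤ) : m ∘ Equiv.swap 2 3 ∈ nonres4 ↔ m ∈ nonres4 := by
  have h0 : Equiv.swap (2 : Fin 4) 3 0 = 0 := by decide
  have h1 : Equiv.swap (2 : Fin 4) 3 1 = 1 := by decide
  have h2 : Equiv.swap (2 : Fin 4) 3 2 = 3 := by decide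
  have h3 : Equiv.swap (2 : Fin 4) 3 3 = 2 := by decide
  simp only [nonres4, zeroSum4, q4, Set.mem_ofPred_eq, Function.comp_apply, h0, h1, h2, h3]
  constructor <;> exact fun ⟨a, b⟩ => ⟨by linarith, fun h => b (by linarith)⟩

lemma q4_rot (m : Fin 4 → ℤ) : q4 (m ∘ rot) = -q4 m := by
  have h0 : rot 0 = 2 := by decide
  have h1 : rot 1 = 3 := by decide
  have h2 : rot 2 = 0 := by decide
  have h3 : rot 3 = 1 := by decide
  simp only [q4, Function.comp_apply, h0, h1, h2, h3]
  ring

lemma q4_swap23 (m : Fin 4 → ℤ) : q4 (m ∘ Equiv.swap 2 3) = q4 m := by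
  have h0 : Equiv.swap (2 : Fin 4) 3 0 = 0 := by decide
  have h1 : Equiv.swap (2 : Fin 4) 3 1 = 1 := by decide
  have h2 : Equiv.swap (2 : Fin 4) 3 2 = 3 := by decide
  have h3 : Equiv.swap (2 : Fin 4) 3 3 = 2 := by decide
  simp only [q4, Function.comp_apply, h0, h1, h2, h3]
  ring

lemma cj4_rot (i : Fin 4) : cj4 (rot i) = !cj4 i := by
  revert i; decide

lemma cj4_swap01 (i : Fin 4) : cj4 (Equiv.swap 0 1 i) = cj4 i := by
  revert i; decide

lemma cj4_swap23 (i : Fin 4) : cj4 (Equiv.swap 2 3 i) = cj4 i := by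
  revert i; decide

lemma kH_rot (m : Fin 4 → ℤ) : kH (m ∘ rot) = 1 * conj (kH m) := by
  unfold kH
  by_cases h : m ∈ nonres4
  · rw [if_pos h, if_pos ((mem_nonres4_rot m).mpr h)]
    simp
  · rw [if_neg h, if_neg (mt (mem_nonres4_rot m).mp h)]
    simp

lemma kH_swap01 (m : Fin 4 → ℤ) : kH (m ∘ Equiv.swap 0 1) = kH m := by
  unfold kH
  by_cases h : m ∈ nonres4
  · rw [if_pos h, if_pos ((mem_nonres4_swap01 m).mpr h)]
  · rw [if_neg h, if_neg (mt (mem_nonres4_swap01 m).mp h)]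

lemma kF1_rot (σ : ℝ) (m : Fin 4 → ℤ) : kF1 σ (m ∘ rot) = (-1) * conj (kF1 σ m) := by
  unfold kF1
  by_cases h : m ∈ nonres4
  · rw [if_pos h, if_pos ((mem_nonres4_rot m).mpr h), q4_rot]
    simp [div_neg]
  · rw [if_neg h, if_neg (mt (mem_nonres4_rot m).mp h)]
    simp

lemma kF1_swap23 (σ : ℝ) (m : Fin 4 → ℤ) : kF1 σ (m ∘ Equiv.swap 2 3) = kF1 σ m := by
  unfold kF1
  by_cases h : m ∈ nonres4
  · rw [if_pos h, if_pos ((mem_nonres4_swap23 m).mpr h), q4_swap23]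
  · rw [if_neg h, if_neg (mt (mem_nonres4_swap23 m).mp h)]

lemma kDiag_rot (m : Fin 4 → ℤ) : kDiag (m ∘ rot) = 1 * conj (kDiag m) := by
  have : (∀ i, (m ∘ rot) i = (m ∘ rot) 0) ↔ ∀ i, m i = m 0 := by
    constructor
    · intro h i
      have h1 := h (rot.symm i)
      have h2 := h (rot.symm 0)
      simp only [Function.comp_apply, Equiv.apply_symm_apply] at h1 h2
      rw [h1, h2]
    · intro h i
      rw [Function.comp_apply, h, Function.comp_apply, h (rot 0)]
  simp only [kDiag, this]
  split_ifs <;> simp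

lemma form_diag_im_eq_zero {c : (Fin 4 → ℤ) → ℂ} (hc : ∀ m, c (m ∘ rot) = 1 * conj (c m))
    (f : ℤ → ℂ) : (form c cj4 fun _ => f).im = 0 := by
  have h := form_perm_conj rot hc cj4_rot fun _ => f
  rw [one_mul] at h
  exact Complex.conj_eq_iff_im.mp h.symm

/-- Exchanging the conjugated pair with the other one changes the sign of q, so the form is purely
imaginary and i Im does not alter it. -/
lemma genF1_eq (σ : ℝ) (v : ℤ → ℂ) : genF1 σ v = imL (form (kF1 σ) cj4 fun _ => v) := by
  have e : genF1 σ v = form (kF1 σ) cj4 fun _ => v := by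
    rw [genF1, form, ← tsum_mul_left, tsum_subtype nonres4 fun m => σ * (monomial4 v m / (q4 m : ℂ))]
    refine tsum_congr fun m => ?_
    simp only [mono_cj4, monomial4]
    rw [kF1]
    by_cases h : m ∈ nonres4
    · rw [Set.indicator_of_mem h, if_pos h]; ring
    · rw [Set.indicator_of_notMem h, if_neg h]; ring
  rw [e]
  have h : form (kF1 σ) cj4 (fun _ => v) = _ :=
    form_perm_conj rot (kF1_rot σ) cj4_rot fun _ => v
  have h1 := congrArg Complex.re h
  simp only [neg_mul, one_mul, Complex.neg_re, Complex.conj_re] at h1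
  apply Complex.ext
  · simp only [imL_apply, Complex.re_ofReal_mul, Complex.I_re, mul_zero]
    linarith
  · simp

/-- Z - Z̄ = i Im(2Z), which explains the factor 2 in `kF2`. -/
lemma genF2_eq (v : ℤ → ℂ) : genF2 v = imL (form kF2 cj6 fun _ => v) := by
  have e : form kF2 cj6 (fun _ => v) = 2 * halfF2 v := by
    rw [halfF2, form, ← tsum_mul_left, tsum_subtype nonres6 fun m => 2 * (monomial6 v m /
      ((q6 m : ℂ) * ((m 1 - m 5 : ℤ) : ℂ) * ((m 5 - m 2 : ℤ) : ℂ)))]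
    refine tsum_congr fun m => ?_
    simp only [mono_cj6, monomial6]
    rw [kF2, denom]
    by_cases h : m ∈ nonres6
    · rw [Set.indicator_of_mem h, if_pos h, div_eq_mul_inv, mul_inv, mul_inv, mul_inv]
      ring
    · rw [Set.indicator_of_notMem h, if_neg h]
      ring
  rw [e, genF2]
  apply Complex.ext
  · simp
  · simp
    ring

/-- The two index quadruples which are joined in a sextic monomial. -/
def joinIndex (M : Fin 6 → ℤ) : (Fin 4 → ℤ) × (Fin 4 → ℤ) :=
  (![M 1 + M 2 - M 5, M 0, M 3, M 4], ![M 1, M 2, M 5, M 1 + M 2 - M 5])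

lemma joinIndex_injective : Function.Injective joinIndex := by
  intro M M' h
  have h1 := congrArg Prod.fst h
  have h2 := congrArg Prod.snd h
  exact fin6_ext (congrFun h1 1) (congrFun h2 0) (congrFun h2 1) (congrFun h1 2) (congrFun h1 3)
    (congrFun h2 2)

lemma q4_joinIndex_fst {M : Fin 6 → ℤ} (h : M 0 + M 1 + M 2 - M 3 - M 4 - M 5 = 0) :
    q4 (joinIndex M).1 = -2 * ((M 0 - M 4) * (M 3 - M 0)) := by
  have h5 : M 5 = M 0 + M 1 + M 2 - M 3 - M 4 := by linarith
  simp [joinIndex, q4, h5]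
  ring

lemma q4_joinIndex_snd (M : Fin 6 → ℤ) :
    q4 (joinIndex M).2 = 2 * ((M 1 - M 5) * (M 5 - M 2)) := by
  simp [joinIndex, q4]
  ring

/-- The four inequalities in the index set of F₂ say exactly that neither of the two factorised
functions q of the joined quadruples vanishes. -/
lemma mem_joinIndex (M : Fin 6 → ℤ) :
    ((joinIndex M).1 ∈ nonres4 ∧ (joinIndex M).2 ∈ nonres4) ↔ M ∈ index6 := by
  have e1 : (joinIndex M).1 ∈ zeroSum4 ↔ M 0 + M 1 + M 2 - M 3 - M 4 - M 5 = 0 := by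
    simp only [joinIndex, zeroSum4, Set.mem_ofPred_eq, Matrix.cons_val]
    constructor <;> intro h <;> linarith
  have e2 : (joinIndex M).2 ∈ zeroSum4 := by
    simp only [joinIndex, zeroSum4, Set.mem_ofPred_eq, Matrix.cons_val]
    ring
  constructor
  · rintro ⟨⟨h1, h2⟩, -, h4⟩
    have h1' := e1.mp h1
    rw [q4_joinIndex_fst h1'] at h2
    rw [q4_joinIndex_snd] at h4
    refine ⟨h1', ?_, ?_, ?_, ?_⟩
    · intro h; exact h2 (by rw [h]; ring)
    · intro h; exact h2 (by rw [h]; ring)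
    · intro h; exact h4 (by rw [h]; ring)
    · intro h; exact h4 (by rw [h]; ring)
  · rintro ⟨h1, h2, h3, h4, h5⟩
    refine ⟨⟨e1.mpr h1, ?_⟩, e2, ?_⟩
    · rw [q4_joinIndex_fst h1]
      exact mul_ne_zero (by norm_num) (mul_ne_zero (sub_ne_zero.mpr h3.symm) (sub_ne_zero.mpr h2))
    · rw [q4_joinIndex_snd]
      exact mul_ne_zero (by norm_num) (mul_ne_zero (sub_ne_zero.mpr h4) (sub_ne_zero.mpr h5.symm))

lemma kH_mul_kF1_joinIndex (σ : ℝ) (M : Fin 6 → ℤ) :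
    kH (joinIndex M).1 * (2 * kF1 σ (joinIndex M).2) = σ * kZ M := by
  by_cases hM : M ∈ index6
  · have h := (mem_joinIndex M).mpr hM
    rw [kH, if_pos h.1, kF1, if_pos h.2, kZ, if_pos hM, q4_joinIndex_snd, denom, Int.cast_mul,
      Int.cast_mul, div_eq_mul_inv, mul_inv, Int.cast_ofNat]
    ring
  · rw [kZ, if_neg hM]
    by_cases h1 : (joinIndex M).1 ∈ nonres4
    · have h2 : (joinIndex M).2 ∉ nonres4 := fun h2 => hM ((mem_joinIndex M).mp ⟨h1, h2⟩)
      rw [kF1, if_neg h2]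
      ring
    · rw [kH, if_neg h1]
      ring

variable {δ N : ℝ} [hN : Fact (1 ≤ N)]

/-- Slots 2 and 3 agree by symmetry, and the antisymmetry under `rot` makes the contributions of
slots 0 and 1 agree with them: four equal halves. -/
lemma fieldRaw_kF1 (σ : ℝ) (f : ℤ → ℂ) (n : ℤ) :
    fieldRaw imL (kF1 σ) cj4 f n = 2 * slot (kF1 σ) cj4 f 3 n := by
  have h2 : slot (kF1 σ) cj4 f 2 n = slot (kF1 σ) cj4 f 3 n := by
    have := form_perm (Equiv.swap 2 3) (kF1_swap23 σ) cj4_swap23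
      (Function.update (fun _ => f) (Equiv.swap 2 3 2) (Pi.single n 1))
    rwa [update_const_comp, show Equiv.swap (2 : Fin 4) 3 2 = 3 by decide] at this
  have h0 : slot (kF1 σ) cj4 f 0 n = (-1) * conj (slot (kF1 σ) cj4 f 2 n) := by
    have := form_perm_conj rot (kF1_rot σ) cj4_rot
      (Function.update (fun _ => f) (rot 0) (Pi.single n 1))
    rwa [update_const_comp] at this
  have h1 : slot (kF1 σ) cj4 f 1 n = (-1) * conj (slot (kF1 σ) cj4 f 3 n) := by
    have := form_perm_conj rot (kF1_rot σ) cj4_rot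
      (Function.update (fun _ => f) (rot 1) (Pi.single n 1))
    rwa [update_const_comp] at this
  rw [fieldRaw, Fin.sum_univ_four]
  simp only [gradRaw_imL]
  rw [h0, h1, h2]
  simp [cj4]
  ring

lemma brk_kH_eq (f V : ℤ → ℂ) :
    brk kH cj4 f V = 4 * ((form kH cj4 (Function.update (fun _ => f) 0 V)).re : ℂ) := by
  have h1 : form kH cj4 (Function.update (fun _ => f) 1 V)
      = form kH cj4 (Function.update (fun _ => f) 0 V) := by
    have := form_perm (Equiv.swap 0 1) kH_swap01 cj4_swap01
      (Function.update (fun _ => f) (Equiv.swap 0 1 1) V)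
    rwa [update_const_comp, show Equiv.swap (0 : Fin 4) 1 1 = 0 by decide] at this
  have h2 : form kH cj4 (Function.update (fun _ => f) 2 V)
      = conj (form kH cj4 (Function.update (fun _ => f) 0 V)) := by
    have := form_perm_conj rot kH_rot cj4_rot (Function.update (fun _ => f) (rot 2) V)
    rwa [update_const_comp, one_mul, show rot 2 = 0 by decide] at this
  have h3 : form kH cj4 (Function.update (fun _ => f) 3 V)
      = conj (form kH cj4 (Function.update (fun _ => f) 1 V)) := by
    have := form_perm_conj rot kH_rot cj4_rot (Function.update (fun _ => f) (rot 3) V)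
    rwa [update_const_comp, one_mul, show rot 3 = 1 by decide] at this
  rw [brk, Fin.sum_univ_four, h3, h2, h1]
  apply Complex.ext <;> simp
  ring

/-- Inserting the cubic field into slot 0 gives a sum over pairs of quadruples in which the last
index of the second equals the first index of the first. The pairs that contribute lie in the range
of the injection `joinIndex`. Absolute convergence permits the passage from the sum over sextuples
to an iterated sum. -/
lemma form_kH_update {M₁ M₂ : ℝ≥0} {σ : ℝ} (hF : Bdd δ N M₁ (kF1 σ)) (hZ : Bdd δ N M₂ kZ)
    (u : X δ N) : form kH cj4 (Function.update (fun _ => ev u) 0 (fieldRaw imL (kF1 σ) cj4 (ev u)))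
      = σ * form kZ cj6 fun _ => ev u := by
  set f := ev u with hf
  let A : (Fin 4 → ℤ) → ℂ := fun m => kH m * (f (m 1) * conj (f (m 2)) * conj (f (m 3)))
  let G : (Fin 4 → ℤ) × (Fin 4 → ℤ) → ℂ := fun p => A p.1 * (2 * (kF1 σ p.2 *
    mono cj4 p.2 (Function.update (fun _ => f) 3 (Pi.single (p.1 0) 1))))
  have hG : ∀ M, G (joinIndex M) = σ * (kZ M * mono cj6 M fun _ => f) := by
    intro M
    simp only [G, A, mono_cj4, mono_cj6]
    rw [← mul_assoc (σ : ℂ), ← kH_mul_kF1_joinIndex]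
    generalize kH (joinIndex M).1 = x
    generalize kF1 σ (joinIndex M).2 = y
    simp [joinIndex]
    ring
  have hsupp : ∀ p ∉ Set.range joinIndex, G p = 0 := by
    rintro ⟨m, m'⟩ hp
    by_contra h0
    apply hp
    have hm : m ∈ nonres4 := by
      by_contra h
      exact h0 (by simp [G, A, kH, h])
    have hm' : m' ∈ nonres4 := by
      by_contra h
      exact h0 (by simp [G, kF1, h])
    have h3 : m' 3 = m 0 := by
      by_contra h
      refine h0 ?_
      simp only [G, mono_cj4]
      simp [h]
    have h4 : m' 0 + m' 1 - m' 2 - m' 3 = 0 := hm'.1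
    refine ⟨![m 1, m' 0, m' 1, m 2, m 3, m' 2], Prod.ext (fin4_ext ?_ rfl rfl rfl)
      (fin4_ext rfl rfl rfl ?_)⟩
    · change m' 0 + m' 1 - m' 2 = m 0
      linarith
    · change m' 0 + m' 1 - m' 2 = m' 3
      linarith
  have h1 : HasSum G (σ * form kZ cj6 fun _ => f) := by
    rw [← joinIndex_injective.hasSum_iff hsupp]
    have := ((hZ.summable cj6 u).hasSum).mul_left (σ : ℂ)
    have e : G ∘ joinIndex = fun M => σ * (kZ M * mono cj6 M fun _ => f) := funext hG
    rw [e]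
    exact this
  have h2 : HasSum (fun m => A m * (2 * slot (kF1 σ) cj4 f 3 (m 0)))
      (σ * form kZ cj6 fun _ => f) := by
    refine h1.prod_fiberwise fun m => ?_
    have hs := summable_form (cj := cj4) (hF.ne_top (Function.update (fun _ => u) 3 (sg (m 0) 1)))
    rw [update_ev_comp, ev_sg] at hs
    exact (hs.hasSum.mul_left 2).mul_left (A m)
  rw [← h2.tsum_eq, form]
  refine tsum_congr fun m => ?_
  rw [mono_cj4]
  simp [A, fieldRaw_kF1]
  ring

/-- The derivative of the nonresonant quartic part along the flow of `F₁`. -/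
lemma brk_kH_fieldRaw {M₁ M₂ : ℝ≥0} {σ : ℝ} (hF : Bdd δ N M₁ (kF1 σ)) (hZ : Bdd δ N M₂ kZ)
    (u : X δ N) : brk kH cj4 (ev u) (fieldRaw imL (kF1 σ) cj4 (ev u))
      = ((4 * σ * (form kZ cj6 fun _ => ev u).re : ℝ) : ℂ) := by
  rw [brk_kH_eq, form_kH_update hF hZ, Complex.re_ofReal_mul]
  push_cast
  ring

end Identities

/-! ### The Hamiltonian in terms of forms -/

section Splitting

/-- The kernel of `(∑ |v(n)|²)²`. -/
def kMass (m : Fin 4 → ℤ) : ℂ := if m 2 = m 0 ∧ m 3 = m 1 then 1 else 0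

/-- The kernel of `(∑ |v(n)|²)²`, with the conjugated slots exchanged. -/
def kMass' (m : Fin 4 → ℤ) : ℂ := if m 2 = m 1 ∧ m 3 = m 0 then 1 else 0

-- With l = 0, the condition q = 0 means that the conjugated indices match the others in one of two
-- ways; both matchings hold exactly on the diagonal, so inclusion–exclusion applies.
open Classical in
lemma indicator_zeroSum4 (m : Fin 4 → ℤ) :
    (if m ∈ zeroSum4 then (1 : ℂ) else 0) = kH m + kMass m + kMass' m - kDiag m := by
  have hd : (∀ i, m i = m 0) ↔ m 1 = m 0 ∧ m 2 = m 0 ∧ m 3 = m 0 := by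
    simp [Fin.forall_fin_succ]
  unfold kH kMass kMass' kDiag
  simp only [hd]
  by_cases h : m ∈ zeroSum4
  · have hl : m 0 + m 1 - m 2 - m 3 = 0 := h
    have hn : m ∈ nonres4 ↔ m 2 ≠ m 0 ∧ m 2 ≠ m 1 := by
      have e : m ∈ nonres4 ↔ q4 m ≠ 0 := and_iff_right h
      rw [e, q4_eq h, mul_ne_zero_iff, mul_ne_zero_iff, sub_ne_zero, sub_ne_zero]
      simp
    rw [if_pos h]
    by_cases h0 : m 2 = m 0 <;> by_cases h1 : m 2 = m 1
    · have h3 : m 3 = m 0 := by linarith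
      have h4 : m 1 = m 0 := by linarith
      simp [hn, h0, h3, h4]
    · have h3 : m 3 = m 1 := by linarith
      have h4 : m 1 ≠ m 0 := fun h4 => h1 (by linarith)
      have h5 : m 0 ≠ m 1 := h4.symm
      simp [hn, h0, h3, h4, h5]
    · have h3 : m 3 = m 0 := by linarith
      have h4 : m 1 ≠ m 0 := fun h4 => h0 (by linarith)
      simp [hn, h1, h3, h4]
    · simp [hn, h0, h1]
  · have hl : m 0 + m 1 - m 2 - m 3 ≠ 0 := h
    have hn : m ∉ nonres4 := fun h' => h h'.1
    rw [if_neg h, if_neg hn, if_neg, if_neg, if_neg]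
    · simp
    · rintro ⟨h1, h2, h3⟩
      exact hl (by rw [h1, h2, h3]; ring)
    · rintro ⟨h1, h2⟩
      exact hl (by rw [h1, h2]; ring)
    · rintro ⟨h1, h2⟩
      exact hl (by rw [h1, h2]; ring)

lemma enorm_kMass_le (m : Fin 4 → ℤ) : ‖kMass m‖ₑ ≤ 1 := by
  unfold kMass
  split_ifs <;> simp

lemma enorm_kMass'_le (m : Fin 4 → ℤ) : ‖kMass' m‖ₑ ≤ 1 := by
  unfold kMass'
  split_ifs <;> simp

lemma enorm_kDiag_le (m : Fin 4 → ℤ) : ‖kDiag m‖ₑ ≤ 1 := by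
  unfold kDiag
  split_ifs <;> simp

lemma form_kMass' (f : ℤ → ℂ) : form kMass' cj4 (fun _ => f) = form kMass cj4 fun _ => f := by
  refine form_perm (Equiv.swap 2 3) (fun m => ?_) cj4_swap23 fun _ => f
  have h0 : Equiv.swap (2 : Fin 4) 3 0 = 0 := by decide
  have h1 : Equiv.swap (2 : Fin 4) 3 1 = 1 := by decide
  simp only [kMass, kMass', Function.comp_apply, h0, h1, Equiv.swap_apply_left,
    Equiv.swap_apply_right, and_comm]

variable {δ N : ℝ} [hN : Fact (1 ≤ N)]

lemma form_kMass (hδ : 0 ≤ δ) (u : X δ N) :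
    form kMass cj4 (fun _ => ev u) = (mass (ev u) : ℂ) ^ 2 := by
  set f := ev u with hf
  let ι : ℤ × ℤ → Fin 4 → ℤ := fun p => ![p.1, p.2, p.1, p.2]
  have hι : Function.Injective ι := fun p q h => Prod.ext (congrFun h 0) (congrFun h 1)
  have hs := (bdd_of_enorm_le_one hδ hN.out enorm_kMass_le).summable cj4 u
  have hsupp : ∀ m ∉ Set.range ι, (kMass m * mono cj4 m fun _ => f) = 0 := by
    intro m hm
    have : ¬(m 2 = m 0 ∧ m 3 = m 1) := fun h =>
      hm ⟨(m 0, m 1), fin4_ext rfl rfl h.1.symm h.2.symm⟩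
    rw [kMass, if_neg this, zero_mul]
  have e : (fun m => kMass m * mono cj4 m fun _ => f) ∘ ι
      = fun p : ℤ × ℤ => ((‖f p.1‖ ^ 2 : ℝ) : ℂ) * ((‖f p.2‖ ^ 2 : ℝ) : ℂ) := by
    funext p
    simp only [Function.comp_apply, mono_cj4, kMass, ι, Matrix.cons_val, and_self, if_true]
    rw [← Complex.normSq_eq_norm_sq, ← Complex.normSq_eq_norm_sq, ← Complex.mul_conj,
      ← Complex.mul_conj]
    ring
  have hs' : Summable ((fun m => kMass m * mono cj4 m fun _ => f) ∘ ι) :=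
    (hι.summable_iff hsupp).mpr hs
  rw [e] at hs'
  have h1 : HasSum (fun n => ((‖f n‖ ^ 2 : ℝ) : ℂ)) (mass f : ℂ) := by
    have h := hasSum_quad (bdd_kerQuad hδ hN.out (enorm_one_le_wt hδ)) u
    simp only [one_mul] at h
    rw [Complex.hasSum_ofReal, mass]
    exact h.summable.hasSum
  have h2 := h1.mul h1 hs'
  rw [← e, hι.hasSum_iff hsupp] at h2
  rw [form, h2.tsum_eq, sq]

lemma quadPart_eq (hδ : 0 < δ) (u : X δ N) : quadPart (ev u)
    = Complex.I * (((form (kerQuad fun n => (n : ℝ) ^ 2) cj2 fun _ => ev u).re : ℝ) : ℂ) := by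
  rw [quadPart, (hasSum_quad (bdd_kerQuad hδ.le hN.out (enorm_sq_le_wt hδ)) u).tsum_eq]

lemma mass_eq (hδ : 0 ≤ δ) (u : X δ N) :
    mass (ev u) = (form (kerQuad fun _ => 1) cj2 fun _ => ev u).re := by
  have h := hasSum_quad (bdd_kerQuad hδ hN.out (enorm_one_le_wt hδ)) u
  rw [← h.tsum_eq, mass]
  simp only [one_mul]

lemma quarticPart_eq (hδ : 0 ≤ δ) (σ : ℝ) (u : X δ N) : quarticPart σ (ev u)
    = Complex.I * ((σ * ((form kH cj4 fun _ => ev u).re + 2 * mass (ev u) ^ 2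
        - (form kDiag cj4 fun _ => ev u).re) : ℝ) : ℂ) := by
  classical
  have hre : ∀ {c : (Fin 4 → ℤ) → ℂ}, (∀ m, c (m ∘ rot) = 1 * conj (c m)) →
      form c cj4 (fun _ => ev u) = ((form c cj4 fun _ => ev u).re : ℂ) := fun hc =>
    Complex.ext rfl (by simpa using form_diag_im_eq_zero hc (ev u))
  have s1 := (bdd_of_enorm_le_one hδ hN.out enorm_kH_le).summable cj4 u
  have s2 := (bdd_of_enorm_le_one hδ hN.out enorm_kMass_le).summable cj4 u
  have s3 := (bdd_of_enorm_le_one hδ hN.out enorm_kMass'_le).summable cj4 u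
  have s4 := (bdd_of_enorm_le_one hδ hN.out enorm_kDiag_le).summable cj4 u
  have e : ∑' m : zeroSum4, monomial4 (ev u) m = form kH cj4 (fun _ => ev u)
      + form kMass cj4 (fun _ => ev u) + form kMass' cj4 (fun _ => ev u)
      - form kDiag cj4 (fun _ => ev u) := by
    unfold form
    rw [tsum_subtype zeroSum4 (monomial4 (ev u)), ← s1.tsum_add s2, ← (s1.add s2).tsum_add s3,
      ← ((s1.add s2).add s3).tsum_sub s4]
    refine tsum_congr fun m => ?_
    rw [← add_mul, ← add_mul, ← sub_mul, ← indicator_zeroSum4, mono_cj4, ← monomial4,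
      Set.indicator_apply]
    split_ifs <;> simp
  rw [quarticPart, e, form_kMass', form_kMass hδ, hre kH_rot, hre kDiag_rot]
  push_cast
  simp only [Complex.ofReal_re]
  ring

/-- The derivative of a form along a curve. -/
lemma Bdd.hasDerivWithinAt_form {k : ℕ} {M : ℝ≥0} {c : (Fin k → ℤ) → ℂ} (h : Bdd δ N M c)
    (cj : Fin k → Bool) {w : ℝ → X δ N} {V : X δ N} {I : Set ℝ} {s : ℝ}
    (hw : HasDerivWithinAt w V I s) :
    HasDerivWithinAt (fun t => (form c cj fun _ => ev (w t)).re)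
      (brk c cj (ev (w s)) (ev V)).re I s := by
  have h1 := Complex.reCLM.hasFDerivAt.comp_hasDerivWithinAt s
    ((hasFDerivAt_diag (formL h cj) (w s)).comp_hasDerivWithinAt s hw)
  rw [linearDeriv_diag_apply] at h1
  simp only [formL_apply, update_ev_comp] at h1
  exact h1

lemma Bdd.differentiable_form {k : ℕ} {M : ℝ≥0} {c : (Fin k → ℤ) → ℂ} (h : Bdd δ N M c)
    (cj : Fin k → Bool) : Differentiable ℝ fun u : X δ N => (form c cj fun _ => ev u).re :=
  fun u => Complex.reCLM.differentiableAt.comp u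
    (hasFDerivAt_diag (formL h cj) u).differentiableAt

end Splitting

/-! ### Estimates along the two flows -/

section Dynamics

lemma enorm_sub_le_of_hasDerivWithinAt {f f' : ℝ → ℝ} {B : ℝ≥0∞}
    (hf : ∀ s ∈ Set.Icc (0 : ℝ) 1, HasDerivWithinAt f (f' s) (Set.Icc 0 1) s)
    (hB : ∀ s ∈ Set.Icc (0 : ℝ) 1, ‖f' s‖ₑ ≤ B) : ‖f 1 - f 0‖ₑ ≤ B := by
  rcases eq_or_ne B ∞ with rfl | hB'
  · exact le_top
  have h := norm_image_sub_le_of_norm_deriv_le_segment_01' (C := B.toReal) hf fun s hs => by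
    have := hB s (Set.Ico_subset_Icc_self hs)
    rwa [← ofReal_norm, ENNReal.ofReal_le_iff_le_toReal hB'] at this
  rwa [← ofReal_norm, ENNReal.ofReal_le_iff_le_toReal hB']

variable {δ N : ℝ} [hN : Fact (1 ≤ N)] {k l : ℕ}

/-- `w` is an integral curve on `[0, 1]` of the vector field `u ↦ T(u, …, u)`. -/
def IsCurve (T : ContinuousMultilinearMap ℝ (fun _ : Fin k => X δ N) (X δ N))
    (w : ℝ → X δ N) : Prop :=
  ∀ s ∈ Set.Icc (0 : ℝ) 1, HasDerivWithinAt w (T fun _ => w s) (Set.Icc 0 1) s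

/-- All points of the curve have norm at most `r`. -/
def StaysIn (r : ℝ≥0∞) (w : ℝ → X δ N) : Prop :=
  ∀ s ∈ Set.Icc (0 : ℝ) 1, nB δ N (fun n => ‖ev (w s) n‖ₑ) ≤ r

/-- The Lipschitz constant on a ball of the vector field of a Hamiltonian of degree `k + 1`. -/
def lipConst (k : ℕ) (β r : ℝ≥0∞) : ℝ≥0∞ := (k + 1) * (k * (β * (2 * r) ^ (k - 1)))

variable {M M' β : ℝ≥0} {β' : ℝ≥0∞} {c : (Fin (k + 1) → ℤ) → ℂ} {c' : (Fin (l + 1) → ℤ) → ℂ}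
  {cj : Fin (k + 1) → Bool} {r : ℝ≥0∞}

lemma nD_fieldL_sub_le (hM : Bdd δ N M c) (hS : SlotBound δ N β fun m => ‖c m‖ₑ) (hr : r ≠ ∞)
    {u u' : X δ N} (hu : nB δ N (fun n => ‖ev u n‖ₑ) ≤ r) (hu' : nB δ N (fun n => ‖ev u' n‖ₑ) ≤ r) :
    nD δ N (fun n => ‖ev (fieldL hM hS imL cj fun _ => u) n
        - ev (fieldL hM hS imL cj fun _ => u') n‖ₑ)
      ≤ lipConst k β r * nD δ N (fun n => ‖ev u n - ev u' n‖ₑ) := by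
  rw [ev_fieldL, ev_fieldL]
  refine (hS.nD_fieldRaw_sub_le hN.out hM imL cj hr hu hu').trans ?_
  unfold lipConst
  refine mul_le_mul_left (mul_le_mul_right ?_ _) _
  exact (mul_le_mul_left enorm_imL_le _).trans (one_mul _).le

/-- The difference of two integral curves satisfies the hypothesis of `nD_ev_le_two_mul`, because
the field has Lipschitz constant at most 1/2 for the dual norm. -/
lemma IsCurve.nD_sub_le (hδ : 0 ≤ δ) {hM : Bdd δ N M c} {hS : SlotBound δ N β fun m => ‖c m‖ₑ}
    (hr : r ≠ ∞) (hsm : lipConst k β r ≤ 1 / 2) {w w' : ℝ → X δ N}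
    (hw : IsCurve (fieldL hM hS imL cj) w) (hw' : IsCurve (fieldL hM hS imL cj) w')
    (h : StaysIn r w) (h' : StaysIn r w') {s : ℝ} (hs : s ∈ Set.Icc (0 : ℝ) 1) :
    nD δ N (fun n => ‖ev (w s) n - ev (w' s) n‖ₑ)
      ≤ 2 * nD δ N (fun n => ‖ev (w 0) n - ev (w' 0) n‖ₑ) := by
  have hTc : Continuous fun u : X δ N => fieldL hM hS imL cj fun _ => u :=
    (fieldL hM hS imL cj).cont.comp (by fun_prop)
  have hc : ∀ {w}, IsCurve (fieldL hM hS imL cj) w →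
      ContinuousOn (fun s => fieldL hM hS imL cj fun _ => w s) (Set.Icc 0 1) := fun hw =>
    hTc.comp_continuousOn fun s hs => (hw s hs).continuousWithinAt
  have := nD_ev_le_two_mul hδ (z := w - w') (fun s hs => (hw s hs).sub (hw' s hs))
    ((hc hw).sub (hc hw')) (fun s hs => ?_) hs
  · simpa only [Pi.sub_apply, map_sub] using this
  · simp only [Pi.sub_apply, map_sub]
    refine (nD_fieldL_sub_le hM hS hr (h s hs) (h' s hs)).trans ?_
    gcongr

lemma brk_fieldL_sub_le (hk : k ≠ 0) (hM : Bdd δ N M c) (hS : SlotBound δ N β fun m => ‖c m‖ₑ)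
    (hM' : Bdd δ N M' c') (hS' : SlotBound δ N β' fun m => ‖c' m‖ₑ) (cj' : Fin (l + 1) → Bool)
    (hr : r ≠ ∞) {u u' : X δ N} (hu : nB δ N (fun n => ‖ev u n‖ₑ) ≤ r)
    (hu' : nB δ N (fun n => ‖ev u' n‖ₑ) ≤ r) :
    ‖brk c' cj' (ev u) (ev (fieldL hM hS imL cj fun _ => u))
        - brk c' cj' (ev u') (ev (fieldL hM hS imL cj fun _ => u'))‖ₑ
      ≤ (l + 1) * ((l + 1) * (β' * (lipConst k β r * (2 * r) ^ l)))
        * nD δ N (fun n => ‖ev u n - ev u' n‖ₑ) := by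
  -- The Lipschitz constant times r also dominates the size of the field, since k ≥ 1; so it can
  -- play the role of θ in `SlotBound.brk_sub_le`.
  have hV : ∀ {u : X δ N}, nB δ N (fun n => ‖ev u n‖ₑ) ≤ r →
      nB δ N (fun n => ‖ev (fieldL hM hS imL cj fun _ => u) n‖ₑ) ≤ lipConst k β r * r := by
    intro u hu
    rw [ev_fieldL]
    refine (hS.nB_fieldRaw_le imL cj hu).trans ?_
    obtain ⟨j, rfl⟩ := Nat.exists_eq_succ_of_ne_zero hk
    have h1 : (1 : ℝ≥0∞) ≤ ((j + 1 : ℕ) : ℝ≥0∞) := by exact_mod_cast Nat.le_add_left 1 j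
    calc _ ≤ (((j + 1 : ℕ) : ℝ≥0∞) + 1) * (1 * (β * r ^ (j + 1))) := by
          gcongr; exact enorm_imL_le
      _ = (((j + 1 : ℕ) : ℝ≥0∞) + 1) * (1 * (β * (1 * r) ^ j)) * r := by rw [one_mul r]; ring
      _ ≤ (((j + 1 : ℕ) : ℝ≥0∞) + 1) * (((j + 1 : ℕ) : ℝ≥0∞) * (β * (2 * r) ^ j)) * r := by
          gcongr
          exact one_le_two
      _ = _ := rfl
  have hθ : lipConst k β r ≠ ∞ := by
    unfold lipConst
    finiteness
  exact hS'.brk_sub_le hN.out hM' cj' hr hθ hu hu' (hV hu) (hV hu')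
    (nD_fieldL_sub_le hM hS hr hu hu')

/-- The real part of a form on the diagonal. -/
def reForm {k : ℕ} (c : (Fin k → ℤ) → ℂ) (cj : Fin k → Bool) (u : X δ N) : ℝ :=
  (form c cj fun _ => ev u).re

/-- `∑ n² |v(n)|²`. -/
def quad (u : X δ N) : ℝ := reForm (kerQuad fun n => (n : ℝ) ^ 2) cj2 u

lemma form_const_mul {k : ℕ} (a : ℂ) (c : (Fin k → ℤ) → ℂ) (cj : Fin k → Bool)
    (f : Fin k → ℤ → ℂ) : form (fun m => a * c m) cj f = a * form c cj f := by
  unfold form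
  rw [← tsum_mul_left]
  exact tsum_congr fun m => mul_assoc _ _ _

/-! ### Mass conservation and the evolution of ∑ n²|v(n)|² -/

section Conservation

variable {hM : Bdd δ N M c} {hS : SlotBound δ N β fun m => ‖c m‖ₑ} {w : ℝ → X δ N}

lemma IsCurve.mass_eq (hδ : 0 ≤ δ) (hw : IsCurve (fieldL hM hS imL cj) w) (hc : ∀ m, ‖c m‖ₑ ≤ 1)
    (h0 : ∀ m, c m * ∑ j, sgn (cj j) * ((1 : ℝ) : ℂ) = 0) :
    mass (ev (w 1)) = mass (ev (w 0)) := by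
  have hd := bdd_kerQuad hδ hN.out (enorm_one_le_wt hδ)
  have h1 : ∀ s ∈ Set.Icc (0 : ℝ) 1, HasDerivWithinAt
      (fun s => reForm (kerQuad fun _ => 1) cj2 (w s)) 0 (Set.Icc 0 1) s := by
    intro s hs
    have h2 := hd.hasDerivWithinAt_form cj2 (hw s hs)
    rw [brk_kerQuad hd (fun j => bdd_mul hδ hN.out hc (enorm_one_le_wt hδ) j)
      (ev_fieldL hM hS imL cj (w s))] at h2
    have hz : form (fun _ : Fin (k + 1) → ℤ => (0 : ℂ)) cj (fun _ => ev (w s)) = 0 := by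
      simp [form]
    rw [show (fun m => c m * ∑ j, sgn (cj j) * ((1 : ℝ) : ℂ)) = fun _ => 0 from funext h0, hz,
      Complex.zero_re, Complex.ofReal_zero, neg_zero, Complex.zero_re] at h2
    exact h2
  have h3 := enorm_sub_le_of_hasDerivWithinAt (B := 0) h1 (by simp)
  rw [nonpos_iff_eq_zero, enorm_eq_zero, sub_eq_zero] at h3
  rw [QuasiLinear.mass_eq hδ, QuasiLinear.mass_eq hδ]
  exact h3

lemma IsCurve.hasDerivWithinAt_quad (hδ : 0 < δ) (hw : IsCurve (fieldL hM hS imL cj) w)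
    (hc : ∀ m, ‖c m‖ₑ ≤ 1) {a : ℝ} {c₀ : (Fin (k + 1) → ℤ) → ℂ}
    (h0 : ∀ m, c m * ∑ j, sgn (cj j) * (((m j : ℝ) ^ 2 : ℝ) : ℂ) = a * c₀ m)
    {s : ℝ} (hs : s ∈ Set.Icc (0 : ℝ) 1) :
    HasDerivWithinAt (fun s => quad (w s)) (-(a * reForm c₀ cj (w s))) (Set.Icc 0 1) s := by
  have hd := bdd_kerQuad hδ.le hN.out (enorm_sq_le_wt hδ)
  have h2 := hd.hasDerivWithinAt_form cj2 (hw s hs)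
  rw [brk_kerQuad hd (fun j => bdd_mul hδ.le hN.out hc (enorm_sq_le_wt hδ) j)
      (ev_fieldL hM hS imL cj (w s)), funext h0, form_const_mul, Complex.neg_re,
      Complex.ofReal_re, Complex.re_ofReal_mul] at h2
  exact h2

end Conservation

variable {M₁ M₂ β₁ β₂ : ℝ≥0} {σ : ℝ} {w w' : ℝ → X δ N}

/-- Second order Taylor formula along the flow of `F₁`. -/
lemma hasDerivWithinAt_taylor_kF1 (hδ : 0 < δ) (hσ : |σ| = 1) {hM : Bdd δ N M₁ (kF1 σ)}
    {hS : SlotBound δ N β₁ fun m => ‖kF1 σ m‖ₑ} (hZ : Bdd δ N M₂ kZ)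
    (hw : IsCurve (fieldL hM hS imL cj4) w) {s : ℝ} (hs : s ∈ Set.Icc (0 : ℝ) 1) :
    HasDerivWithinAt (fun s => quad (w s) + σ * s * reForm kH cj4 (w s)
        + 2 * (1 - s ^ 2) * reForm kZ cj6 (w s))
      (2 * (1 - s ^ 2) * (brk kZ cj6 (ev (w s)) (ev (fieldL hM hS imL cj4 fun _ => w s))).re)
      (Set.Icc 0 1) s := by
  have hσ2 : σ * σ = 1 := by rw [← abs_mul_abs_self, hσ, one_mul]
  have h1 := hw.hasDerivWithinAt_quad hδ
    (fun m => (enorm_kF1_le hσ m).trans (kerQuartic_le_one m)) (kF1_mul_sum_sq σ) hs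
  have h2 := (bdd_of_enorm_le_one hδ.le hN.out enorm_kH_le).hasDerivWithinAt_form cj4 (hw s hs)
  rw [ev_fieldL, brk_kH_fieldRaw hM hZ, Complex.ofReal_re] at h2
  have h3 := hZ.hasDerivWithinAt_form cj6 (hw s hs)
  have h4 : HasDerivWithinAt (fun s : ℝ => σ * s) (σ * 1) (Set.Icc 0 1) s :=
    (hasDerivWithinAt_id s _).const_mul σ
  -- This coefficient vanishes at s = 1, and its derivative -4s cancels σs times the derivative 4σZ
  -- of the quartic form, because σ² = 1.
  have h5 : HasDerivWithinAt (fun s : ℝ => 2 * (1 - s ^ 2)) (2 * -((2 : ℕ) * s ^ 1 * 1))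
      (Set.Icc 0 1) s := (((hasDerivWithinAt_id s _).pow 2).const_sub 1).const_mul 2
  refine ((h1.add (h4.mul h2)).add (h5.mul h3)).congr_deriv ?_
  unfold reForm
  linear_combination (4 * s * (form kZ cj6 fun _ => ev (w s)).re) * hσ2

/-- First order Taylor formula along the flow of `F₂`. -/
lemma hasDerivWithinAt_taylor_kF2 (hδ : 0 < δ) {hM : Bdd δ N M₁ kF2}
    {hS : SlotBound δ N β₁ fun m => ‖kF2 m‖ₑ} (hZ : Bdd δ N M₂ kZnr)
    (hw : IsCurve (fieldL hM hS imL cj6) w) {s : ℝ} (hs : s ∈ Set.Icc (0 : ℝ) 1) :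
    HasDerivWithinAt (fun s => quad (w s) + 2 * s * reForm kZnr cj6 (w s))
      (2 * s * (brk kZnr cj6 (ev (w s)) (ev (fieldL hM hS imL cj6 fun _ => w s))).re)
      (Set.Icc 0 1) s := by
  have h1 := hw.hasDerivWithinAt_quad hδ (a := 2)
    (fun m => (enorm_kF2_le m).trans (kerNonres_le_one m))
    (fun m => by rw [Complex.ofReal_ofNat]; exact kF2_mul_sum_sq m) hs
  have h3 := hZ.hasDerivWithinAt_form cj6 (hw s hs)
  -- The coefficient vanishes at s = 0, and its derivative cancels the derivative of `quad`, which
  -- is -2 times the nonresonant sextic form.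
  have h4 : HasDerivWithinAt (fun s : ℝ => 2 * s) (2 * 1) (Set.Icc 0 1) s :=
    (hasDerivWithinAt_id s _).const_mul 2
  refine (h1.add (h4.mul h3)).congr_deriv ?_
  unfold reForm
  ring

lemma enorm_re_le (z : ℂ) : ‖z.re‖ₑ ≤ ‖z‖ₑ := by
  rw [← ofReal_norm, ← ofReal_norm]
  exact ENNReal.ofReal_le_ofReal (Complex.abs_re_le_norm z)

lemma enorm_mul_re_sub_le {a : ℝ} (ha : ‖a‖ₑ ≤ 2) {z z' : ℂ} {B : ℝ≥0∞} (h : ‖z - z'‖ₑ ≤ B) :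
    ‖a * z.re - a * z'.re‖ₑ ≤ 2 * B := by
  rw [← mul_sub, ← Complex.sub_re, enorm_mul]
  gcongr
  exact (enorm_re_le _).trans h

lemma enorm_le_two {a : ℝ} (ha : |a| ≤ 2) : ‖a‖ₑ ≤ 2 := by
  rw [← ofReal_norm, Real.norm_eq_abs]
  exact (ENNReal.ofReal_le_ofReal ha).trans (by simp)

/-- The exact formula is used for both curves and only the difference of the integrands is
estimated; no bound on `quad` is involved. The factor 36 = 6² counts pairs of slots of a sextic
form. -/
lemma taylor_kF1_sub_le (hδ : 0 < δ) (hσ : |σ| = 1) {hM : Bdd δ N M₁ (kF1 σ)}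
    {hS : SlotBound δ N β₁ fun m => ‖kF1 σ m‖ₑ} (hZ : Bdd δ N M₂ kZ)
    (hSZ : SlotBound δ N β₂ fun m => ‖kZ m‖ₑ) (hr : r ≠ ∞)
    (hw : IsCurve (fieldL hM hS imL cj4) w) (hw' : IsCurve (fieldL hM hS imL cj4) w')
    (h : StaysIn r w) (h' : StaysIn r w') {D : ℝ≥0∞}
    (hD : ∀ s ∈ Set.Icc (0 : ℝ) 1, nD δ N (fun n => ‖ev (w s) n - ev (w' s) n‖ₑ) ≤ D) :
    ‖(quad (w 1) + σ * reForm kH cj4 (w 1) - quad (w 0) - 2 * reForm kZ cj6 (w 0))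
      - (quad (w' 1) + σ * reForm kH cj4 (w' 1) - quad (w' 0) - 2 * reForm kZ cj6 (w' 0))‖ₑ
      ≤ 2 * (36 * (β₂ * (lipConst 3 β₁ r * (2 * r) ^ 5)) * D) := by
  have key := enorm_sub_le_of_hasDerivWithinAt
    (fun s hs => (hasDerivWithinAt_taylor_kF1 hδ hσ hZ hw hs).sub
      (hasDerivWithinAt_taylor_kF1 hδ hσ hZ hw' hs)) (fun s hs => by
    have ha : |2 * (1 - s ^ 2)| ≤ 2 := by
      rw [abs_le]
      constructor <;> nlinarith [hs.1, hs.2]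
    refine enorm_mul_re_sub_le (enorm_le_two ha)
      ((brk_fieldL_sub_le (by norm_num) hM hS hZ hSZ cj6 hr (h s hs) (h' s hs)).trans
        (mul_le_mul_right (hD s hs) _)))
  simp only [Pi.sub_apply] at key
  convert key using 2
  · ring_nf
  · norm_num
    ring

lemma taylor_kF2_sub_le (hδ : 0 < δ) {hM : Bdd δ N M₁ kF2}
    {hS : SlotBound δ N β₁ fun m => ‖kF2 m‖ₑ} (hZ : Bdd δ N M₂ kZnr)
    (hSZ : SlotBound δ N β₂ fun m => ‖kZnr m‖ₑ) (hr : r ≠ ∞)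
    (hw : IsCurve (fieldL hM hS imL cj6) w) (hw' : IsCurve (fieldL hM hS imL cj6) w')
    (h : StaysIn r w) (h' : StaysIn r w') {D : ℝ≥0∞}
    (hD : ∀ s ∈ Set.Icc (0 : ℝ) 1, nD δ N (fun n => ‖ev (w s) n - ev (w' s) n‖ₑ) ≤ D) :
    ‖(quad (w 1) + 2 * reForm kZnr cj6 (w 1) - quad (w 0))
      - (quad (w' 1) + 2 * reForm kZnr cj6 (w' 1) - quad (w' 0))‖ₑ
      ≤ 2 * (36 * (β₂ * (lipConst 5 β₁ r * (2 * r) ^ 5)) * D) := by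
  have key := enorm_sub_le_of_hasDerivWithinAt
    (fun s hs => (hasDerivWithinAt_taylor_kF2 hδ hZ hw hs).sub
      (hasDerivWithinAt_taylor_kF2 hδ hZ hw' hs)) (fun s hs => by
    have ha : |2 * s| ≤ 2 := by
      rw [abs_le]
      constructor <;> nlinarith [hs.1, hs.2]
    refine enorm_mul_re_sub_le (enorm_le_two ha)
      ((brk_fieldL_sub_le (by norm_num) hM hS hZ hSZ cj6 hr (h s hs) (h' s hs)).trans
        (mul_le_mul_right (hD s hs) _)))
  simp only [Pi.sub_apply] at key
  convert key using 2
  · ring_nf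
  · norm_num
    ring

end Dynamics

/-! ### The transformed Hamiltonian -/

section Transformed

/-- `kap` as a nonnegative real number. -/
def kapN (N : ℝ) : ℝ≥0 := (5 + 2 * Real.log N).toNNReal

lemma coe_kapN (N : ℝ) : (kapN N : ℝ≥0∞) = kap N := rfl

/-- The gradient bound for `F₁`. -/
def beta1 (N : ℝ) : ℝ≥0 := kapN N ^ 2

/-- The gradient bound for `F₂`. -/
def beta2 (N : ℝ) : ℝ≥0 := 10 * N.toNNReal * kapN N ^ 3

/-- The gradient bound for the sextic terms. -/
def betaZ (N : ℝ) : ℝ≥0 := N.toNNReal ^ 2 * kapN N ^ 2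

/-- The Lipschitz constant of the first vector field. -/
def lip1 (N : ℝ) (r : ℝ≥0) : ℝ≥0 := 48 * kapN N ^ 2 * r ^ 2

/-- The Lipschitz constant of the second vector field. -/
def lip2 (N : ℝ) (r : ℝ≥0) : ℝ≥0 := 4800 * N.toNNReal * kapN N ^ 3 * r ^ 4

lemma lipConst_beta1 (N : ℝ) (r : ℝ≥0) : lipConst 3 (beta1 N) r = lip1 N r := by
  simp only [lipConst, beta1, lip1]
  push_cast
  norm_num
  ring

lemma lipConst_beta2 (N : ℝ) (r : ℝ≥0) : lipConst 5 (beta2 N) r = lip2 N r := by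
  simp only [lipConst, beta2, lip2]
  push_cast
  norm_num
  ring

/-- The Lipschitz constant of the remainder on the ball of radius `r / 6`. -/
def lipRem (N : ℝ) (r : ℝ≥0) : ℝ≥0 :=
  -- 288 = 2·36·4, 144 = 2·36·2, 24 = 2·6·2, 16 = 4·4: a prefactor (1 for the diagonal term), the
  -- count of slots or pairs of slots, and 2 for each flow that has been followed.
  288 * (betaZ N * (lip1 N r * (2 * r) ^ 5)) + 144 * (betaZ N * (lip2 N r * (2 * r) ^ 5))
    + 24 * (beta2 N * (2 * r) ^ 5) + 16 * (2 * r) ^ 3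

variable {δ N σ : ℝ} [hN : Fact (1 ≤ N)]

lemma bdd_kF1 (hδ : 0 ≤ δ) (hσ : |σ| = 1) : Bdd δ N (1 * N.toNNReal ^ 4) (kF1 σ) :=
  bdd_of_enorm_le_one hδ hN.out fun m => (enorm_kF1_le hσ m).trans (kerQuartic_le_one m)

lemma bdd_kF2 (hδ : 0 ≤ δ) : Bdd δ N (1 * N.toNNReal ^ 6) kF2 :=
  bdd_of_enorm_le_one hδ hN.out fun m => (enorm_kF2_le m).trans (kerNonres_le_one m)

lemma bdd_kZ (hδ : 0 ≤ δ) : Bdd δ N (1 * N.toNNReal ^ 6) kZ :=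
  bdd_of_enorm_le_one hδ hN.out fun m => (enorm_kZ_le m).trans (kerSextic_le_one m)

lemma bdd_kZnr (hδ : 0 ≤ δ) : Bdd δ N (1 * N.toNNReal ^ 6) kZnr :=
  bdd_of_enorm_le_one hδ hN.out fun m => (enorm_kZnr_le m).trans (kerSextic_le_one m)

lemma bdd_kZr (hδ : 0 ≤ δ) : Bdd δ N (1 * N.toNNReal ^ 6) kZr :=
  bdd_of_enorm_le_one hδ hN.out fun m => (enorm_kZr_le m).trans (kerNonres_le_one m)

lemma slotBound_beta1 (hδ : 0 ≤ δ) (hσ : |σ| = 1) :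
    SlotBound δ N (beta1 N) fun m => ‖kF1 σ m‖ₑ := by
  simpa [beta1, coe_kapN] using slotBound_kF1 hδ hN.out hσ

lemma coe_beta2 (N : ℝ) : (beta2 N : ℝ≥0∞) = 10 * ENNReal.ofReal N * kap N ^ 3 := by
  simp only [beta2]
  push_cast
  rw [coe_kapN, ENNReal.ofReal]

lemma slotBound_beta2 (hδ : 0 ≤ δ) : SlotBound δ N (beta2 N) fun m => ‖kF2 m‖ₑ := by
  rw [coe_beta2]
  exact slotBound_kF2 hδ hN.out

lemma coe_betaZ (N : ℝ) : (betaZ N : ℝ≥0∞) = ENNReal.ofReal N ^ 2 * kap N ^ 2 := by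
  simp only [betaZ]
  push_cast
  rw [coe_kapN, ENNReal.ofReal]

/-- The vector field of `F₁`. -/
def field1 (hδ : 0 ≤ δ) (hσ : |σ| = 1) :
    ContinuousMultilinearMap ℝ (fun _ : Fin 3 => X δ N) (X δ N) :=
  fieldL (bdd_kF1 hδ hσ) (slotBound_beta1 hδ hσ) imL cj4

/-- The vector field of `F₂`. -/
def field2 (hδ : 0 ≤ δ) : ContinuousMultilinearMap ℝ (fun _ : Fin 5 => X δ N) (X δ N) :=
  fieldL (bdd_kF2 hδ) (slotBound_beta2 hδ) imL cj6

lemma dbar_genF1 (hδ : 0 ≤ δ) (hσ : |σ| = 1) (u : X δ N) (n : ℤ) :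
    dbar (genF1 σ) (ev u) n = ev (field1 hδ hσ fun _ => u) n := by
  rw [funext (genF1_eq σ), dbar_form (bdd_kF1 hδ hσ), field1, ev_fieldL]

lemma dbar_genF2 (hδ : 0 ≤ δ) (u : X δ N) (n : ℤ) :
    dbar genF2 (ev u) n = ev (field2 hδ fun _ => u) n := by
  rw [funext genF2_eq, dbar_form (bdd_kF2 hδ), field2, ev_fieldL]

lemma norm_imL_le : ‖imL‖ ≤ 1 := by
  have := enorm_imL_le
  rwa [← ofReal_norm, ENNReal.ofReal_le_one] at this

/-- Smallness of the two vector fields on the ball of radius `r`. -/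
structure IsSmall (N : ℝ) (r : ℝ≥0) : Prop where
  pos : 0 < r
  one : lip1 N r ≤ 1 / 2
  two : lip2 N r ≤ 1 / 2

variable {r : ℝ≥0}

lemma IsSmall.field1 (h : IsSmall N r) (hδ : 0 ≤ δ) (hσ : |σ| = 1) :
    Small (field1 hδ hσ : ContinuousMultilinearMap ℝ (fun _ : Fin 3 => X δ N) (X δ N)) (r / 2) := by
  refine ⟨half_pos (by exact_mod_cast h.pos), ?_⟩
  have h1 : (lip1 N r : ℝ) ≤ ((1 / 2 : ℝ≥0) : ℝ) := by exact_mod_cast h.one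
  rw [lip1] at h1
  push_cast at h1
  have h2 := norm_fieldL_le (bdd_kF1 hδ hσ) (slotBound_beta1 hδ hσ) imL cj4 (δ := δ) (N := N)
  simp only [beta1] at h2
  push_cast at h2 ⊢
  calc _ ≤ ((3 : ℝ) + 1) * (1 * (kapN N : ℝ) ^ 2) * (3 + 1) * (2 * (r / 2)) ^ 2 := by
        gcongr
        refine h2.trans ?_
        gcongr
        exact norm_imL_le
    _ ≤ 1 / 4 := by nlinarith

lemma IsSmall.field2 (h : IsSmall N r) (hδ : 0 ≤ δ) :
    Small (field2 hδ : ContinuousMultilinearMap ℝ (fun _ : Fin 5 => X δ N) (X δ N)) (r / 6) := by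
  have hr : (0 : ℝ) < r := by exact_mod_cast h.pos
  refine ⟨by positivity, ?_⟩
  have h1 : (lip2 N r : ℝ) ≤ ((1 / 2 : ℝ≥0) : ℝ) := by exact_mod_cast h.two
  rw [lip2] at h1
  push_cast at h1
  have h2 := norm_fieldL_le (bdd_kF2 hδ) (slotBound_beta2 hδ) imL cj6 (δ := δ) (N := N)
  simp only [beta2] at h2
  push_cast at h2 ⊢
  have h3 : 0 ≤ (N.toNNReal : ℝ) * (kapN N : ℝ) ^ 3 * r ^ 4 := by positivity
  calc _ ≤ ((5 : ℝ) + 1) * (1 * (10 * N.toNNReal * (kapN N : ℝ) ^ 3)) * (5 + 1)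
          * (2 * (r / 6)) ^ 4 := by
        gcongr
        refine h2.trans ?_
        gcongr
        exact norm_imL_le
    _ ≤ 1 / 4 := by nlinarith

/-- The flow of `F₁`. -/
def flow1 (hδ : 0 ≤ δ) (hσ : |σ| = 1) (r : ℝ≥0) (u : X δ N) (s : ℝ) : X δ N :=
  flow (field1 hδ hσ) (r / 2) u s

/-- The flow of `F₂`. -/
def flow2 (hδ : 0 ≤ δ) (r : ℝ≥0) (u : X δ N) (s : ℝ) : X δ N :=
  flow (field2 hδ) (r / 6) u s

/-- The change of variables on `X δ N`. -/
def normalX (hδ : 0 ≤ δ) (hσ : |σ| = 1) (r : ℝ≥0) (u : X δ N) : X δ N :=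
  flow1 hδ hσ r (flow2 hδ r u 1) 1

lemma IsSmall.isCurve_flow2 (h : IsSmall N r) (hδ : 0 ≤ δ) {u : X δ N} (hu : ‖u‖ ≤ r / 6) :
    IsCurve (QuasiLinear.field2 hδ) (flow2 hδ r u) := fun _ hs =>
  (h.field2 hδ).hasDerivWithinAt_flow (by norm_num) hu hs

lemma IsSmall.norm_flow2_le (h : IsSmall N r) (hδ : 0 ≤ δ) {u : X δ N} (hu : ‖u‖ ≤ r / 6) {s : ℝ}
    (hs : s ∈ Set.Icc (0 : ℝ) 1) : ‖flow2 hδ r u s‖ ≤ r / 3 :=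
  ((h.field2 hδ).norm_flow_le (by norm_num) hu hs).trans (by linarith)

lemma IsSmall.isCurve_flow1 (h : IsSmall N r) (hδ : 0 ≤ δ) (hσ : |σ| = 1) {u : X δ N}
    (hu : ‖u‖ ≤ r / 2) : IsCurve (QuasiLinear.field1 hδ hσ) (flow1 hδ hσ r u) := fun _ hs =>
  (h.field1 hδ hσ).hasDerivWithinAt_flow (by norm_num) hu hs

lemma IsSmall.norm_flow1_le (h : IsSmall N r) (hδ : 0 ≤ δ) (hσ : |σ| = 1) {u : X δ N}
    (hu : ‖u‖ ≤ r / 2) {s : ℝ} (hs : s ∈ Set.Icc (0 : ℝ) 1) : ‖flow1 hδ hσ r u s‖ ≤ r :=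
  ((h.field1 hδ hσ).norm_flow_le (by norm_num) hu hs).trans (by linarith)

lemma flow2_zero (hδ : 0 ≤ δ) (u : X δ N) : flow2 hδ r u 0 = u := flow_zero u

lemma flow1_zero (hδ : 0 ≤ δ) (hσ : |σ| = 1) (u : X δ N) : flow1 hδ hσ r u 0 = u := flow_zero u

/-- The chain of radii: data in the ball r/6 stay within r/3 under the second flow, inside the ball
r/2 from which the first flow stays within r. -/
lemma IsSmall.norm_flow2_one_le (h : IsSmall N r) (hδ : 0 ≤ δ) {u : X δ N} (hu : ‖u‖ ≤ r / 6) :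
    ‖flow2 hδ r u 1‖ ≤ r / 2 := by
  have hr : (0 : ℝ) < r := by exact_mod_cast h.pos
  exact (h.norm_flow2_le hδ hu ⟨zero_le_one, le_rfl⟩).trans (by linarith)

lemma IsSmall.hasUniqueFlowLine_genF2 (h : IsSmall N r) (hδ : 0 ≤ δ) {u : X δ N}
    (hu : ‖u‖ ≤ r / 6) : HasUniqueFlowLine genF2 (ev u) := by
  have := hasUniqueFlowLine_of_hasDerivWithinAt hδ (dbar_genF2 le_rfl) (dbar_genF2 hδ)
    (h.isCurve_flow2 hδ hu)
  rwa [flow2_zero] at this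

lemma IsSmall.hasUniqueFlowLine_genF1 (h : IsSmall N r) (hδ : 0 ≤ δ) (hσ : |σ| = 1) {u : X δ N}
    (hu : ‖u‖ ≤ r / 2) : HasUniqueFlowLine (genF1 σ) (ev u) := by
  have := hasUniqueFlowLine_of_hasDerivWithinAt hδ (dbar_genF1 le_rfl hσ) (dbar_genF1 hδ hσ)
    (h.isCurve_flow1 hδ hσ hu)
  rwa [flow1_zero] at this

lemma IsSmall.flowMap_genF2 (h : IsSmall N r) (hδ : 0 ≤ δ) {u : X δ N} (hu : ‖u‖ ≤ r / 6) :
    flowMap genF2 1 (ev u) = ev (flow2 hδ r u 1) := by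
  have := flowMap_one_eq hδ (dbar_genF2 le_rfl) (dbar_genF2 hδ) (h.isCurve_flow2 hδ hu)
  rwa [flow2_zero] at this

lemma IsSmall.flowMap_genF1 (h : IsSmall N r) (hδ : 0 ≤ δ) (hσ : |σ| = 1) {u : X δ N}
    (hu : ‖u‖ ≤ r / 2) : flowMap (genF1 σ) 1 (ev u) = ev (flow1 hδ hσ r u 1) := by
  have := flowMap_one_eq hδ (dbar_genF1 le_rfl hσ) (dbar_genF1 hδ hσ) (h.isCurve_flow1 hδ hσ hu)
  rwa [flow1_zero] at this

lemma IsSmall.normalForm_eq (h : IsSmall N r) (hδ : 0 ≤ δ) (hσ : |σ| = 1) {u : X δ N}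
    (hu : ‖u‖ ≤ r / 6) : normalForm σ (ev u) = ev (normalX hδ hσ r u) := by
  rw [normalForm, h.flowMap_genF2 hδ hu, h.flowMap_genF1 hδ hσ (h.norm_flow2_one_le hδ hu)]
  rfl

lemma hamiltonian_eq (hδ : 0 < δ) (σ : ℝ) (u : X δ N) : hamiltonian σ (ev u)
    = Complex.I * ((quad u + σ * (reForm kH cj4 u + 2 * mass (ev u) ^ 2
        - reForm kDiag cj4 u) : ℝ) : ℂ) := by
  rw [hamiltonian, quadPart_eq hδ, quarticPart_eq hδ.le, ← mul_add, ← Complex.ofReal_add]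
  rfl

/-- The remainder, divided by `i`, on `X δ N`. -/
def remX (hδ : 0 ≤ δ) (hσ : |σ| = 1) (r : ℝ≥0) (u : X δ N) : ℝ :=
  (quad (normalX hδ hσ r u) + σ * reForm kH cj4 (normalX hδ hσ r u) - quad (flow2 hδ r u 1)
      - 2 * reForm kZ cj6 (flow2 hδ r u 1))
    + (quad (flow2 hδ r u 1) + 2 * reForm kZnr cj6 (flow2 hδ r u 1) - quad u)
    + 2 * reForm kZr cj6 (flow2 hδ r u 1) - σ * reForm kDiag cj4 (normalX hδ hσ r u)

/-- The terms which `remX` adds and subtracts at the intermediate point cancel because Z is the sum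
of its resonant and nonresonant parts; conservation of mass along both flows removes the term 2σP².
-/
lemma IsSmall.remainder_eq (h : IsSmall N r) (hδ : 0 < δ) (hσ : |σ| = 1) {u : X δ N}
    (hu : ‖u‖ ≤ r / 6) : remainder σ (ev u) = Complex.I * (remX hδ.le hσ r u : ℂ) := by
  have hz : reForm kZ cj6 (flow2 hδ.le r u 1)
      = reForm kZnr cj6 (flow2 hδ.le r u 1) + reForm kZr cj6 (flow2 hδ.le r u 1) := by
    unfold reForm form
    rw [← Complex.add_re, ← ((bdd_kZnr hδ.le).summable cj6 _).tsum_add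
      ((bdd_kZr hδ.le).summable cj6 _)]
    congr 1
    exact tsum_congr fun m => by rw [← add_mul, kZnr_add_kZr]
  have hm2 : mass (ev (flow2 hδ.le r u 1)) = mass (ev u) := by
    have := (h.isCurve_flow2 hδ.le hu).mass_eq hδ.le
      (fun m => (enorm_kF2_le m).trans (kerNonres_le_one m)) kF2_mul_sum_one
    rwa [flow2_zero] at this
  have hm1 : mass (ev (normalX hδ.le hσ r u)) = mass (ev (flow2 hδ.le r u 1)) := by
    have := (h.isCurve_flow1 hδ.le hσ (h.norm_flow2_one_le hδ.le hu)).mass_eq hδ.le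
      (fun m => (enorm_kF1_le hσ m).trans (kerQuartic_le_one m)) (kF1_mul_sum_one σ)
    rwa [flow1_zero] at this
  rw [remainder, transformedHamiltonian, h.normalForm_eq hδ.le hσ hu, hamiltonian_eq hδ,
    quadPart_eq hδ, resonantPart, hm1, hm2, remX, hz]
  change _ - Complex.I * (quad u : ℂ) - _ = _
  push_cast
  ring

lemma staysIn_of_norm_le {w : ℝ → X δ N} (h : ∀ s ∈ Set.Icc (0 : ℝ) 1, ‖w s‖ ≤ r) :
    StaysIn (r : ℝ≥0∞) w := fun s hs => by
  have := (X.norm_le_iff r.coe_nonneg).mp (h s hs)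
  rwa [ENNReal.ofReal_coe_nnreal] at this

lemma reForm_sub_le {k : ℕ} {M : ℝ≥0} {β : ℝ≥0∞} {c : (Fin (k + 1) → ℤ) → ℂ} (hM : Bdd δ N M c)
    (hS : SlotBound δ N β fun m => ‖c m‖ₑ) (cj : Fin (k + 1) → Bool) {u u' : X δ N}
    (hu : ‖u‖ ≤ r) (hu' : ‖u'‖ ≤ r) : ‖reForm c cj u - reForm c cj u'‖ₑ
      ≤ (k + 1) * (β * (2 * (r : ℝ≥0∞)) ^ k) * nD δ N (fun n => ‖ev u n - ev u' n‖ₑ) := by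
  have h1 := (X.norm_le_iff r.coe_nonneg).mp hu
  have h2 := (X.norm_le_iff r.coe_nonneg).mp hu'
  rw [ENNReal.ofReal_coe_nnreal] at h1 h2
  rw [reForm, reForm, ← Complex.sub_re]
  exact (enorm_re_le _).trans (hS.form_diag_sub_le hN.out hM cj ENNReal.coe_ne_top h1 h2)

/-- The remainder is Lipschitz for the dual norm. -/
lemma IsSmall.remX_sub_le (h : IsSmall N r) (hδ : 0 < δ) (hσ : |σ| = 1) {u u' : X δ N}
    (hu : ‖u‖ ≤ r / 6) (hu' : ‖u'‖ ≤ r / 6) : ‖remX hδ.le hσ r u - remX hδ.le hσ r u'‖ₑ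
      ≤ lipRem N r * nD δ N (fun n => ‖ev u n - ev u' n‖ₑ) := by
  set d := nD δ N (fun n => ‖ev u n - ev u' n‖ₑ) with hd
  have hr0 : (0 : ℝ) ≤ r := r.2
  have hr : (r : ℝ≥0∞) ≠ ∞ := ENNReal.coe_ne_top
  have one_mem : (1 : ℝ) ∈ Set.Icc (0 : ℝ) 1 := ⟨zero_le_one, le_rfl⟩
  have st2 : ∀ {u : X δ N}, ‖u‖ ≤ r / 6 → StaysIn (r : ℝ≥0∞) (flow2 hδ.le r u) := fun hu =>
    staysIn_of_norm_le fun s hs => (h.norm_flow2_le hδ.le hu hs).trans (by linarith)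
  have st1 : ∀ {u : X δ N}, ‖u‖ ≤ r / 2 → StaysIn (r : ℝ≥0∞) (flow1 hδ.le hσ r u) := fun hu =>
    staysIn_of_norm_le fun s hs => h.norm_flow1_le hδ.le hσ hu hs
  have l2 : lipConst 5 (beta2 N) r ≤ 1 / 2 := by
    rw [lipConst_beta2]
    refine (ENNReal.coe_le_coe.mpr h.two).trans (le_of_eq ?_)
    rw [ENNReal.coe_div two_ne_zero]
    rfl
  have l1 : lipConst 3 (beta1 N) r ≤ 1 / 2 := by
    rw [lipConst_beta1]
    refine (ENNReal.coe_le_coe.mpr h.one).trans (le_of_eq ?_)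
    rw [ENNReal.coe_div two_ne_zero]
    rfl
  have c2 := h.isCurve_flow2 hδ.le hu
  have c2' := h.isCurve_flow2 hδ.le hu'
  have hx := h.norm_flow2_one_le hδ.le hu
  have hx' := h.norm_flow2_one_le hδ.le hu'
  have c1 := h.isCurve_flow1 hδ.le hσ hx
  have c1' := h.isCurve_flow1 hδ.le hσ hx'
  have D2 : ∀ s ∈ Set.Icc (0 : ℝ) 1,
      nD δ N (fun n => ‖ev (flow2 hδ.le r u s) n - ev (flow2 hδ.le r u' s) n‖ₑ) ≤ 2 * d := by
    intro s hs
    have := IsCurve.nD_sub_le hδ.le hr l2 c2 c2' (st2 hu) (st2 hu') hs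
    rwa [flow2_zero, flow2_zero] at this
  have D1 : ∀ s ∈ Set.Icc (0 : ℝ) 1,
      nD δ N (fun n => ‖ev (flow1 hδ.le hσ r (flow2 hδ.le r u 1) s) n
        - ev (flow1 hδ.le hσ r (flow2 hδ.le r u' 1) s) n‖ₑ) ≤ 2 * (2 * d) := by
    intro s hs
    have := IsCurve.nD_sub_le hδ.le hr l1 c1 c1' (st1 hx) (st1 hx') hs
    rw [flow1_zero, flow1_zero] at this
    exact this.trans (by gcongr; exact D2 1 one_mem)
  have hZ : SlotBound δ N (betaZ N) fun m => ‖kZ m‖ₑ := by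
    rw [coe_betaZ]; exact slotBound_kZ hδ.le hN.out
  have hZnr : SlotBound δ N (betaZ N) fun m => ‖kZnr m‖ₑ := by
    rw [coe_betaZ]; exact slotBound_kZnr hδ.le hN.out
  have hZr : SlotBound δ N (beta2 N) fun m => ‖kZr m‖ₑ := by
    rw [coe_beta2]; exact slotBound_kZr hδ.le hN.out
  have E1 := taylor_kF1_sub_le hδ hσ (bdd_kZ hδ.le) hZ hr c1 c1' (st1 hx) (st1 hx') D1
  rw [flow1_zero, flow1_zero, lipConst_beta1] at E1
  have E2 := taylor_kF2_sub_le hδ (bdd_kZnr hδ.le) hZnr hr c2 c2' (st2 hu) (st2 hu') D2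
  rw [flow2_zero, flow2_zero, lipConst_beta2] at E2
  have E3 := (reForm_sub_le (bdd_kZr hδ.le) hZr cj6 (hx.trans (by linarith : (r : ℝ) / 2 ≤ r))
    (hx'.trans (by linarith : (r : ℝ) / 2 ≤ r))).trans (mul_le_mul_right (D2 1 one_mem) _)
  have E4 := (reForm_sub_le (bdd_of_enorm_le_one hδ.le hN.out enorm_kDiag_le)
    (slotBound_kDiag hδ.le hN.out) cj4 (h.norm_flow1_le hδ.le hσ hx one_mem)
    (h.norm_flow1_le hδ.le hσ hx' one_mem)).trans (mul_le_mul_right (D1 1 one_mem) _)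
  have e : remX hδ.le hσ r u - remX hδ.le hσ r u'
      = ((quad (normalX hδ.le hσ r u) + σ * reForm kH cj4 (normalX hδ.le hσ r u)
        - quad (flow2 hδ.le r u 1) - 2 * reForm kZ cj6 (flow2 hδ.le r u 1))
        - (quad (normalX hδ.le hσ r u') + σ * reForm kH cj4 (normalX hδ.le hσ r u')
        - quad (flow2 hδ.le r u' 1) - 2 * reForm kZ cj6 (flow2 hδ.le r u' 1)))
      + ((quad (flow2 hδ.le r u 1) + 2 * reForm kZnr cj6 (flow2 hδ.le r u 1) - quad u)
        - (quad (flow2 hδ.le r u' 1) + 2 * reForm kZnr cj6 (flow2 hδ.le r u' 1) - quad u'))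
      + 2 * (reForm kZr cj6 (flow2 hδ.le r u 1) - reForm kZr cj6 (flow2 hδ.le r u' 1))
      + (-σ) * (reForm kDiag cj4 (normalX hδ.le hσ r u)
        - reForm kDiag cj4 (normalX hδ.le hσ r u')) := by
    unfold remX
    ring
  have eσ : ‖-σ‖ₑ = 1 := by
    rw [enorm_neg, ← ofReal_norm, Real.norm_eq_abs, hσ, ENNReal.ofReal_one]
  have e2 : ‖(2 : ℝ)‖ₑ = 2 := by
    rw [← ofReal_norm, Real.norm_ofNat, ENNReal.ofReal_ofNat]
  have E3' := mul_le_mul_right E3 (2 : ℝ≥0∞)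
  rw [← e2, ← enorm_mul, e2] at E3'
  rw [← one_mul ‖reForm kDiag cj4 _ - _‖ₑ, ← eσ, ← enorm_mul] at E4
  rw [e]
  refine (enorm_add_le _ _).trans ((add_le_add ((enorm_add_le _ _).trans (add_le_add
    ((enorm_add_le _ _).trans (add_le_add E1 E2)) E3')) E4).trans (le_of_eq ?_))
  rw [eσ]
  simp only [lipRem]
  push_cast
  norm_num
  ring

end Transformed

/-! ### Gradients of functions on `X δ N` -/

section Gradient

variable {δ N σ : ℝ}

lemma nD_const_mul_le (a : ℝ≥0∞) (h : ℤ → ℝ≥0∞) :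
    nD δ N (fun n => a * h n) ≤ a * nD δ N h :=
  nD_le fun g hg => by
    simp_rw [mul_left_comm _ a]
    rw [ENNReal.tsum_mul_left]
    gcongr
    exact tsum_mul_le_nD hg

lemma enorm_half_I_le {a b : ℝ} : ‖(1 / 2 : ℂ) * (Complex.I * a + Complex.I * (Complex.I * b))‖ₑ
    ≤ ‖a‖ₑ + ‖b‖ₑ := by
  rw [enorm_mul]
  have h1 : ‖(1 / 2 : ℂ)‖ₑ ≤ 1 := by
    rw [← ofReal_norm, ENNReal.ofReal_le_one]; norm_num
  have hI : ‖Complex.I‖ₑ = 1 := by rw [← ofReal_norm]; simp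
  have hr : ∀ x : ℝ, ‖(x : ℂ)‖ₑ = ‖x‖ₑ := fun x => by
    rw [← ofReal_norm, Complex.norm_real, ofReal_norm]
  calc _ ≤ 1 * (‖Complex.I * (a : ℂ)‖ₑ + ‖Complex.I * (Complex.I * (b : ℂ))‖ₑ) := by
        gcongr; exact enorm_add_le _ _
    _ = _ := by rw [enorm_mul, enorm_mul, enorm_mul, hI, hr, hr]; ring

lemma half_I_eq (a : ℝ) (w : ℂ) : (1 / 2 : ℂ) * (Complex.I * ((2 * a * (1 * conj w).re : ℝ) : ℂ)
    + Complex.I * (Complex.I * ((2 * a * (Complex.I * conj w).re : ℝ) : ℂ))) = Complex.I * a * w := by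
  apply Complex.ext <;> simp <;> ring

/-- Interpolation between the weighted `ℓ¹` and `ℓ^∞` norms. -/
lemma wnorm_le (hN : 1 ≤ N) {f : ℤ → ℂ} {A : ℝ≥0} (h1 : ∀ n, wt δ n * ‖f n‖ₑ ≤ A)
    (h2 : ∑' n, wt δ n * ‖f n‖ₑ ≤ A * ENNReal.ofReal N) {p : ℝ≥0∞} (hp : 1 ≤ p) :
    wnorm p δ f ≤ ENNReal.ofReal (A * N ^ (p⁻¹).toReal) := by
  have hN0 : 0 < N := zero_lt_one.trans_le hN
  rcases eq_or_ne p ∞ with rfl | hp'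
  · rw [wnorm, MeasureTheory.eLpNorm_exponent_top, ENNReal.inv_top, ENNReal.toReal_zero,
      Real.rpow_zero, mul_one, ENNReal.ofReal_coe_nnreal]
    refine MeasureTheory.eLpNormEssSup_le_of_ae_enorm_bound (Filter.Eventually.of_forall fun n => ?_)
    rw [enorm_exp_smul]
    exact h1 n
  · have hp0 : p ≠ 0 := (zero_lt_one.trans_le hp).ne'
    have hpr : 1 ≤ p.toReal := by
      rw [← ENNReal.toReal_one]; exact ENNReal.toReal_mono hp' hp
    rw [wnorm, MeasureTheory.eLpNorm_eq_lintegral_rpow_enorm_toReal hp0 hp',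
      MeasureTheory.lintegral_count]
    simp only [enorm_exp_smul]
    have h3 : ∑' n, (wt δ n * ‖f n‖ₑ) ^ p.toReal ≤ (A : ℝ≥0∞) ^ p.toReal * ENNReal.ofReal N := by
      calc ∑' n, (wt δ n * ‖f n‖ₑ) ^ p.toReal
          ≤ ∑' n, (A : ℝ≥0∞) ^ (p.toReal - 1) * (wt δ n * ‖f n‖ₑ) := by
            refine ENNReal.tsum_le_tsum fun n => ?_
            have e : p.toReal = (p.toReal - 1) + 1 := by ring
            conv_lhs => rw [e, ENNReal.rpow_add_of_nonneg _ _ (by linarith) zero_le_one,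
              ENNReal.rpow_one]
            gcongr
            exact h1 n
        _ = (A : ℝ≥0∞) ^ (p.toReal - 1) * ∑' n, wt δ n * ‖f n‖ₑ := ENNReal.tsum_mul_left
        _ ≤ (A : ℝ≥0∞) ^ (p.toReal - 1) * (A * ENNReal.ofReal N) := by gcongr
        _ = _ := by
            rw [← mul_assoc]
            congr 1
            conv_lhs => rw [← ENNReal.rpow_one (A : ℝ≥0∞)]
            rw [← ENNReal.rpow_mul, mul_comm (1 : ℝ), mul_one,
              ← ENNReal.rpow_add_of_nonneg _ _ (by linarith) zero_le_one, sub_add_cancel]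
    refine (ENNReal.rpow_le_rpow h3 (by positivity)).trans (le_of_eq ?_)
    rw [ENNReal.mul_rpow_of_nonneg _ _ (by positivity), ← ENNReal.rpow_mul,
      mul_one_div_cancel (by linarith), ENNReal.rpow_one, ENNReal.ofReal_mul A.coe_nonneg,
      ENNReal.ofReal_coe_nnreal, ENNReal.ofReal_rpow_of_pos hN0, ENNReal.toReal_inv, one_div]

variable [hN : Fact (1 ≤ N)]

lemma hasFDerivAt_update {A : (ℤ → ℂ) → ℂ} {u : X δ N} {A' : X δ N →L[ℝ] ℂ}
    (h : HasFDerivAt (fun u : X δ N => A (ev u)) A' u) (n : ℤ) :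
    HasFDerivAt (fun z : ℂ => A (Function.update (ev u) n z)) (A'.comp (sg n)) (ev u n) := by
  simp only [update_ev]
  exact hasFDerivAt_comp_update h n

lemma dbar_eq {A : (ℤ → ℂ) → ℂ} {u : X δ N} {A' : X δ N →L[ℝ] ℂ}
    (h : HasFDerivAt (fun u : X δ N => A (ev u)) A' u) (n : ℤ) :
    dbar A (ev u) n = (1 / 2 : ℂ) * (A' (sg n 1) + Complex.I * A' (sg n Complex.I)) := by
  rw [dbar, (hasFDerivAt_update h n).fderiv]
  rfl

/-- The derivative of a function which is Lipschitz for the dual norm. -/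
lemma enorm_fderiv_le (hδ : 0 ≤ δ) {f : X δ N → ℝ} {f' : X δ N →L[ℝ] ℝ} {u : X δ N}
    (hf : HasFDerivAt f f' u) {α : ℝ≥0} (hα : ∀ᶠ x in nhds u,
      ‖f x - f u‖ₑ ≤ α * nD δ N (fun n => ‖ev x n - ev u n‖ₑ)) (x : X δ N) :
    ‖f' x‖ₑ ≤ α * nD δ N (fun n => ‖ev x n‖ₑ) := by
  set d := nD δ N (fun n => ‖ev x n‖ₑ) with hd
  have hdt : d ≠ ∞ := ne_top_of_le_ne_top (by finiteness) (nD_ev_le hδ x)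
  have h1 : HasDerivAt (fun t : ℝ => u + t • x) x 0 := by
    simpa using ((hasDerivAt_id (0 : ℝ)).smul_const x).const_add u
  have h2 : HasDerivAt (fun t : ℝ => f (u + t • x)) (f' x) 0 := by
    have hf0 : HasFDerivAt f f' (u + (0 : ℝ) • x) := by simpa using hf
    exact hf0.comp_hasDerivAt (0 : ℝ) h1
  have h3 : ∀ᶠ t in nhds (0 : ℝ), ‖f (u + t • x) - f (u + (0 : ℝ) • x)‖
      ≤ (α * d.toReal) * ‖t - 0‖ := by
    have hc : Filter.Tendsto (fun t : ℝ => u + t • x) (nhds 0) (nhds u) := by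
      simpa using h1.continuousAt.tendsto
    filter_upwards [hc.eventually hα] with t ht
    have e : (fun n => ‖ev (u + t • x) n - ev u n‖ₑ) = fun n => ‖t‖ₑ * ‖ev x n‖ₑ := by
      funext n
      rw [map_add, map_smul, Pi.add_apply, add_sub_cancel_left, Pi.smul_apply, enorm_smul]
    rw [e] at ht
    have h4 : ‖f (u + t • x) - f u‖ₑ ≤ ENNReal.ofReal (α * d.toReal * ‖t‖) := by
      refine ht.trans ((mul_le_mul_right (nD_const_mul_le _ _) _).trans (le_of_eq ?_))
      rw [ENNReal.ofReal_mul (by positivity), ENNReal.ofReal_mul (by positivity),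
        ENNReal.ofReal_toReal hdt, ENNReal.ofReal_coe_nnreal, ofReal_norm, mul_assoc,
        mul_comm ‖t‖ₑ]
    rw [← ofReal_norm, ENNReal.ofReal_le_ofReal_iff (by positivity)] at h4
    simpa using h4
  have h5 := h2.le_of_lip' (by positivity) h3
  rw [← ofReal_norm]
  refine (ENNReal.ofReal_le_ofReal h5).trans (le_of_eq ?_)
  rw [ENNReal.ofReal_mul (by positivity), ENNReal.ofReal_toReal hdt, ENNReal.ofReal_coe_nnreal]

/-- The signed sums of unit directions. -/
lemma sum_wt_enorm_le {f' : X δ N →L[ℝ] ℝ} {α : ℝ≥0}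
    (hα : ∀ x, ‖f' x‖ₑ ≤ α * nD δ N (fun n => ‖ev x n‖ₑ)) {z : ℂ} (hz : ‖z‖ = 1) :
    ∑' n, wt δ n * ‖f' (sg n z)‖ₑ ≤ α * ENNReal.ofReal N := by
  refine ENNReal.summable.tsum_le_of_sum_le fun S => ?_
  -- The signs make every term of f' x nonnegative, and the entries have modulus at most e^{δ|n|},
  -- so the dual norm of the test vector is at most N.
  let a : ℤ → ℝ := fun n => Real.exp (δ * |(n : ℝ)|) * SignType.sign (f' (sg n z))
  let x : X δ N := ∑ n ∈ S, sg n (a n * z)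
  have hfx : f' x = ∑ n ∈ S, Real.exp (δ * |(n : ℝ)|) * |f' (sg n z)| := by
    simp only [x, map_sum]
    refine Finset.sum_congr rfl fun n _ => ?_
    have e : ((a n : ℂ) * z) = a n • z := by simp
    rw [e, map_smul, map_smul, smul_eq_mul]
    simp only [a]
    rw [mul_assoc, sign_mul_self]
  have hx : ∀ n, ‖ev x n‖ₑ ≤ wt δ n * 1 := by
    intro n
    have e : ev x n = if n ∈ S then (a n : ℂ) * z else 0 := by
      simp only [x, map_sum, Finset.sum_apply, ev_sg, Pi.single_apply]
      simp
    rw [e, mul_one]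
    split_ifs
    · rw [← ofReal_norm, wt, norm_mul, hz, mul_one, Complex.norm_real]
      refine ENNReal.ofReal_le_ofReal ?_
      simp only [a, norm_mul]
      rw [Real.norm_of_nonneg (Real.exp_pos _).le]
      refine mul_le_of_le_one_right (Real.exp_pos _).le ?_
      rcases lt_trichotomy (f' (sg n z)) 0 with h | h | h
      · simp [sign_neg h]
      · simp [h]
      · simp [sign_pos h]
    · simp
  have h1 := (hα x).trans (mul_le_mul_right (nD_le_of_le_wt hN.out hx) _)
  rw [mul_one] at h1
  refine le_trans (le_of_eq ?_) h1
  rw [hfx, ← ofReal_norm, Real.norm_of_nonneg (Finset.sum_nonneg fun _ _ => by positivity),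
    ENNReal.ofReal_sum_of_nonneg fun _ _ => by positivity]
  refine Finset.sum_congr rfl fun n _ => ?_
  rw [ENNReal.ofReal_mul (Real.exp_pos _).le, wt, ← ofReal_norm, Real.norm_eq_abs]

/-- A single unit direction has dual norm at most e^{-δ|n|}; together with `sum_wt_enorm_le` this
controls both halves of `nB` of the gradient. -/
lemma wt_mul_enorm_le {f' : X δ N →L[ℝ] ℝ} {α : ℝ≥0}
    (hα : ∀ x, ‖f' x‖ₑ ≤ α * nD δ N (fun n => ‖ev x n‖ₑ)) {z : ℂ} (hz : ‖z‖ = 1) (n : ℤ) :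
    wt δ n * ‖f' (sg n z)‖ₑ ≤ α := by
  have hz' : ‖z‖ₑ = 1 := by rw [← ofReal_norm, hz, ENNReal.ofReal_one]
  have h1 := hα (sg n z)
  have e : (fun m => ‖ev (sg n z : X δ N) m‖ₑ) = Pi.single n 1 := by
    funext m
    rw [ev_sg]
    exact enorm_single hz' n m
  rw [e] at h1
  calc wt δ n * ‖f' (sg n z)‖ₑ ≤ wt δ n * (α * nD δ N (Pi.single n 1)) := by gcongr
    _ = α * (wt δ n * nD δ N (Pi.single n 1)) := by ring
    _ ≤ α * 1 := by gcongr; exact nD_single_le n 1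
    _ = α := mul_one _

/-! ### Differentiability -/

variable {r : ℝ≥0}

lemma differentiable_reForm {k : ℕ} {M : ℝ≥0} {c : (Fin k → ℤ) → ℂ} (h : Bdd δ N M c)
    (cj : Fin k → Bool) : Differentiable ℝ fun u : X δ N => reForm c cj u :=
  h.differentiable_form cj

lemma differentiable_quad (hδ : 0 < δ) : Differentiable ℝ fun u : X δ N => quad u :=
  differentiable_reForm (bdd_kerQuad hδ.le hN.out (enorm_sq_le_wt hδ)) cj2

lemma IsSmall.differentiableAt_flow2 (h : IsSmall N r) (hδ : 0 ≤ δ) {u : X δ N}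
    (hu : ‖u‖ < r / 6) : DifferentiableAt ℝ (fun u => flow2 hδ r u 1) u :=
  (h.field2 hδ).differentiableAt_flow (by norm_num) hu

lemma IsSmall.differentiableAt_normalX (h : IsSmall N r) (hδ : 0 ≤ δ) (hσ : |σ| = 1) {u : X δ N}
    (hu : ‖u‖ < r / 6) : DifferentiableAt ℝ (fun u => normalX hδ hσ r u) u := by
  have hr : (0 : ℝ) < r := by exact_mod_cast h.pos
  have hx : ‖flow2 hδ r u 1‖ < r / 2 :=
    (h.norm_flow2_le hδ hu.le ⟨zero_le_one, le_rfl⟩).trans_lt (by linarith)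
  exact DifferentiableAt.comp (g := fun x => flow1 hδ hσ r x 1) u
    ((h.field1 hδ hσ).differentiableAt_flow (by norm_num) hx) (h.differentiableAt_flow2 hδ hu)

lemma IsSmall.differentiableAt_remX (h : IsSmall N r) (hδ : 0 < δ) (hσ : |σ| = 1) {u : X δ N}
    (hu : ‖u‖ < r / 6) : DifferentiableAt ℝ (remX hδ.le hσ r) u := by
  have d2 := h.differentiableAt_flow2 hδ.le hu
  have d1 := h.differentiableAt_normalX hδ.le hσ hu
  have q := differentiable_quad (N := N) hδ
  have c : ∀ {k : ℕ} {M : ℝ≥0} {c : (Fin k → ℤ) → ℂ} (_ : Bdd δ N M c) (cj : Fin k → Bool)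
      {g : X δ N → X δ N} (_ : DifferentiableAt ℝ g u),
      DifferentiableAt ℝ (fun u => reForm c cj (g u)) u := fun hb cj _ hg =>
    DifferentiableAt.comp (g := fun u => reForm _ cj u) u (differentiable_reForm hb cj _) hg
  have q' : ∀ {g : X δ N → X δ N} (_ : DifferentiableAt ℝ g u),
      DifferentiableAt ℝ (fun u => quad (g u)) u := fun hg =>
    DifferentiableAt.comp (g := fun u => quad u) u (q _) hg
  exact ((((((q' d1).add ((c (bdd_of_enorm_le_one hδ.le hN.out enorm_kH_le) cj4 d1).const_mul σ)).sub
    (q' d2)).sub ((c (bdd_kZ hδ.le) cj6 d2).const_mul 2)).add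
    (((q' d2).add ((c (bdd_kZnr hδ.le) cj6 d2).const_mul 2)).sub (q u))).add
    ((c (bdd_kZr hδ.le) cj6 d2).const_mul 2)).sub
    ((c (bdd_of_enorm_le_one hδ.le hN.out enorm_kDiag_le) cj4 d1).const_mul σ)

/-- Multiplication of a real functional by `i`. -/
def iMul (f : X δ N →L[ℝ] ℝ) : X δ N →L[ℝ] ℂ := (f.smulRight Complex.I : X δ N →L[ℝ] ℂ)

lemma iMul_apply (f : X δ N →L[ℝ] ℝ) (x : X δ N) : iMul f x = Complex.I * (f x : ℂ) := by
  simp [iMul, mul_comm]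

lemma hasFDerivAt_iMul {f : X δ N → ℝ} {f' : X δ N →L[ℝ] ℝ} {u : X δ N} (h : HasFDerivAt f f' u) :
    HasFDerivAt (fun u => Complex.I * (f u : ℂ)) (iMul f') u := by
  have := h.smul_const Complex.I
  simp only [Complex.real_smul, mul_comm _ Complex.I] at this
  exact this

lemma IsSmall.eventually_norm_lt {u : X δ N} (hu : ‖u‖ < r / 6) :
    ∀ᶠ x in nhds u, ‖x‖ < r / 6 :=
  (continuous_norm.tendsto u).eventually (gt_mem_nhds hu)

lemma IsSmall.hasFDerivAt_remainder (h : IsSmall N r) (hδ : 0 < δ) (hσ : |σ| = 1) {u : X δ N}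
    (hu : ‖u‖ < r / 6) : HasFDerivAt (fun u : X δ N => remainder σ (ev u))
      (iMul (fderiv ℝ (remX hδ.le hσ r) u)) u := by
  refine (hasFDerivAt_iMul (h.differentiableAt_remX hδ hσ hu).hasFDerivAt).congr_of_eventuallyEq ?_
  filter_upwards [IsSmall.eventually_norm_lt hu] with x hx
  exact h.remainder_eq hδ hσ hx.le

/-- The bound for the error term. -/
lemma IsSmall.wnorm_errorTerm_le (h : IsSmall N r) (hδ : 0 < δ) (hσ : |σ| = 1) {u : X δ N}
    (hu : ‖u‖ < r / 6) {p : ℝ≥0∞} (hp : 1 ≤ p) :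
    wnorm p δ (errorTerm σ (ev u)) ≤ ENNReal.ofReal (2 * lipRem N r * N ^ (p⁻¹).toReal) := by
  set f' := fderiv ℝ (remX hδ.le hσ r) u with hf'
  have hα := enorm_fderiv_le hδ.le (h.differentiableAt_remX hδ hσ hu).hasFDerivAt
    (α := lipRem N r) (by
      filter_upwards [IsSmall.eventually_norm_lt hu] with x hx
      exact h.remX_sub_le hδ hσ hx.le hu.le)
  rw [← hf'] at hα
  have hE : ∀ n, ‖errorTerm σ (ev u) n‖ₑ ≤ ‖f' (sg n 1)‖ₑ + ‖f' (sg n Complex.I)‖ₑ := by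
    intro n
    rw [errorTerm, dbar_eq (h.hasFDerivAt_remainder hδ hσ hu), iMul_apply, iMul_apply]
    exact enorm_half_I_le
  have hI : ‖Complex.I‖ = 1 := Complex.norm_I
  refine (wnorm_le (A := 2 * lipRem N r) hN.out (fun n => ?_) ?_ hp).trans (le_of_eq (by simp))
  · calc wt δ n * ‖errorTerm σ (ev u) n‖ₑ
        ≤ wt δ n * ‖f' (sg n 1)‖ₑ + wt δ n * ‖f' (sg n Complex.I)‖ₑ := by
          rw [← mul_add]; gcongr; exact hE n
      _ ≤ lipRem N r + lipRem N r :=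
          add_le_add (wt_mul_enorm_le hα norm_one n) (wt_mul_enorm_le hα hI n)
      _ = _ := by push_cast; ring
  · calc ∑' n, wt δ n * ‖errorTerm σ (ev u) n‖ₑ
        ≤ ∑' n, (wt δ n * ‖f' (sg n 1)‖ₑ + wt δ n * ‖f' (sg n Complex.I)‖ₑ) := by
          refine ENNReal.tsum_le_tsum fun n => ?_
          rw [← mul_add]; gcongr; exact hE n
      _ ≤ lipRem N r * ENNReal.ofReal N + lipRem N r * ENNReal.ofReal N := by
          rw [ENNReal.tsum_add]
          exact add_le_add (sum_wt_enorm_le hα norm_one) (sum_wt_enorm_le hα hI)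
      _ = _ := by push_cast; ring

/-! ### The integrable part of the equation -/

lemma exists_hasFDerivAt_kerQuad {M : ℝ≥0} {d : ℤ → ℝ} (hd : Bdd δ N M (kerQuad d)) (u : X δ N) :
    ∃ f' : X δ N →L[ℝ] ℝ, HasFDerivAt (fun u : X δ N => reForm (kerQuad d) cj2 u) f' u ∧
      ∀ n z, f' (sg n z) = 2 * d n * (z * conj (ev u n)).re := by
  refine ⟨_, (Complex.reCLM.hasFDerivAt.comp u (hasFDerivAt_diag (formL hd cj2) u)), fun n z => ?_⟩
  rw [ContinuousLinearMap.comp_apply, linearDeriv_diag_apply, Fin.sum_univ_two]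
  simp only [formL_apply, update_ev_comp, ev_sg, form_kerQuad_single_zero, form_kerQuad_single_one]
  simp
  ring

/-- The remainder is Fréchet differentiable, so the derivative splits. The explicit part contributes
n² from Λ₂ and, by the chain rule for P², the coefficient 4σP; the rest is `errorTerm` by
definition. -/
lemma IsSmall.dbar_transformed (h : IsSmall N r) (hδ : 0 < δ) (hσ : |σ| = 1) {u : X δ N}
    (hu : ‖u‖ < r / 6) (n : ℤ) :
    DifferentiableAt ℝ
        (fun z : ℂ => transformedHamiltonian σ (Function.update (ev u) n z)) (ev u n) ∧
      dbar (transformedHamiltonian σ) (ev u) n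
        = Complex.I * ((n : ℂ) ^ 2 + 4 * σ * (mass (ev u) : ℂ)) * ev u n
          + errorTerm σ (ev u) n := by
  obtain ⟨q', hq, hqn⟩ := exists_hasFDerivAt_kerQuad
    (bdd_kerQuad hδ.le hN.out (enorm_sq_le_wt hδ)) u
  obtain ⟨m', hm, hmn⟩ := exists_hasFDerivAt_kerQuad
    (bdd_kerQuad hδ.le hN.out (enorm_one_le_wt hδ.le)) u
  have hR := h.hasFDerivAt_remainder hδ hσ hu
  set R' := iMul (fderiv ℝ (remX hδ.le hσ r) u)
  have hT : HasFDerivAt (fun u : X δ N => transformedHamiltonian σ (ev u))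
      (iMul (q' + (4 * σ * mass (ev u)) • m') + R') u := by
    have h1 : HasFDerivAt (fun u : X δ N => quad u + 2 * σ * (reForm (kerQuad fun _ => 1) cj2 u) ^ 2)
        (q' + (4 * σ * mass (ev u)) • m') u := by
      refine (hq.add ((hm.pow 2).const_mul (2 * σ))).congr_fderiv ?_
      rw [mass_eq hδ.le]
      ext x
      simp [reForm]
      ring
    refine ((hasFDerivAt_iMul h1).add hR).congr_of_eventuallyEq (Filter.Eventually.of_forall ?_)
    intro x
    simp only [Pi.add_apply]
    rw [remainder, resonantPart, quadPart_eq hδ, mass_eq hδ.le]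
    change _ = Complex.I * ((quad x + 2 * σ * (reForm (kerQuad fun _ => 1) cj2 x) ^ 2 : ℝ) : ℂ)
      + (_ - Complex.I * (quad x : ℂ)
        - 2 * σ * Complex.I * (reForm (kerQuad fun _ => 1) cj2 x : ℂ) ^ 2)
    push_cast
    ring
  refine ⟨(hasFDerivAt_update hT n).differentiableAt, ?_⟩
  rw [dbar_eq hT, errorTerm, dbar_eq hR]
  simp only [add_apply, smul_apply, iMul_apply, hqn, hmn, smul_eq_mul]
  have e1 := half_I_eq ((n : ℝ) ^ 2) (ev u n)
  have e2 := half_I_eq 1 (ev u n)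
  push_cast at e1 e2 ⊢
  linear_combination e1 + (4 * σ * (mass (ev u) : ℂ)) * e2

end Gradient

/-! ### Choice of the parameters -/

section Parameters

lemma kapN_le {ε γ : ℝ} (hε : 0 < ε) (hε1 : ε < 1) (hγ : 0 < γ) :
    (kapN ε⁻¹ : ℝ) ≤ (5 + 2 / γ) * ε ^ (-γ) := by
  have hlog : Real.log ε⁻¹ ≤ ε⁻¹ ^ γ / γ := Real.log_le_rpow_div (by positivity) hγ
  have hpos : 0 ≤ Real.log ε⁻¹ := Real.log_nonneg ((one_le_inv₀ hε).mpr hε1.le)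
  have h1 : (1 : ℝ) ≤ ε ^ (-γ) := by
    rw [Real.rpow_neg hε.le, one_le_inv₀ (by positivity)]
    exact Real.rpow_le_one hε.le hε1.le hγ.le
  rw [kapN, Real.coe_toNNReal _ (by positivity)]
  rw [Real.inv_rpow hε.le, ← Real.rpow_neg hε.le] at hlog
  calc 5 + 2 * Real.log ε⁻¹ ≤ 5 * ε ^ (-γ) + 2 * (ε ^ (-γ) / γ) := by linarith
    _ = _ := by ring

lemma one_le_kapN {ε : ℝ} (hε : 0 < ε) (hε1 : ε < 1) : 1 ≤ (kapN ε⁻¹ : ℝ) := by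
  have hpos : 0 ≤ Real.log ε⁻¹ := Real.log_nonneg ((one_le_inv₀ hε).mpr hε1.le)
  rw [kapN, Real.coe_toNNReal _ (by positivity)]
  linarith

/-- The radius for the parameters `ε`, `C`. -/
def radius (C ε : ℝ) : ℝ≥0 := (12 * C * √ε).toNNReal

variable {C ε : ℝ}

lemma coe_radius (hC : 0 < C) : (radius C ε : ℝ) = 12 * C * √ε :=
  Real.coe_toNNReal _ (by positivity)

lemma coe_toNNReal_inv (hε : 0 < ε) : ((ε⁻¹).toNNReal : ℝ) = (√ε ^ 2)⁻¹ := by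
  rw [Real.coe_toNNReal _ (by positivity), Real.sq_sqrt hε.le]

/-- With N = 1/ε and r of order √ε, `lip1` is of order ε κ² and `lip2` of order ε κ³, where κ is the
logarithmic factor. Both are at most B√ε, and ε₀ is chosen so that B√ε ≤ 1/2. -/
lemma exists_isSmall (hC : 0 < C) :
    ∃ ε₀ ∈ Set.Ioo (0 : ℝ) 1, ∀ ε ∈ Set.Ioo (0 : ℝ) ε₀, IsSmall ε⁻¹ (radius C ε) := by
  set B : ℝ := 17 ^ 3 * (48 * 144 * C ^ 2 + 4800 * 12 ^ 4 * C ^ 4) with hB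
  have hB0 : 0 < B := by positivity
  refine ⟨(1 / (2 * (B + 1))) ^ 2, ⟨by positivity, ?_⟩, fun ε hε => ?_⟩
  · refine pow_lt_one₀ (by positivity) ?_ two_ne_zero
    rw [div_lt_one (by positivity)]
    linarith
  · have hε0 := hε.1
    have hs0 : 0 < √ε := Real.sqrt_pos.mpr hε0
    have hs : √ε < 1 / (2 * (B + 1)) := by
      rw [Real.sqrt_lt' (by positivity)]
      exact hε.2
    have hε1 : ε < 1 := by
      refine hε.2.trans (pow_lt_one₀ (by positivity) ?_ two_ne_zero)
      rw [div_lt_one (by positivity)]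
      linarith
    have hBs : B * √ε ≤ 1 / 2 := by
      rw [lt_div_iff₀ (by positivity)] at hs
      nlinarith
    set κ := (kapN ε⁻¹ : ℝ) with hκ
    have hκ1 : 1 ≤ κ := one_le_kapN hε0 hε1
    have hκ3 : ε * κ ^ 3 ≤ 17 ^ 3 * √ε := by
      -- The exponent 1/6 makes the cube equal to ε^{-1/2}; the constant is 5 + 2·6 = 17.
      have h1 := kapN_le hε0 hε1 (γ := 1 / 6) (by norm_num)
      rw [← hκ] at h1
      calc ε * κ ^ 3 ≤ ε * ((5 + 2 / (1 / 6)) * ε ^ (-(1 / 6) : ℝ)) ^ 3 := by gcongr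
        _ = 17 ^ 3 * (ε * (ε ^ (-(1 / 6) : ℝ)) ^ 3) := by ring
        _ = 17 ^ 3 * √ε := by
            have e : (ε ^ (-(1 / 6) : ℝ)) ^ 3 = ε ^ (-(1 / 2) : ℝ) := by
              rw [← Real.rpow_natCast, ← Real.rpow_mul hε0.le]
              norm_num
            rw [e, Real.sqrt_eq_rpow]
            congr 1
            nth_rewrite 1 [← Real.rpow_one ε]
            rw [← Real.rpow_add hε0]
            norm_num
    have hκ2 : ε * κ ^ 2 ≤ 17 ^ 3 * √ε := by
      refine le_trans ?_ hκ3
      gcongr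
      norm_num
    have hss : √ε ^ 2 = ε := Real.sq_sqrt hε0.le
    refine ⟨?_, ?_, ?_⟩
    · rw [radius, Real.toNNReal_pos]
      positivity
    · rw [← NNReal.coe_le_coe, lip1]
      push_cast
      rw [coe_radius hC, ← hκ]
      calc 48 * κ ^ 2 * (12 * C * √ε) ^ 2 = 48 * 144 * C ^ 2 * (ε * κ ^ 2) := by
            rw [mul_pow, hss]; ring
        _ ≤ 48 * 144 * C ^ 2 * (17 ^ 3 * √ε) := by gcongr
        _ ≤ B * √ε := by
            rw [hB]
            have : 0 ≤ 17 ^ 3 * (4800 * 12 ^ 4 * C ^ 4) * √ε := by positivity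
            linarith
        _ ≤ 1 / 2 := hBs
    · rw [← NNReal.coe_le_coe, lip2]
      push_cast
      rw [coe_radius hC, ← hκ, coe_toNNReal_inv hε0, hss]
      calc 4800 * ε⁻¹ * κ ^ 3 * (12 * C * √ε) ^ 4
          = 4800 * 12 ^ 4 * C ^ 4 * (ε⁻¹ * (√ε ^ 2) ^ 2 * κ ^ 3) := by ring
        _ = 4800 * 12 ^ 4 * C ^ 4 * (ε * κ ^ 3) := by
            rw [hss]; congr 2; field_simp
        _ ≤ 4800 * 12 ^ 4 * C ^ 4 * (17 ^ 3 * √ε) := by gcongr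
        _ ≤ B * √ε := by
            rw [hB]
            have : 0 ≤ 17 ^ 3 * (48 * 144 * C ^ 2) * √ε := by positivity
            linarith
        _ ≤ 1 / 2 := hBs

/-- The constant in the bound for the remainder. -/
def remConst (C : ℝ) : ℝ :=
  (442368 * (12 * C) ^ 4 + 22118400 * (12 * C) ^ 6 + 7680 * (12 * C) ^ 2 + 128) * (12 * C) ^ 3

/-- In each summand the powers of N = 1/ε and of r combine to √ε³, leaving κ to the powers 4, 5, 3
and 0, all at most κ⁵. -/
lemma lipRem_le (hC : 0 < C) (hε : 0 < ε) (hε1 : ε < 1) :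
    (lipRem ε⁻¹ (radius C ε) : ℝ) ≤ remConst C * (kapN ε⁻¹ : ℝ) ^ 5 * √ε ^ 3 := by
  have hs0 : 0 < √ε := Real.sqrt_pos.mpr hε
  have hκ1 := one_le_kapN hε hε1
  simp only [lipRem, lip1, lip2, beta2, betaZ]
  push_cast
  rw [coe_radius hC, coe_toNNReal_inv hε, remConst]
  set κ := (kapN ε⁻¹ : ℝ)
  set s := √ε
  set c := 12 * C
  have hc : 0 < c := by positivity
  have e : 288 * ((s ^ 2)⁻¹ ^ 2 * κ ^ 2 * (48 * κ ^ 2 * (c * s) ^ 2 * (2 * (c * s)) ^ 5)) +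
      144 * ((s ^ 2)⁻¹ ^ 2 * κ ^ 2 * (4800 * (s ^ 2)⁻¹ * κ ^ 3 * (c * s) ^ 4 * (2 * (c * s)) ^ 5)) +
      24 * (10 * (s ^ 2)⁻¹ * κ ^ 3 * (2 * (c * s)) ^ 5) + 16 * (2 * (c * s)) ^ 3
      = (442368 * c ^ 4 * κ ^ 4 + 22118400 * c ^ 6 * κ ^ 5 + 7680 * c ^ 2 * κ ^ 3 + 128 * κ ^ 0)
        * c ^ 3 * s ^ 3 := by
    field_simp
    ring
  rw [e]
  have hp : ∀ j ≤ 5, κ ^ j ≤ κ ^ 5 := fun j hj => pow_le_pow_right₀ hκ1 hj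
  calc _ ≤ (442368 * c ^ 4 * κ ^ 5 + 22118400 * c ^ 6 * κ ^ 5 + 7680 * c ^ 2 * κ ^ 5 + 128 * κ ^ 5)
        * c ^ 3 * s ^ 3 := by
        gcongr ?_ * c ^ 3 * s ^ 3
        gcongr 442368 * c ^ 4 * ?_ + _ + 7680 * c ^ 2 * ?_ + 128 * ?_
        · exact hp 4 (by norm_num)
        · exact hp 3 (by norm_num)
        · exact hp 0 (by norm_num)
    _ = _ := by ring

/-- The logarithm enters to the fifth power, so each factor may lose ε^{-γ/5}; the power of ε⁻¹
comes from interpolation, with x = 1/p. -/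
lemma error_const_le (hC : 0 < C) (hε : 0 < ε) (hε1 : ε < 1) {γ : ℝ} (hγ : 0 < γ) (x : ℝ) :
    2 * lipRem ε⁻¹ (radius C ε) * ε⁻¹ ^ x
      ≤ 2 * remConst C * (5 + 2 / (γ / 5)) ^ 5 * ε ^ ((3 : ℝ) / 2 - x - γ) := by
  have hR : 0 ≤ remConst C := by unfold remConst; positivity
  have h1 := kapN_le hε hε1 (γ := γ / 5) (by positivity)
  have e1 : (ε ^ (-(γ / 5))) ^ 5 = ε ^ (-γ) := by
    rw [← Real.rpow_natCast, ← Real.rpow_mul hε.le]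
    congr 1
    push_cast
    ring
  have e2 : √ε ^ 3 = ε ^ ((3 : ℝ) / 2) := by
    rw [Real.sqrt_eq_rpow, ← Real.rpow_natCast, ← Real.rpow_mul hε.le]
    norm_num
  have e3 : ε⁻¹ ^ x = ε ^ (-x) := by rw [Real.inv_rpow hε.le, Real.rpow_neg hε.le]
  calc 2 * (lipRem ε⁻¹ (radius C ε) : ℝ) * ε⁻¹ ^ x
      ≤ 2 * (remConst C * ((5 + 2 / (γ / 5)) * ε ^ (-(γ / 5))) ^ 5 * √ε ^ 3) * ε⁻¹ ^ x := by
        gcongr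
        exact (lipRem_le hC hε hε1).trans (by gcongr)
    _ = 2 * remConst C * (5 + 2 / (γ / 5)) ^ 5 * (ε ^ ((3 : ℝ) / 2) * ε ^ (-x) * ε ^ (-γ)) := by
        rw [mul_pow, e1, e2, e3]; ring
    _ = _ := by
        rw [← Real.rpow_add hε, ← Real.rpow_add hε]
        congr 2

variable {δ : ℝ}

/-- The class of data in terms of the norm `nB`. -/
lemma nB_le_of_mem_dataSet (hC : 0 < C) (hε : 0 < ε) (hε1 : ε < 1) {v : ℤ → ℂ}
    (hv : v ∈ dataSet δ ε C) : nB δ ε⁻¹ (fun n => ‖v n‖ₑ) ≤ ENNReal.ofReal (C * √ε) := by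
  have hN : 1 ≤ ε⁻¹ := (one_le_inv₀ hε).mpr hε1.le
  refine nB_le hN (fun n => ?_) ?_
  · have h := hv ∞ le_top
    rw [ENNReal.inv_top, ENNReal.toReal_zero, sub_zero, ← Real.sqrt_eq_rpow, wnorm,
      MeasureTheory.eLpNorm_exponent_top] at h
    rw [← enorm_exp_smul]
    refine le_trans ?_ h
    have h2 := MeasureTheory.enorm_ae_le_eLpNormEssSup
      (fun n : ℤ => Real.exp (δ * |(n : ℝ)|) • v n) MeasureTheory.Measure.count
    rw [MeasureTheory.Measure.ae_count_iff] at h2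
    exact h2 n
  · have h := hv 1 le_rfl
    rw [wnorm, MeasureTheory.eLpNorm_one_eq_lintegral_enorm, MeasureTheory.lintegral_count] at h
    simp only [enorm_exp_smul] at h
    refine h.trans (le_of_eq ?_)
    rw [← ENNReal.ofReal_mul (by positivity)]
    congr 1
    rw [inv_one, ENNReal.toReal_one, Real.rpow_sub hε, Real.rpow_one, ← Real.sqrt_eq_rpow]
    field_simp

end Parameters

end QuasiLinear

end

/-! ### The proposition -/

theorem proposition2 (σ : ℝ) (hσ : σ = 1 ∨ σ = -1) (C : ℝ) (hC : 0 < C) :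
    ∃ ε₀ ∈ Set.Ioo (0 : ℝ) 1,
      (∀ δ : ℝ, 0 < δ → ∀ ε ∈ Set.Ioo (0 : ℝ) ε₀, ∀ v ∈ dataSet δ ε C,
        HasUniqueFlowLine genF2 v ∧
        HasUniqueFlowLine (genF1 σ) (flowMap genF2 1 v) ∧
        ∀ n : ℤ,
          DifferentiableAt ℝ
            (fun z : ℂ => transformedHamiltonian σ (Function.update v n z)) (v n) ∧
          dbar (transformedHamiltonian σ) v n
            = Complex.I * ((n : ℂ) ^ 2 + 4 * σ * (mass v : ℂ)) * v n + errorTerm σ v n) ∧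
      ∀ p : ENNReal, 1 ≤ p → ∀ γ : ℝ, 0 < γ → ∃ K : ℝ,
        ∀ δ : ℝ, 0 < δ → ∀ ε ∈ Set.Ioo (0 : ℝ) ε₀, ∀ v ∈ dataSet δ ε C,
          wnorm p δ (errorTerm σ v)
            ≤ ENNReal.ofReal (K * ε ^ ((3 : ℝ) / 2 - (p⁻¹).toReal - γ)) := by
  have hσ' : |σ| = 1 := by rcases hσ with rfl | rfl <;> simp
  obtain ⟨ε₀, hε₀, hsm⟩ := exists_isSmall hC
  -- Data become points in the interior of a ball of `X δ ε⁻¹`. The space depends on ε, so the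
  -- instance 1 ≤ ε⁻¹ is produced along with the point.
  have key : ∀ δ : ℝ, ∀ ε ∈ Set.Ioo (0 : ℝ) ε₀, ∀ v ∈ dataSet δ ε C,
      ∃ (_ : Fact (1 ≤ ε⁻¹)) (u : X δ ε⁻¹), ev u = v ∧ ‖u‖ < (radius C ε : ℝ) / 6 := by
    intro δ ε hε v hv
    have hε1 : ε < 1 := hε.2.trans hε₀.2
    have hN : 1 ≤ ε⁻¹ := (one_le_inv₀ hε.1).mpr hε1.le
    have hs : 0 < √ε := Real.sqrt_pos.mpr hε.1
    have hnB := nB_le_of_mem_dataSet hC hε.1 hε1 hv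
    refine ⟨⟨hN⟩, @mkX δ ε⁻¹ ⟨hN⟩ v (ne_top_of_le_ne_top ENNReal.ofReal_ne_top hnB), ?_, ?_⟩
    · exact @ev_mkX δ ε⁻¹ ⟨hN⟩ v _
    · have : Fact (1 ≤ ε⁻¹) := ⟨hN⟩
      rw [coe_radius hC]
      refine lt_of_le_of_lt ((X.norm_le_iff (M := C * √ε) (by positivity)).mpr ?_) ?_
      · rwa [ev_mkX]
      -- One sixth of the radius is 2C√ε, strictly more than the size C√ε of the data;
      -- differentiability needs the strict inequality.
      · nlinarith [mul_pos hC hs]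
  refine ⟨ε₀, hε₀, fun δ hδ ε hε v hv => ?_, fun p hp γ hγ => ?_⟩
  · obtain ⟨hN, u, rfl, hu⟩ := key δ ε hε v hv
    have h := hsm ε hε
    refine ⟨h.hasUniqueFlowLine_genF2 hδ.le hu.le, ?_, fun n => h.dbar_transformed hδ hσ' hu n⟩
    rw [h.flowMap_genF2 hδ.le hu.le]
    exact h.hasUniqueFlowLine_genF1 hδ.le hσ' (h.norm_flow2_one_le hδ.le hu.le)
  · refine ⟨2 * remConst C * (5 + 2 / (γ / 5)) ^ 5, fun δ hδ ε hε v hv => ?_⟩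
    obtain ⟨hN, u, rfl, hu⟩ := key δ ε hε v hv
    refine ((hsm ε hε).wnorm_errorTerm_le hδ hσ' hu hp).trans (ENNReal.ofReal_le_ofReal ?_)
    exact error_const_le hC hε.1 (hε.2.trans hε₀.2) hγ _
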